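/- Let $(M,g)$ be a (nonempty) compact smooth Riemannian manifold without boundary, of dimension $n\ge 3$, with scalar curvature $s_g$ and volume measure $\mu_g$. Let $m\ge 1$ be an integer, $a=\frac{4(m+n-1)}{m+n-2}$ and $p=\frac{2(m+n)}{m+n-2}$. Let $H=H^1_g(M)$ be the Sobolev space, and let $u^+=\max\{u,0\}$ and $u^-=\min\{u,0\}$. For $\varepsilon>0$ and $u,v\in H$ put $$\mathcal L_\varepsilon(u,v)=\frac1{\varepsilon^n}\int_M\Big[\varepsilon^2\langle\nabla_g u,\nabla_g v\rangle_g+\Big(\frac{s_g}{a}\varepsilon^2+1\Big)uv\Big]d\mu_g,\qquad |u|_{p,\varepsilon}=\Big(\frac1{\varepsilon^n}\int_M|u|^p\,d\mu_g\Big)^{1/p},$$ $$J_\varepsilon(u)=\frac1{\varepsilon^n}\int_M\Big[\frac12\varepsilon^2|\nabla_g u|_g^2+\frac12\Big(\frac{s_g}{a}\varepsilon^2+1\Big)u^2-\frac1p|u|^p\Big]d\mu_g,$$ $$\mathcal N_\varepsilon=\{u\in H\setminus\{0\}:\mathcal L_\varepsilon(u,u)=|u|_{p,\varepsilon}^p\},\qquad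 \mathcal E_\varepsilon=\{u\in H: u^+,u^-\in\mathcal N_\varepsilon\},$$ $$\mathbf m_\varepsilon=\inf_{\mathcal N_\varepsilon}J_\varepsilon,\qquad \mathbf d_\varepsilon=\inf_{\mathcal E_\varepsilon}J_\varepsilon.$$ Then for every $\varepsilon>0$ such that $1+\frac{s_g}{a}\varepsilon^2>c_\varepsilon$ on $M$ for some constant $c_\varepsilon>0$, there exists $u_\varepsilon\in\mathcal E_\varepsilon$ with $J_\varepsilon(u_\varepsilon)=\mathbf d_\varepsilon$, so that the infimum $\mathbf d_\varepsilon$ is attained, and $u_\varepsilon$ is a sign-changing weak solution of $$-\varepsilon^2\Delta_g u+\Big(\frac{s_g}{a}\varepsilon^2+1\Big)u=|u|^{p-2}u\quad\text{on } M,$$ that is, $u_\varepsilon$ is positive on a set of positive measure, negative on a set of positive measure, and $\mathcal L_\varepsilon(u_\varepsilon,v)=\frac1{\varepsilon^n}\int_M|u_\varepsilon|^{p-2}u_\varepsilon v\,d\mu_g$ for all $v\in H$. Moreover, the infimum $\mathbf m_\varepsilon$ is finite and $\mathbf d_\varepsilon\ge 2\,\mathbf m_\varepsilon$. -/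

import Mathlib

open scoped Manifold ContDiff ENNReal Topology
open MeasureTheory Filter Bundle

noncomputable section

namespace NodalYamabe

/-! ### Coordinate formulas for the curvature of a matrix-valued function `G = (g_ij)` -/

section Coordinates

variable {n : ℕ}

/-- The partial derivative `∂_i f (y)`. -/
def partialD (i : Fin n) (f : EuclideanSpace ℝ (Fin n) → ℝ) (y : EuclideanSpace ℝ (Fin n)) : ℝ :=
  fderiv ℝ f y (EuclideanSpace.single i 1)

/-- The Christoffel symbols
`Γ^k_ij = ½ ∑_l g^{kl} (∂_i g_jl + ∂_j g_il - ∂_l g_ij)`. -/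
def christoffel (G : EuclideanSpace ℝ (Fin n) → Matrix (Fin n) (Fin n) ℝ) (k i j : Fin n)
    (y : EuclideanSpace ℝ (Fin n)) : ℝ :=
  (1 / 2) * ∑ l, (G y)⁻¹ k l *
    (partialD i (fun z => G z j l) y + partialD j (fun z => G z i l) y
      - partialD l (fun z => G z i j) y)

/-- The Ricci curvature
`R_jk = ∑_i (∂_i Γ^i_jk - ∂_j Γ^i_ik) + ∑_{i,p} (Γ^i_ip Γ^p_jk - Γ^i_jp Γ^p_ik)`. -/
def ricci (G : EuclideanSpace ℝ (Fin n) → Matrix (Fin n) (Fin n) ℝ) (j k : Fin n)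
    (y : EuclideanSpace ℝ (Fin n)) : ℝ :=
  (∑ i, (partialD i (christoffel G i j k) y - partialD j (christoffel G i i k) y))
    + ∑ i, ∑ p, (christoffel G i i p y * christoffel G p j k y
        - christoffel G i j p y * christoffel G p i k y)

/-- The scalar curvature `∑_{j,k} g^{jk} R_jk` in coordinates. -/
def coordScalarCurvature (G : EuclideanSpace ℝ (Fin n) → Matrix (Fin n) (Fin n) ℝ)
    (y : EuclideanSpace ℝ (Fin n)) : ℝ :=
  ∑ j, ∑ k, (G y)⁻¹ j k * ricci G j k y

end Coordinates

/-! ### Riemannian geometry -/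

variable {n : ℕ} {M : Type*} [TopologicalSpace M] [ChartedSpace (EuclideanSpace ℝ (Fin n)) M]
  [IsManifold (𝓡 n) ∞ M]

/-- Smooth Riemannian metrics on the tangent bundle of the `n`-manifold `M`. -/
abbrev RMetric (n : ℕ) (M : Type*) [TopologicalSpace M]
    [ChartedSpace (EuclideanSpace ℝ (Fin n)) M] [IsManifold (𝓡 n) ∞ M] :=
  ContMDiffRiemannianMetric (𝓡 n) ∞ (EuclideanSpace ℝ (Fin n))
    (fun x : M => TangentSpace (𝓡 n) x)

/-- The components `g_ij = g(∂_i, ∂_j)` of the metric in the preferred chart at `c`, as functions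
on the target of that chart. -/
def gram (g : RMetric n M) (c : M) (y : EuclideanSpace ℝ (Fin n)) : Matrix (Fin n) (Fin n) ℝ :=
  Matrix.of fun i j =>
    g.inner ((extChartAt (𝓡 n) c).symm y)
      (mfderiv (𝓡 n) (𝓡 n) (extChartAt (𝓡 n) c).symm y (EuclideanSpace.single i (1 : ℝ)))
      (mfderiv (𝓡 n) (𝓡 n) (extChartAt (𝓡 n) c).symm y (EuclideanSpace.single j (1 : ℝ)))

/-- The scalar curvature `s_g`. It does not depend on the chart; at `x` it is computed in the
preferred chart at `x`. -/
def scalarCurvature (g : RMetric n M) (x : M) : ℝ :=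
  coordScalarCurvature (gram g x) (extChartAt (𝓡 n) x x)

/-- The measure `√(det g_ij) dy` of the chart at `c`, transported to `M`. -/
def chartVolume [MeasurableSpace M] (g : RMetric n M) (c : M) : Measure M :=
  Measure.map (extChartAt (𝓡 n) c).symm
    ((volume.restrict (extChartAt (𝓡 n) c).target).withDensity
      (fun y => ENNReal.ofReal (Real.sqrt (gram g c y).det)))

/-- The Riemannian volume measure `μ_g`. The chart measures agree on the overlaps of the charts,
so their supremum in the lattice of measures is the measure that restricts to each of them. -/
def vol [MeasurableSpace M] (g : RMetric n M) : Measure M :=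
  ⨆ c : M, chartVolume g c

/-- Every covector is `g(v, ·)` for some `v`, which is unique as `g` is positive definite. -/
theorem exists_sharp (g : RMetric n M) (x : M) (η : TangentSpace (𝓡 n) x →L[ℝ] ℝ) :
    ∃ v : TangentSpace (𝓡 n) x, ∀ w, g.inner x v w = η w := by
  let f : EuclideanSpace ℝ (Fin n) →ₗ[ℝ] Module.Dual ℝ (EuclideanSpace ℝ (Fin n)) :=
    { toFun := fun v => (g.inner x v).toLinearMap
      map_add' := fun v w => LinearMap.ext fun z => DFunLike.congr_fun ((g.inner x).map_add v w) z
      map_smul' := fun a v => LinearMap.ext fun z => DFunLike.congr_fun ((g.inner x).map_smul a v) z }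
  have hf : Function.Injective f := by
    rw [← LinearMap.ker_eq_bot, LinearMap.ker_eq_bot']
    intro v hv
    by_contra h
    have h1 := g.pos x v h
    have h2 : g.inner x v v = 0 := LinearMap.congr_fun hv v
    exact absurd h2 h1.ne'
  have hs : Function.Surjective f :=
    (LinearMap.injective_iff_surjective_of_finrank_eq_finrank
      (Subspace.dual_finrank_eq (K := ℝ) (V := EuclideanSpace ℝ (Fin n))).symm).1 hf
  obtain ⟨v, hv⟩ := hs η.toLinearMap
  exact ⟨v, fun w => LinearMap.congr_fun hv w⟩

/-- The gradient `∇_g φ` of a differentiable function: `g(∇_g φ, w) = dφ(w)`. -/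
def grad (g : RMetric n M) (φ : M → ℝ) (x : M) : TangentSpace (𝓡 n) x :=
  Classical.choose (exists_sharp g x (mfderiv (𝓡 n) 𝓘(ℝ, ℝ) φ x))

/-! ### The Sobolev space `H¹_g(M)` -/

variable [MeasurableSpace M]

/-- `u` lies in `H¹_g(M)`, the closure of `C^∞(M)` for the norm
`(∫ |∇_g u|_g² + u²)^{1/2}`, and the vector field `X` is its gradient. A vector field is measurable
when its derivatives of all smooth functions are; up to null sets there is at most one such `X`. -/
structure IsSobolevGradient (g : RMetric n M) (u : M → ℝ)
    (X : (x : M) → TangentSpace (𝓡 n) x) : Prop where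
  memLp : MemLp u 2 (vol g)
  measurable : ∀ φ : M → ℝ, ContMDiff (𝓡 n) 𝓘(ℝ, ℝ) ∞ φ →
    AEMeasurable (fun x => (mfderiv (𝓡 n) 𝓘(ℝ, ℝ) φ x (X x) : ℝ)) (vol g)
  approx : ∃ φ : ℕ → M → ℝ, (∀ k, ContMDiff (𝓡 n) 𝓘(ℝ, ℝ) ∞ (φ k)) ∧
    Tendsto (fun k => eLpNorm (u - φ k) 2 (vol g)) atTop (𝓝 0) ∧
    Tendsto (fun k => ∫⁻ x, ENNReal.ofReal
      (g.inner x (X x - grad g (φ k) x) (X x - grad g (φ k) x)) ∂(vol g)) atTop (𝓝 0)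

/-- The space `H_ε = H¹_g(M)`, as a set of functions (to be read modulo null sets). -/
def H1 (g : RMetric n M) : Set (M → ℝ) :=
  {u | ∃ X, IsSobolevGradient g u X}

open Classical in
/-- The gradient `∇_g u` of `u ∈ H¹_g(M)`. -/
def sobolevGrad (g : RMetric n M) (u : M → ℝ) : (x : M) → TangentSpace (𝓡 n) x :=
  if h : ∃ X, IsSobolevGradient g u X then Classical.choose h else fun _ => 0

/-! ### The variational problem -/

/-- `a_k = 4 (k - 1) / (k - 2)`. -/
def aConst (k : ℕ) : ℝ := 4 * ((k : ℝ) - 1) / ((k : ℝ) - 2)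

/-- `p_k = 2 k / (k - 2)`. -/
def pConst (k : ℕ) : ℝ := 2 * (k : ℝ) / ((k : ℝ) - 2)

/-- The potential `(s_g / a_{m+n}) ε² + 1`. -/
def potential (g : RMetric n M) (m : ℕ) (ε : ℝ) (x : M) : ℝ :=
  scalarCurvature g x / aConst (m + n) * ε ^ 2 + 1

/-- The bilinear form `𝓛_ε(u, v)`. -/
def bilin (g : RMetric n M) (m : ℕ) (ε : ℝ) (u v : M → ℝ) : ℝ :=
  1 / ε ^ n * ∫ x, (ε ^ 2 * g.inner x (sobolevGrad g u x) (sobolevGrad g v x)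
    + potential g m ε x * (u x * v x)) ∂(vol g)

/-- The norm `|u|_{q,ε}`. -/
def lqNorm (g : RMetric n M) (q ε : ℝ) (u : M → ℝ) : ℝ :=
  (1 / ε ^ n * ∫ x, |u x| ^ q ∂(vol g)) ^ (1 / q)

/-- The functional `J_ε`. -/
def energy (g : RMetric n M) (m : ℕ) (ε : ℝ) (u : M → ℝ) : ℝ :=
  1 / ε ^ n * ∫ x, (1 / 2 * ε ^ 2 * g.inner x (sobolevGrad g u x) (sobolevGrad g u x)
    + 1 / 2 * potential g m ε x * u x ^ 2
    - 1 / pConst (m + n) * |u x| ^ pConst (m + n)) ∂(vol g)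

/-- The Nehari manifold `𝓝_ε`. -/
def nehari (g : RMetric n M) (m : ℕ) (ε : ℝ) : Set (M → ℝ) :=
  {u | u ∈ H1 g ∧ ¬ u =ᵐ[vol g] 0 ∧
    bilin g m ε u u = lqNorm g (pConst (m + n)) ε u ^ pConst (m + n)}

/-- The set `𝓔_ε` of the `u ∈ H_ε` whose positive part `max(u, 0)` and negative part `min(u, 0)`
both lie on the Nehari manifold. -/
def nodalNehari (g : RMetric n M) (m : ℕ) (ε : ℝ) : Set (M → ℝ) :=
  {u | u ∈ H1 g ∧ (fun x => max (u x) 0) ∈ nehari g m ε ∧ (fun x => min (u x) 0) ∈ nehari g m ε}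

/-- `𝐦_ε = inf_{𝓝_ε} J_ε`. -/
def groundLevel (g : RMetric n M) (m : ℕ) (ε : ℝ) : ℝ :=
  sInf (energy g m ε '' nehari g m ε)

/-- `𝐝_ε = inf_{𝓔_ε} J_ε`. -/
def nodalLevel (g : RMetric n M) (m : ℕ) (ε : ℝ) : ℝ :=
  sInf (energy g m ε '' nodalNehari g m ε)

/-- `u ∈ H_ε` solves `-ε² Δ_g u + ((s_g / a_{m+n}) ε² + 1) u = |u|^{p-2} u` (weakly):
`𝓛_ε(u, v) = ε^{-n} ∫ |u|^{p-2} u v` for all `v ∈ H_ε`. -/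
def IsSolution (g : RMetric n M) (m : ℕ) (ε : ℝ) (u : M → ℝ) : Prop :=
  u ∈ H1 g ∧ ∀ v ∈ H1 g,
    Integrable (fun x => |u x| ^ (pConst (m + n) - 2) * u x * v x) (vol g) ∧
    bilin g m ε u v
      = 1 / ε ^ n * ∫ x, |u x| ^ (pConst (m + n) - 2) * u x * v x ∂(vol g)

/-- `u` takes positive values and negative values, each on a set of positive measure. -/
def SignChanging (g : RMetric n M) (u : M → ℝ) : Prop :=
  0 < vol g {x | 0 < u x} ∧ 0 < vol g {x | u x < 0}

end NodalYamabe

end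

noncomputable section

namespace NodalYamabe

/-! ### The Poincaré–Miranda theorem in the plane -/

/-! The minimum is found by the direct method on the nodal Nehari set, and the Euler-Lagrange
equation by a deformation argument.

On the Nehari set `J` is `1/2 - 1/p` times the (rescaled) integral of `|u|^p`, and the Sobolev
inequality keeps that integral away from zero. Since `m ≥ 1`, the exponent `p = p_{m+n}` lies
strictly below `2n/(n-2)`, so bounded sequences in `H¹` have subsequences converging in `L^p`. The
positive and the negative parts of a minimising sequence therefore converge separately, to nonzero
`v ≥ 0` and `w ≤ 0` with disjoint supports. The quadratic form may drop in the limit, so each limit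
is multiplied by a factor at most `1` to return to the Nehari set; this does not raise the energy,
and the sum of the two rescaled limits is a minimiser (`exists_nodal_minimizer`).

Because `u ↦ u⁺` is not differentiable, Lagrange multipliers are not available. If the derivative of
`J` at the minimiser `u` were negative in a direction `v`, one would look at `t u⁺ + s u⁻ + r v`
with `(t, s)` in a small square about `(1, 1)` and `r > 0` small. The Poincaré–Miranda theorem finds
`(t, s)` for which this function is in the nodal set. Its energy is below that of `t u⁺ + s u⁻`,
which is at most that of `u`: a contradiction (`slope_eq_zero_of_minimizer`). The bound on the
levels is additivity: `J(u) = J(u⁺) + J(u⁻)`, and both parts lie on the Nehari set.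

This argument takes place in a `CompactForm`. To obtain one, `GradientData` lists what is needed of
smooth functions: chain rule, closability of the gradient, Sobolev inequality and Rellich's theorem.
Closing the graph of the gradient in `L² × L²` gives the Sobolev space, which inherits these
properties and is stable under positive parts. On the manifold, `ChartCover` selects one chart at
each point measurably, so that a gradient becomes a function with values in Euclidean space. Bump
functions then reduce the Sobolev inequality, Rellich's theorem and closability to their Euclidean
versions.

Two objects are defined through varying charts and need invariance under changes of coordinates: the
scalar curvature, whose continuity bounds the potential (`continuous_scalarCurvature`), and the
volume, a supremum of chart measures (`vol_restrict_source`). -/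

theorem mem_Ioo_of_ne_endpoints {γ : ℝ → ℝ} (hγ : Continuous γ) {a b α β : ℝ}
    (h : ∀ x ∈ Set.uIcc a b, γ x ≠ α ∧ γ x ≠ β) (ha : γ a ∈ Set.Ioo α β) :
    γ b ∈ Set.Ioo α β := by
  have hiv := intermediate_value_uIcc (a := a) (b := b) hγ.continuousOn
  by_contra hb
  rw [Set.mem_Ioo, not_and_or, not_lt, not_lt] at hb
  rcases hb with hb | hb
  · obtain ⟨x, hx, hxe⟩ := hiv (Set.mem_uIcc.2 (Or.inr ⟨hb, ha.1.le⟩))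
    exact (h x hx).1 hxe
  · obtain ⟨x, hx, hxe⟩ := hiv (Set.mem_uIcc.2 (Or.inl ⟨ha.2.le, hb⟩))
    exact (h x hx).2 hxe

theorem isSimplyConnected_univ_prod : IsSimplyConnected (Set.univ : Set (ℝ × ℝ)) := by
  have : ContractibleSpace (Set.univ : Set (ℝ × ℝ)) :=
    (convex_univ (𝕜 := ℝ)).contractibleSpace Set.univ_nonempty
  exact SimplyConnectedSpace.ofContractible _

/-- The plane is simply connected, so a nowhere vanishing map has a continuous logarithm; the
imaginary part of the logarithm is the angle. -/
theorem exists_continuous_angle {F : ℝ × ℝ → ℂ} (hF : Continuous F) (h0 : ∀ z, F z ≠ 0) :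
    ∃ θ : ℝ × ℝ → ℝ, Continuous θ ∧ ∀ z, ∃ r : ℝ, 0 < r ∧ (F z).re = r * Real.cos (θ z) ∧
      (F z).im = r * Real.sin (θ z) := by
  obtain ⟨f, hf, he⟩ := Complex.exists_continuousOn_eqOn_exp_comp isSimplyConnected_univ_prod
    isOpen_univ hF.continuousOn (by rintro ⟨z, -, hz⟩; exact h0 z hz)
  refine ⟨fun z => (f z).im, Complex.continuous_im.comp (continuousOn_univ.1 hf), fun z => ?_⟩
  have := he (Set.mem_univ z)
  simp only [Function.comp] at this
  refine ⟨Real.exp (f z).re, Real.exp_pos _, ?_, ?_⟩ <;> rw [← this]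
  · rw [Complex.exp_re]
  · rw [Complex.exp_im]

/-- The **Poincaré–Miranda theorem** in dimension two. -/
theorem exists_zero_of_signs_on_boundary {f₁ f₂ : ℝ × ℝ → ℝ} (h₁ : Continuous f₁)
    (h₂ : Continuous f₂) {a b : ℝ} (hab : a ≤ b)
    (hl : ∀ y ∈ Set.Icc a b, 0 < f₁ (a, y)) (hr : ∀ y ∈ Set.Icc a b, f₁ (b, y) < 0)
    (hd : ∀ x ∈ Set.Icc a b, 0 < f₂ (x, a)) (hu : ∀ x ∈ Set.Icc a b, f₂ (x, b) < 0) :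
    ∃ x ∈ Set.Icc a b, ∃ y ∈ Set.Icc a b, f₁ (x, y) = 0 ∧ f₂ (x, y) = 0 := by
  by_contra hcon
  push Not at hcon
  -- Clamping the coordinates to `[a, b]` extends the pair `(f₁, f₂)` from the square to the whole
  -- plane without creating zeros, so that a global angle exists.
  let π' : ℝ → ℝ := fun x => (Set.projIcc a b hab x : ℝ)
  have hπc : Continuous π' := continuous_subtype_val.comp continuous_projIcc
  have hπm : ∀ x, π' x ∈ Set.Icc a b := fun x => (Set.projIcc a b hab x).2
  have hπ : ∀ x ∈ Set.Icc a b, π' x = x := fun x hx => by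
    simp only [π', Set.projIcc_of_mem hab hx]
  let F : ℝ × ℝ → ℂ := fun z => ⟨f₁ (π' z.1, π' z.2), f₂ (π' z.1, π' z.2)⟩
  have hFc : Continuous F := by
    have e : F = fun z => ((f₁ (π' z.1, π' z.2) : ℝ) : ℂ) + ((f₂ (π' z.1, π' z.2) : ℝ) : ℂ)
        * Complex.I := by
      funext z; exact Complex.ext (by simp [F]) (by simp [F])
    rw [e]
    fun_prop
  have hF0 : ∀ z, F z ≠ 0 := by
    intro z hz
    have h1 := congrArg Complex.re hz
    have h2 := congrArg Complex.im hz
    exact hcon _ (hπm z.1) _ (hπm z.2) h1 h2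
  obtain ⟨θ, hθ, hpol⟩ := exists_continuous_angle hFc hF0
  have haI : a ∈ Set.Icc a b := ⟨le_rfl, hab⟩
  have hbI : b ∈ Set.Icc a b := ⟨hab, le_rfl⟩
  have hcosl : ∀ y ∈ Set.Icc a b, 0 < Real.cos (θ (a, y)) := fun y hy => by
    obtain ⟨r, hr0, h, -⟩ := hpol (a, y)
    have := hl y hy
    simp only [F, hπ a haI, hπ y hy] at h
    rw [h] at this
    exact pos_of_mul_pos_right this hr0.le
  have hcosr : ∀ y ∈ Set.Icc a b, Real.cos (θ (b, y)) < 0 := fun y hy => by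
    obtain ⟨r, hr0, h, -⟩ := hpol (b, y)
    have := hr y hy
    simp only [F, hπ b hbI, hπ y hy] at h
    rw [h] at this
    exact neg_of_mul_neg_right this hr0.le
  have hsind : ∀ x ∈ Set.Icc a b, 0 < Real.sin (θ (x, a)) := fun x hx => by
    obtain ⟨r, hr0, -, h⟩ := hpol (x, a)
    have := hd x hx
    simp only [F, hπ a haI, hπ x hx] at h
    rw [h] at this
    exact pos_of_mul_pos_right this hr0.le
  have hsinu : ∀ x ∈ Set.Icc a b, Real.sin (θ (x, b)) < 0 := fun x hx => by
    obtain ⟨r, hr0, -, h⟩ := hpol (x, b)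
    have := hu x hx
    simp only [F, hπ b hbI, hπ x hx] at h
    rw [h] at this
    exact neg_of_mul_neg_right this hr0.le
  -- normalise the angle at the first corner
  obtain ⟨k, hk⟩ : ∃ k : ℤ, θ (a, a) - k * (2 * Real.pi) ∈ Set.Ico 0 (2 * Real.pi) := by
    refine ⟨toIcoDiv Real.two_pi_pos 0 (θ (a, a)), ?_⟩
    have := toIcoMod_mem_Ico Real.two_pi_pos 0 (θ (a, a))
    rw [toIcoMod, zsmul_eq_mul, zero_add] at this
    exact this
  let φ : ℝ × ℝ → ℝ := fun z => θ z - k * (2 * Real.pi)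
  have hφ : Continuous φ := by fun_prop
  have hcosφ : ∀ z, Real.cos (φ z) = Real.cos (θ z) := fun z => Real.cos_sub_int_mul_two_pi _ _
  have hsinφ : ∀ z, Real.sin (φ z) = Real.sin (θ z) := fun z => Real.sin_sub_int_mul_two_pi _ _
  have hpi := Real.pi_pos
  have hIcc : Set.uIcc a b = Set.Icc a b := Set.uIcc_of_le hab
  have hIcc' : Set.uIcc b a = Set.Icc a b := Set.uIcc_of_ge hab
  -- The angle is followed once around the square. On each side one of `cos`, `sin` keeps its sign,
  -- which confines the angle to an interval of length `π` between two zeros of that function. Back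
  -- at the first corner it exceeds `3π/2`, although it started below `π/2`.
  have c1 : φ (a, a) ∈ Set.Ioo 0 (Real.pi / 2) := by
    have hs : 0 < Real.sin (φ (a, a)) := by rw [hsinφ]; exact hsind a haI
    have hc : 0 < Real.cos (φ (a, a)) := by rw [hcosφ]; exact hcosl a haI
    have h0 : φ (a, a) ≠ 0 := fun h => by rw [h] at hs; simp at hs
    have h1 : 0 < φ (a, a) := lt_of_le_of_ne hk.1 h0.symm
    have h2 : φ (a, a) < Real.pi := by
      by_contra h
      push Not at h
      have : Real.sin (φ (a, a) - Real.pi) < 0 := by rw [Real.sin_sub_pi]; linarith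
      have h3 : 0 ≤ Real.sin (φ (a, a) - Real.pi) :=
        Real.sin_nonneg_of_nonneg_of_le_pi (by linarith) (by have := hk.2; simp only [φ]; linarith)
      linarith
    refine ⟨h1, ?_⟩
    by_contra h
    push Not at h
    have := Real.cos_nonpos_of_pi_div_two_le_of_le h (by linarith)
    linarith
  have c2 : φ (b, a) ∈ Set.Ioo 0 Real.pi :=
    mem_Ioo_of_ne_endpoints (γ := fun x => φ (x, a)) (by fun_prop) (a := a) (by
      intro x hx
      have hs : 0 < Real.sin (φ (x, a)) := by rw [hsinφ]; exact hsind x (hIcc ▸ hx)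
      constructor <;> intro h <;> rw [h] at hs <;> simp at hs)
      ⟨c1.1, by linarith [c1.2]⟩
  have c3 : φ (b, b) ∈ Set.Ioo (Real.pi / 2) (3 * Real.pi / 2) :=
    mem_Ioo_of_ne_endpoints (γ := fun y => φ (b, y)) (by fun_prop) (a := a) (by
      intro y hy
      have hs : Real.cos (φ (b, y)) < 0 := by rw [hcosφ]; exact hcosr y (hIcc ▸ hy)
      constructor <;> intro h <;> rw [h] at hs
      · simp at hs
      · rw [show 3 * Real.pi / 2 = Real.pi / 2 + Real.pi by ring, Real.cos_add_pi] at hs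
        simp at hs) (by
      have hs : Real.cos (φ (b, a)) < 0 := by rw [hcosφ]; exact hcosr a haI
      refine ⟨?_, by linarith [c2.2]⟩
      by_contra h
      push Not at h
      have := Real.cos_nonneg_of_neg_pi_div_two_le_of_le (by linarith [c2.1]) h
      linarith)
  have c4 : φ (a, b) ∈ Set.Ioo Real.pi (2 * Real.pi) :=
    mem_Ioo_of_ne_endpoints (γ := fun x => φ (x, b)) (by fun_prop) (a := b) (by
      intro x hx
      have hs : Real.sin (φ (x, b)) < 0 := by rw [hsinφ]; exact hsinu x (hIcc' ▸ hx)
      constructor <;> intro h <;> rw [h] at hs <;> simp at hs) (by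
      have hs : Real.sin (φ (b, b)) < 0 := by rw [hsinφ]; exact hsinu b hbI
      refine ⟨?_, by linarith [c3.2]⟩
      by_contra h
      push Not at h
      have := Real.sin_nonneg_of_nonneg_of_le_pi (by linarith [c3.1]) h
      linarith)
  have c5 : φ (a, a) ∈ Set.Ioo (3 * Real.pi / 2) (5 * Real.pi / 2) :=
    mem_Ioo_of_ne_endpoints (γ := fun y => φ (a, y)) (by fun_prop) (a := b) (by
      intro y hy
      have hs : 0 < Real.cos (φ (a, y)) := by rw [hcosφ]; exact hcosl y (hIcc' ▸ hy)
      constructor <;> intro h <;> rw [h] at hs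
      · rw [show 3 * Real.pi / 2 = Real.pi / 2 + Real.pi by ring, Real.cos_add_pi] at hs
        simp at hs
      · rw [show 5 * Real.pi / 2 = Real.pi / 2 + 2 * Real.pi by ring, Real.cos_add_two_pi] at hs
        simp at hs) (by
      have hs : 0 < Real.cos (φ (a, b)) := by rw [hcosφ]; exact hcosl b hbI
      refine ⟨?_, by linarith [c4.2]⟩
      by_contra h
      push Not at h
      have h1 : 0 ≤ Real.cos (φ (a, b) - Real.pi) :=
        Real.cos_nonneg_of_neg_pi_div_two_le_of_le (by linarith [c4.1]) (by linarith)
      rw [Real.cos_sub_pi] at h1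
      linarith)
  linarith [c1.2, c5.1]

/-! ### Two inequalities for powers -/

/-- The convex function `|t|^p` lies above its tangent at `a`. The inequality is Young's for the
exponents `p/(p-1)` and `p`, applied to `|a|^(p-1)` and `|a + b|`. -/
theorem abs_rpow_tangent_le {p : ℝ} (hp : 2 < p) (a b : ℝ) :
    |a| ^ p + p * (|a| ^ (p - 2) * a * b) ≤ |a + b| ^ p := by
  have hp0 : 0 < p := by linarith
  have hpq : (p / (p - 1)).HolderConjugate p := by
    rw [Real.holderConjugate_iff]
    refine ⟨by rw [lt_div_iff₀ (by linarith)]; linarith, ?_⟩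
    field_simp
    ring
  have hy := Real.young_inequality_of_nonneg (a := |a| ^ (p - 1)) (b := |a + b|) (by positivity)
    (abs_nonneg _) hpq
  rw [← Real.rpow_mul (abs_nonneg a), mul_div_cancel₀ _ (by linarith : p - 1 ≠ 0)] at hy
  have h1 : |a| ^ (p - 2) * a * (a + b) ≤ |a| ^ (p - 1) * |a + b| := by
    rcases eq_or_ne a 0 with rfl | ha
    · simp only [mul_zero, zero_mul]; positivity
    have : |a| ^ (p - 1) = |a| ^ (p - 2) * |a| := by
      rw [← Real.rpow_add_one (abs_ne_zero.2 ha)]; ring_nf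
    rw [this, mul_assoc, mul_assoc, ← abs_mul]
    exact mul_le_mul_of_nonneg_left (le_abs_self _) (by positivity)
  have h2 : |a| ^ (p - 2) * a * a = |a| ^ p := by
    rcases eq_or_ne a 0 with rfl | ha
    · simp [Real.zero_rpow hp0.ne']
    · rw [mul_assoc, ← abs_mul_abs_self, ← mul_assoc, ← Real.rpow_add_one (abs_ne_zero.2 ha),
        ← Real.rpow_add_one (abs_ne_zero.2 ha)]
      ring_nf
  have h3 : p * (|a| ^ p / (p / (p - 1)) + |a + b| ^ p / p) = (p - 1) * |a| ^ p + |a + b| ^ p := by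
    field_simp
  have h4 := mul_le_mul_of_nonneg_left (h1.trans hy) hp0.le
  rw [h3] at h4
  nlinarith [h4, h2]

/-- The energy along a ray through a point of the Nehari set is a multiple of `t²/2 - t^p/p`, whose
maximum is at `t = 1`. This is Bernoulli's inequality for `(1 + (t² - 1))^(p/2)`. -/
theorem sq_le_rpow_add {p : ℝ} (hp : 2 < p) {t : ℝ} (ht : 0 ≤ t) :
    t ^ 2 / 2 - t ^ p / p ≤ 1 / 2 - 1 / p := by
  have h := one_add_mul_self_le_rpow_one_add (s := t ^ 2 - 1) (by nlinarith [sq_nonneg t])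
    (p := p / 2) (by linarith)
  have e : (1 + (t ^ 2 - 1)) ^ (p / 2) = t ^ p := by
    rw [add_sub_cancel, ← Real.rpow_natCast, ← Real.rpow_mul ht]
    congr 1
    push_cast
    ring
  rw [e] at h
  have hp0 : 0 < p := by linarith
  have : (1 + p / 2 * (t ^ 2 - 1)) / p ≤ t ^ p / p := by gcongr
  have e2 : (1 + p / 2 * (t ^ 2 - 1)) / p = 1 / p + t ^ 2 / 2 - 1 / 2 := by field_simp; ring
  linarith

end NodalYamabe

end

noncomputable section

namespace NodalYamabe

/-! ### Nodal minimisers for a coercive form with a compact embedding into `L^p` -/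

/-- A vector lattice of functions with a symmetric bilinear form that controls the `L^p` norm, for
which sequences of bounded energy have `L^p`-convergent subsequences and which is lower
semicontinuous for `L^p` convergence. -/
structure CompactForm {X : Type*} [MeasurableSpace X] (μ : Measure X) (p : ℝ) where
  space : Submodule ℝ (X → ℝ)
  form : space →ₗ[ℝ] space →ₗ[ℝ] ℝ
  symm : ∀ u v, form u v = form v u
  posPart_mem : ∀ u ∈ space, (fun x => max (u x) 0) ∈ space
  form_eq_zero : ∀ u : space, (u : X → ℝ) =ᵐ[μ] 0 → ∀ v, form u v = 0
  form_parts : ∀ u v w : space, (v : X → ℝ) = (fun x => max ((u : X → ℝ) x) 0) →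
    (w : X → ℝ) = (fun x => min ((u : X → ℝ) x) 0) → form v w = 0
  memLp : ∀ u : space, MemLp (u : X → ℝ) (ENNReal.ofReal p) μ
  const : ℝ
  const_pos : 0 < const
  bound : ∀ u : space, (∫ x, |(u : X → ℝ) x| ^ p ∂μ) ^ (2 / p) ≤ const * form u u
  compact : ∀ (u : ℕ → space) (l : ℝ), Tendsto (fun k => form (u k) (u k)) atTop (𝓝 l) →
    ∃ (v : space) (σ : ℕ → ℕ), StrictMono σ ∧
      Tendsto (fun k => eLpNorm ((u (σ k) : X → ℝ) - (v : X → ℝ)) (ENNReal.ofReal p) μ) atTop (𝓝 0) ∧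
      form v v ≤ l

namespace CompactForm

variable {X : Type*} [MeasurableSpace X] {μ : Measure X} {p : ℝ} (S : CompactForm μ p)

/-- The positive part `max(u, 0)`. -/
def pos (u : S.space) : S.space := ⟨fun x => max ((u : X → ℝ) x) 0, S.posPart_mem u u.2⟩

/-- The negative part `min(u, 0)`. -/
def neg (u : S.space) : S.space := - S.pos (-u)

theorem coe_pos (u : S.space) : (S.pos u : X → ℝ) = fun x => max ((u : X → ℝ) x) 0 := rfl

theorem coe_neg (u : S.space) : (S.neg u : X → ℝ) = fun x => min ((u : X → ℝ) x) 0 := by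
  funext x
  simp only [neg, pos, Submodule.coe_neg, Pi.neg_apply]
  rcases le_total ((u : X → ℝ) x) 0 with h | h
  · rw [max_eq_left (by linarith), min_eq_left h, neg_neg]
  · rw [max_eq_right (by linarith), min_eq_right h, neg_zero]

theorem pos_add_neg (u : S.space) : S.pos u + S.neg u = u := by
  ext x
  simp only [Submodule.coe_add, Pi.add_apply, coe_pos, coe_neg, max_add_min, add_zero]

/-- The quantity `∫ |u|^p`. -/
def power (u : S.space) : ℝ := ∫ x, |(u : X → ℝ) x| ^ p ∂μ

/-- The functional `½ L(u, u) - (1/p) ∫ |u|^p`. -/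
def functional (u : S.space) : ℝ := 1 / 2 * S.form u u - 1 / p * S.power u

/-- The Nehari set. -/
def nehariSet : Set S.space := {u | ¬ (u : X → ℝ) =ᵐ[μ] 0 ∧ S.form u u = S.power u}

/-- The nodal Nehari set. -/
def nodalSet : Set S.space := {u | S.pos u ∈ S.nehariSet ∧ S.neg u ∈ S.nehariSet}

theorem integrable_power (hp : 2 < p) (u : S.space) :
    Integrable (fun x => |(u : X → ℝ) x| ^ p) μ := by
  have h := (S.memLp u).integrable_norm_rpow (by simp; linarith) (by simp)
  rw [ENNReal.toReal_ofReal (by linarith)] at h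
  exact h

theorem power_nonneg (u : S.space) : 0 ≤ S.power u :=
  integral_nonneg fun x => by positivity

theorem power_congr {u v : S.space} (h : (u : X → ℝ) =ᵐ[μ] v) : S.power u = S.power v :=
  integral_congr_ae (h.mono fun x hx => by simp only [hx])

theorem form_congr {u v : S.space} (h : (u : X → ℝ) =ᵐ[μ] v) (w : S.space) :
    S.form u w = S.form v w := by
  have := S.form_eq_zero (u - v) (h.mono fun x hx => by simp [hx]) w
  rw [map_sub, LinearMap.sub_apply] at this
  linarith

theorem form_self_congr {u v : S.space} (h : (u : X → ℝ) =ᵐ[μ] v) :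
    S.form u u = S.form v v := by
  rw [S.form_congr h, S.symm, S.form_congr h]

theorem nehariSet_congr {u v : S.space} (h : (u : X → ℝ) =ᵐ[μ] v) (hu : u ∈ S.nehariSet) :
    v ∈ S.nehariSet :=
  ⟨fun h' => hu.1 (h.trans h'), by rw [← S.form_self_congr h, ← S.power_congr h]; exact hu.2⟩

theorem form_self_nonneg (u : S.space) : 0 ≤ S.form u u := by
  have h := S.bound u
  have : 0 ≤ (S.power u) ^ (2 / p) := Real.rpow_nonneg (S.power_nonneg u) _
  exact nonneg_of_mul_nonneg_right (this.trans h) S.const_pos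

theorem power_pos (hp : 2 < p) {u : S.space} (hu : ¬ (u : X → ℝ) =ᵐ[μ] 0) : 0 < S.power u := by
  refine lt_of_le_of_ne (S.power_nonneg u) fun h => hu ?_
  have := (integral_eq_zero_iff_of_nonneg (fun x => by simp only [Pi.zero_apply]; positivity)
    (S.integrable_power hp u)).1 h.symm
  filter_upwards [this] with x hx
  simp only [Pi.zero_apply] at hx ⊢
  rw [Real.rpow_eq_zero (abs_nonneg _) (by linarith)] at hx
  exact abs_eq_zero.1 hx

theorem form_self_pos (hp : 2 < p) {u : S.space} (hu : ¬ (u : X → ℝ) =ᵐ[μ] 0) :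
    0 < S.form u u := by
  have h := S.bound u
  have : 0 < (S.power u) ^ (2 / p) := Real.rpow_pos_of_pos (S.power_pos hp hu) _
  exact pos_of_mul_pos_right (this.trans_le h) S.const_pos.le

theorem form_smul (t : ℝ) (u : S.space) : S.form (t • u) (t • u) = t ^ 2 * S.form u u := by
  simp only [map_smul, LinearMap.smul_apply, smul_eq_mul]; ring

theorem power_smul {t : ℝ} (ht : 0 ≤ t) (u : S.space) : S.power (t • u) = t ^ p * S.power u := by
  simp only [power, ← integral_const_mul]
  congr 1
  funext x
  simp only [Submodule.coe_smul, Pi.smul_apply, smul_eq_mul, abs_mul, abs_of_nonneg ht]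
  rw [Real.mul_rpow ht (abs_nonneg _)]

theorem form_pos_neg (u : S.space) : S.form (S.pos u) (S.neg u) = 0 :=
  S.form_parts u _ _ (S.coe_pos u) (S.coe_neg u)

theorem form_eq_parts (u : S.space) :
    S.form u u = S.form (S.pos u) (S.pos u) + S.form (S.neg u) (S.neg u) := by
  conv_lhs => rw [← S.pos_add_neg u]
  simp only [map_add, LinearMap.add_apply, S.form_pos_neg, S.symm (S.neg u) (S.pos u)]
  ring

theorem power_eq_parts (hp : 2 < p) (u : S.space) :
    S.power u = S.power (S.pos u) + S.power (S.neg u) := by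
  rw [power, power, power, ← integral_add (S.integrable_power hp _) (S.integrable_power hp _)]
  congr 1
  funext x
  simp only [coe_pos, coe_neg]
  have : (0 : ℝ) ^ p = 0 := Real.zero_rpow (by linarith)
  rcases le_total ((u : X → ℝ) x) 0 with h | h
  · simp [max_eq_right h, min_eq_left h, this]
  · simp [max_eq_left h, min_eq_right h, this]

theorem functional_eq_parts (hp : 2 < p) (u : S.space) :
    S.functional u = S.functional (S.pos u) + S.functional (S.neg u) := by
  simp only [functional, S.form_eq_parts u, S.power_eq_parts hp u]; ring

theorem functional_of_nehari {u : S.space} (hu : u ∈ S.nehariSet) :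
    S.functional u = (1 / 2 - 1 / p) * S.power u := by
  rw [functional, hu.2]; ring

theorem functional_of_nodal (hp : 2 < p) {u : S.space} (hu : u ∈ S.nodalSet) :
    S.functional u = (1 / 2 - 1 / p) * (S.power (S.pos u) + S.power (S.neg u)) := by
  rw [S.functional_eq_parts hp, S.functional_of_nehari hu.1, S.functional_of_nehari hu.2]; ring

theorem coeff_pos {p : ℝ} (hp : 2 < p) : 0 < 1 / 2 - 1 / p := by
  rw [sub_pos]; exact one_div_lt_one_div_of_lt (by norm_num) hp

theorem functional_nonneg (hp : 2 < p) {u : S.space} (hu : u ∈ S.nehariSet) :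
    0 ≤ S.functional u := by
  rw [S.functional_of_nehari hu]
  exact mul_nonneg (coeff_pos hp).le (S.power_nonneg u)

/-- With `form = power` the Sobolev bound reads `power^(2/p) ≤ C power`, and `2/p < 1`. It prevents
the two parts of a minimising sequence from vanishing in the limit. -/
theorem exists_power_lower_bound (hp : 2 < p) :
    ∃ δ : ℝ, 0 < δ ∧ ∀ u ∈ S.nehariSet, δ ≤ S.power u := by
  have hC := S.const_pos
  have he : 0 < 1 - 2 / p := by rw [sub_pos, div_lt_one (by linarith)]; exact hp
  refine ⟨(1 / S.const) ^ (1 / (1 - 2 / p)), by positivity, fun u hu => ?_⟩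
  have hN := S.power_pos hp hu.1
  have hb : S.power u ^ (2 / p) ≤ S.const * S.power u := by
    have := S.bound u
    rwa [hu.2] at this
  have h1 : 1 / S.const ≤ S.power u ^ (1 - 2 / p) := by
    rw [Real.rpow_sub hN, Real.rpow_one, div_le_div_iff₀ hC (by positivity)]
    linarith
  calc (1 / S.const) ^ (1 / (1 - 2 / p)) ≤ (S.power u ^ (1 - 2 / p)) ^ (1 / (1 - 2 / p)) := by
        gcongr
    _ = S.power u := by rw [← Real.rpow_mul hN.le, mul_one_div_cancel he.ne', Real.rpow_one]

/-- The form scales by `t²` and the power by `t^p`, so `t^(p-2) = form / power` is forced. The last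
clause says that a function whose form has dropped below its power is only shrunk. -/
theorem exists_smul_mem_nehari (hp : 2 < p) {u : S.space} (hu : ¬ (u : X → ℝ) =ᵐ[μ] 0) :
    ∃ t : ℝ, 0 < t ∧ t • u ∈ S.nehariSet ∧ (S.form u u ≤ S.power u → t ≤ 1) := by
  have hF := S.form_self_pos hp hu
  have hN := S.power_pos hp hu
  have hp2 : 0 < p - 2 := by linarith
  set t : ℝ := (S.form u u / S.power u) ^ (1 / (p - 2)) with ht
  have ht0 : 0 < t := by positivity
  refine ⟨t, ht0, ⟨fun h => hu ?_, ?_⟩, fun h => ?_⟩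
  · filter_upwards [h] with x hx
    simpa [ht0.ne'] using hx
  · rw [S.form_smul, S.power_smul ht0.le]
    have h1 : t ^ p = t ^ 2 * t ^ (p - 2) := by
      rw [← Real.rpow_natCast, ← Real.rpow_add ht0]; congr 1; push_cast; ring
    have h2 : t ^ (p - 2) = S.form u u / S.power u := by
      rw [ht, ← Real.rpow_mul (by positivity), one_div_mul_cancel hp2.ne', Real.rpow_one]
    rw [h1, h2]
    field_simp
  · exact Real.rpow_le_one (by positivity) ((div_le_one hN).2 h) (by positivity)

theorem tendsto_power (hp : 2 < p) {u : ℕ → S.space} {v : S.space}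
    (h : Tendsto (fun k => eLpNorm ((u k : X → ℝ) - (v : X → ℝ)) (ENNReal.ofReal p) μ) atTop (𝓝 0)) :
    Tendsto (fun k => S.power (u k)) atTop (𝓝 (S.power v)) := by
  have hp0 : 0 < p := by linarith
  haveI : Fact (1 ≤ ENNReal.ofReal p) := ⟨by rw [ENNReal.one_le_ofReal]; linarith⟩
  have hL := (Lp.tendsto_Lp_iff_tendsto_eLpNorm'' (fun k => (u k : X → ℝ))
    (fun k => S.memLp (u k)) (v : X → ℝ) (S.memLp v)).2 h
  have hN : ∀ w : S.space, S.power w = ‖(S.memLp w).toLp (w : X → ℝ)‖ ^ p := fun w => by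
    rw [Lp.norm_toLp, (S.memLp w).eLpNorm_eq_integral_rpow_norm (by simpa using hp0) (by simp),
      ENNReal.toReal_ofReal hp0.le, ENNReal.toReal_ofReal (by positivity),
      ← Real.rpow_mul (by positivity), inv_mul_cancel₀ hp0.ne', Real.rpow_one]
    rfl
  simp only [hN]
  exact hL.norm.rpow_const (Or.inr hp0.le)

theorem exists_subseq_ae (hp : 2 < p) {u : ℕ → S.space} {v : S.space}
    (h : Tendsto (fun k => eLpNorm ((u k : X → ℝ) - (v : X → ℝ)) (ENNReal.ofReal p) μ) atTop (𝓝 0)) :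
    ∃ σ : ℕ → ℕ, StrictMono σ ∧ ∀ᵐ x ∂μ, Tendsto (fun k => (u (σ k) : X → ℝ) x) atTop
      (𝓝 ((v : X → ℝ) x)) :=
  (tendstoInMeasure_of_tendsto_eLpNorm (by simp; linarith)
    (fun k => (S.memLp (u k)).aestronglyMeasurable) (S.memLp v).aestronglyMeasurable h
    ).exists_seq_tendsto_ae

theorem eLpNorm_pos_sub_le (u v : S.space) :
    eLpNorm ((S.pos u : X → ℝ) - (S.pos v : X → ℝ)) (ENNReal.ofReal p) μ
      ≤ eLpNorm ((u : X → ℝ) - (v : X → ℝ)) (ENNReal.ofReal p) μ := by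
  refine eLpNorm_mono fun x => ?_
  simp only [Pi.sub_apply, coe_pos, Real.norm_eq_abs]
  exact abs_max_sub_max_le_abs _ _ _

/-- The field `compact` gives lower semicontinuity only for a limit of its own choosing. Almost
everywhere convergent subsequences identify that limit with `v`. -/
theorem form_le_of_tendsto (hp : 2 < p) {u : ℕ → S.space} {v : S.space} {l : ℝ}
    (h : Tendsto (fun k => eLpNorm ((u k : X → ℝ) - (v : X → ℝ)) (ENNReal.ofReal p) μ) atTop (𝓝 0))
    (hl : Tendsto (fun k => S.form (u k) (u k)) atTop (𝓝 l)) : S.form v v ≤ l := by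
  obtain ⟨w, σ, hσ, hw, hwl⟩ := S.compact u l hl
  have h' := h.comp hσ.tendsto_atTop
  obtain ⟨τ, hτ, hae⟩ := S.exists_subseq_ae hp (u := fun k => u (σ k)) hw
  obtain ⟨τ', hτ', hae'⟩ := S.exists_subseq_ae hp (u := fun k => u (σ (τ k)))
    (h'.comp hτ.tendsto_atTop)
  have : (v : X → ℝ) =ᵐ[μ] w := by
    filter_upwards [hae, hae'] with x h1 h2
    exact tendsto_nhds_unique h2 (h1.comp hτ'.tendsto_atTop)
  rw [S.form_self_congr this]
  exact hwl

/-- The forms of the two parts are each lower semicontinuous and their sum converges to the form of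
`v`, so neither can drop. Every sequence of indices has a subsequence along which this applies. -/
theorem tendsto_form_pos (hp : 2 < p) {u : ℕ → S.space} {v : S.space}
    (h : Tendsto (fun k => eLpNorm ((u k : X → ℝ) - (v : X → ℝ)) (ENNReal.ofReal p) μ) atTop (𝓝 0))
    (hl : Tendsto (fun k => S.form (u k) (u k)) atTop (𝓝 (S.form v v))) :
    Tendsto (fun k => S.form (S.pos (u k)) (S.pos (u k))) atTop
      (𝓝 (S.form (S.pos v) (S.pos v))) := by
  have hpos : Tendsto (fun k => eLpNorm ((S.pos (u k) : X → ℝ) - (S.pos v : X → ℝ)) (ENNReal.ofReal p) μ)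
      atTop (𝓝 0) :=
    tendsto_of_tendsto_of_tendsto_of_le_of_le tendsto_const_nhds h (fun _ => zero_le)
      fun k => S.eLpNorm_pos_sub_le _ _
  have hneg : Tendsto (fun k => eLpNorm ((S.neg (u k) : X → ℝ) - (S.neg v : X → ℝ)) (ENNReal.ofReal p) μ)
      atTop (𝓝 0) := by
    refine tendsto_of_tendsto_of_tendsto_of_le_of_le tendsto_const_nhds h (fun _ => zero_le)
      fun k => ?_
    refine eLpNorm_mono fun x => ?_
    simp only [Pi.sub_apply, coe_neg, Real.norm_eq_abs]
    exact abs_min_sub_min_le_max _ _ _ _ |>.trans (by simp)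
  refine tendsto_of_subseq_tendsto fun ns hns => ?_
  obtain ⟨B, hB⟩ := (hl.comp hns).bddAbove_range
  have hmem : ∀ k, S.form (S.pos (u (ns k))) (S.pos (u (ns k))) ∈ Set.Icc 0 B := fun k => by
    refine ⟨S.form_self_nonneg _, ?_⟩
    have h1 := hB ⟨k, rfl⟩
    simp only [Function.comp] at h1
    rw [S.form_eq_parts] at h1
    linarith [S.form_self_nonneg (S.neg (u (ns k)))]
  obtain ⟨a, -, σ, hσ, ha⟩ := isCompact_Icc.tendsto_subseq hmem
  refine ⟨σ, ?_⟩
  have hsub : Tendsto (fun k => ns (σ k)) atTop atTop := hns.comp hσ.tendsto_atTop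
  have h1 : S.form (S.pos v) (S.pos v) ≤ a := S.form_le_of_tendsto hp (hpos.comp hsub) ha
  have h2 : S.form (S.neg v) (S.neg v) ≤ S.form v v - a := by
    refine S.form_le_of_tendsto hp (hneg.comp hsub) (((hl.comp hsub).sub ha).congr fun k => ?_)
    simp only [Function.comp]
    rw [S.form_eq_parts (u (ns (σ k)))]
    ring
  rw [S.form_eq_parts v] at h2
  have : a = S.form (S.pos v) (S.pos v) := by linarith
  rw [← this]
  exact ha

/-- The tangent inequality for `v` and for `-v` bounds `p` times the absolute value of the product
by `|u + v|^p + |u - v|^p`, which replaces Hölder's inequality. -/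
theorem integrable_mul (hp : 2 < p) (u v : S.space) :
    Integrable (fun x => |(u : X → ℝ) x| ^ (p - 2) * (u : X → ℝ) x * (v : X → ℝ) x) μ := by
  have h1 := S.integrable_power hp u
  have h2 := S.integrable_power hp (u + v)
  have h3 := S.integrable_power hp (u - v)
  have hu := (S.memLp u).aestronglyMeasurable.aemeasurable
  have hv := (S.memLp v).aestronglyMeasurable.aemeasurable
  refine ((h2.add h3).add h1).mono' ?_ (Eventually.of_forall fun x => ?_)
  · exact (((hu.abs.pow_const _).mul hu).mul hv).aestronglyMeasurable
  · simp only [Pi.add_apply, Real.norm_eq_abs]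
    have a1 := abs_rpow_tangent_le hp ((u : X → ℝ) x) ((v : X → ℝ) x)
    have a2 := abs_rpow_tangent_le hp ((u : X → ℝ) x) (-(v : X → ℝ) x)
    have c1 : ((u + v : S.space) : X → ℝ) x = (u : X → ℝ) x + (v : X → ℝ) x := rfl
    have c2 : ((u - v : S.space) : X → ℝ) x = (u : X → ℝ) x + -(v : X → ℝ) x := sub_eq_add_neg _ _
    rw [c1, c2]
    have b0 : 0 ≤ |(u : X → ℝ) x| ^ p := by positivity
    have b1 : 0 ≤ |(u : X → ℝ) x + (v : X → ℝ) x| ^ p := by positivity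
    have b2 : 0 ≤ |(u : X → ℝ) x + -(v : X → ℝ) x| ^ p := by positivity
    rw [mul_neg, mul_neg] at a2
    set T := |(u : X → ℝ) x| ^ (p - 2) * (u : X → ℝ) x * (v : X → ℝ) x
    rcases abs_cases T with ⟨hT, hT0⟩ | ⟨hT, hT0⟩ <;> rw [hT] <;> nlinarith

/-- The derivative of the functional at `u` in the direction `v`. -/
def slope (u v : S.space) : ℝ :=
  S.form u v - ∫ x, |(u : X → ℝ) x| ^ (p - 2) * (u : X → ℝ) x * (v : X → ℝ) x ∂μ

theorem slope_neg (u v : S.space) : S.slope u (-v) = - S.slope u v := by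
  simp only [slope, map_neg, Submodule.coe_neg, Pi.neg_apply, mul_neg, integral_neg]
  ring

/-- By the tangent inequality `-(1/p) power` lies below its linearisation, so the only second-order
term is that of the quadratic form. The bound is exact enough to detect a negative slope and needs
no differentiation under the integral. -/
theorem functional_add_smul_le (hp : 2 < p) (u v : S.space) (r : ℝ) :
    S.functional (u + r • v) ≤ S.functional u + r * S.slope u v + r ^ 2 / 2 * S.form v v := by
  have hp0 : 0 < p := by linarith
  have hpow : S.power u + p * (r * ∫ x, |(u : X → ℝ) x| ^ (p - 2) * (u : X → ℝ) x *
      (v : X → ℝ) x ∂μ) ≤ S.power (u + r • v) := by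
    simp only [power]
    rw [← integral_const_mul, ← integral_const_mul, ← integral_add (S.integrable_power hp u)
      (((S.integrable_mul hp u v).const_mul _).const_mul _)]
    refine integral_mono ((S.integrable_power hp u).add
      (((S.integrable_mul hp u v).const_mul _).const_mul _)) (S.integrable_power hp (u + r • v))
      fun x => ?_
    have := abs_rpow_tangent_le hp ((u : X → ℝ) x) (r * (v : X → ℝ) x)
    simp only [Submodule.coe_add, Submodule.coe_smul, Pi.add_apply, Pi.smul_apply, smul_eq_mul]
    refine le_trans (le_of_eq ?_) this
    ring
  have h1 : 1 / p * S.power (u + r • v) ≥ 1 / p * S.power u + r * ∫ x, |(u : X → ℝ) x| ^ (p - 2) *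
      (u : X → ℝ) x * (v : X → ℝ) x ∂μ := by
    have := mul_le_mul_of_nonneg_left hpow (by positivity : 0 ≤ 1 / p)
    refine le_trans (le_of_eq ?_) this
    field_simp
  have h2 : S.form (u + r • v) (u + r • v)
      = S.form u u + 2 * r * S.form u v + r ^ 2 * S.form v v := by
    simp only [map_add, LinearMap.add_apply, map_smul, LinearMap.smul_apply, smul_eq_mul,
      S.symm v u]
    ring
  simp only [functional, slope, h2]
  nlinarith

end CompactForm

end NodalYamabe

end

/-! ### Existence of a minimiser on the nodal Nehari set -/

noncomputable section

namespace NodalYamabe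

namespace CompactForm

variable {X : Type*} [MeasurableSpace X] {μ : Measure X} {p : ℝ} (S : CompactForm μ p)

theorem pos_combination {v w : S.space} (hv : ∀ᵐ x ∂μ, 0 ≤ (v : X → ℝ) x)
    (hw : ∀ᵐ x ∂μ, (w : X → ℝ) x ≤ 0) (hvw : ∀ᵐ x ∂μ, (v : X → ℝ) x * (w : X → ℝ) x = 0)
    {t s : ℝ} (ht : 0 ≤ t) (hs : 0 ≤ s) :
    (S.pos (t • v + s • w) : X → ℝ) =ᵐ[μ] ((t • v : S.space) : X → ℝ) := by
  filter_upwards [hv, hw, hvw] with x h1 h2 h3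
  simp only [coe_pos, Submodule.coe_add, Submodule.coe_smul, Pi.add_apply, Pi.smul_apply,
    smul_eq_mul]
  rcases mul_eq_zero.1 h3 with h | h
  · rw [h, mul_zero, zero_add, max_eq_right (mul_nonpos_of_nonneg_of_nonpos hs h2)]
  · rw [h, mul_zero, add_zero, max_eq_left (mul_nonneg ht h1)]

theorem neg_combination {v w : S.space} (hv : ∀ᵐ x ∂μ, 0 ≤ (v : X → ℝ) x)
    (hw : ∀ᵐ x ∂μ, (w : X → ℝ) x ≤ 0) (hvw : ∀ᵐ x ∂μ, (v : X → ℝ) x * (w : X → ℝ) x = 0)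
    {t s : ℝ} (ht : 0 ≤ t) (hs : 0 ≤ s) :
    (S.neg (t • v + s • w) : X → ℝ) =ᵐ[μ] ((s • w : S.space) : X → ℝ) := by
  filter_upwards [hv, hw, hvw] with x h1 h2 h3
  simp only [coe_neg, Submodule.coe_add, Submodule.coe_smul, Pi.add_apply, Pi.smul_apply,
    smul_eq_mul]
  rcases mul_eq_zero.1 h3 with h | h
  · rw [h, mul_zero, zero_add, min_eq_left (mul_nonpos_of_nonneg_of_nonpos hs h2)]
  · rw [h, mul_zero, add_zero, min_eq_right (mul_nonneg ht h1)]

theorem pos_nonneg (u : S.space) (x : X) : 0 ≤ (S.pos u : X → ℝ) x := le_max_right _ _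

theorem neg_nonpos (u : S.space) (x : X) : (S.neg u : X → ℝ) x ≤ 0 := by
  rw [coe_neg]; exact min_le_right _ _

theorem pos_mul_neg (u : S.space) (x : X) : (S.pos u : X → ℝ) x * (S.neg u : X → ℝ) x = 0 := by
  rw [coe_neg, coe_pos]
  rcases le_total ((u : X → ℝ) x) 0 with h | h
  · simp [max_eq_right h]
  · simp [min_eq_right h]

/-- Two functions of opposite signs and disjoint supports can be rescaled so that their sum lies
in the nodal Nehari set. -/
theorem exists_combination_mem_nodal (hp : 2 < p) {v w : S.space}
    (hv : ∀ᵐ x ∂μ, 0 ≤ (v : X → ℝ) x) (hw : ∀ᵐ x ∂μ, (w : X → ℝ) x ≤ 0)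
    (hvw : ∀ᵐ x ∂μ, (v : X → ℝ) x * (w : X → ℝ) x = 0)
    (hv0 : ¬ (v : X → ℝ) =ᵐ[μ] 0) (hw0 : ¬ (w : X → ℝ) =ᵐ[μ] 0) :
    ∃ u ∈ S.nodalSet, (S.form v v ≤ S.power v → S.form w w ≤ S.power w →
      S.functional u ≤ (1 / 2 - 1 / p) * (S.power v + S.power w)) := by
  obtain ⟨t, ht, htN, ht1⟩ := S.exists_smul_mem_nehari hp hv0
  obtain ⟨s, hs, hsN, hs1⟩ := S.exists_smul_mem_nehari hp hw0
  have e1 := S.pos_combination hv hw hvw ht.le hs.le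
  have e2 := S.neg_combination hv hw hvw ht.le hs.le
  have hmem : t • v + s • w ∈ S.nodalSet :=
    ⟨S.nehariSet_congr e1.symm htN, S.nehariSet_congr e2.symm hsN⟩
  refine ⟨_, hmem, fun h1 h2 => ?_⟩
  rw [S.functional_of_nodal hp hmem, S.power_congr e1, S.power_congr e2, S.power_smul ht.le,
    S.power_smul hs.le]
  refine mul_le_mul_of_nonneg_left (add_le_add ?_ ?_) (coeff_pos hp).le
  · exact mul_le_of_le_one_left (S.power_nonneg v)
      (Real.rpow_le_one ht.le (ht1 h1) (by linarith))
  · exact mul_le_of_le_one_left (S.power_nonneg w)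
      (Real.rpow_le_one hs.le (hs1 h2) (by linarith))

/-- On the nodal set the functional is a multiple of the sum of the two powers, so these stay
bounded along a minimising sequence, and so do the forms, being equal to them. The limits of the two
parts are nonzero by `exists_power_lower_bound`, and `exists_combination_mem_nodal` rescales them
into the nodal set. -/
theorem exists_nodal_minimizer (hp : 2 < p)
    (h0 : ∃ u : S.space, ¬ (S.pos u : X → ℝ) =ᵐ[μ] 0 ∧ ¬ (S.neg u : X → ℝ) =ᵐ[μ] 0) :
    ∃ u ∈ S.nodalSet, ∀ v ∈ S.nodalSet, S.functional u ≤ S.functional v := by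
  have hne : S.nodalSet.Nonempty := by
    obtain ⟨u, h1, h2⟩ := h0
    obtain ⟨w, hw, -⟩ := S.exists_combination_mem_nodal hp (v := S.pos u) (w := S.neg u)
      (Eventually.of_forall (S.pos_nonneg u)) (Eventually.of_forall (S.neg_nonpos u))
      (Eventually.of_forall (S.pos_mul_neg u)) h1 h2
    exact ⟨w, hw⟩
  have hκ := coeff_pos hp
  have hbdd : BddBelow (S.functional '' S.nodalSet) := by
    refine ⟨0, ?_⟩
    rintro _ ⟨u, hu, rfl⟩
    rw [S.functional_of_nodal hp hu]
    exact mul_nonneg hκ.le (add_nonneg (S.power_nonneg _) (S.power_nonneg _))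
  obtain ⟨y, -, hy, hymem⟩ := exists_seq_tendsto_sInf (hne.image S.functional) hbdd
  choose u hu huy using hymem
  set d := sInf (S.functional '' S.nodalSet)
  have hd : Tendsto (fun k => S.functional (u k)) atTop (𝓝 d) := by simpa only [huy] using hy
  obtain ⟨B, hB⟩ := hd.bddAbove_range
  have hsum : ∀ k, S.power (S.pos (u k)) + S.power (S.neg (u k)) ≤ B / (1 / 2 - 1 / p) := by
    intro k
    rw [le_div_iff₀ hκ, mul_comm, ← S.functional_of_nodal hp (hu k)]
    exact hB ⟨k, rfl⟩
  have hm1 : ∀ k, S.power (S.pos (u k)) ∈ Set.Icc 0 (B / (1 / 2 - 1 / p)) := fun k =>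
    ⟨S.power_nonneg _, by linarith [hsum k, S.power_nonneg (S.neg (u k))]⟩
  obtain ⟨l₁, -, σ₁, hσ₁, hl₁⟩ := isCompact_Icc.tendsto_subseq hm1
  have hm2 : ∀ k, S.power (S.neg (u (σ₁ k))) ∈ Set.Icc 0 (B / (1 / 2 - 1 / p)) := fun k =>
    ⟨S.power_nonneg _, by linarith [hsum (σ₁ k), S.power_nonneg (S.pos (u (σ₁ k)))]⟩
  obtain ⟨l₂, -, σ₂, hσ₂, hl₂⟩ := isCompact_Icc.tendsto_subseq hm2
  have hl₁' := hl₁.comp hσ₂.tendsto_atTop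
  -- On the Nehari set the forms equal the powers, hence converge to `l₁`. The limit satisfies `form
  -- v v ≤ l₁`, whereas its power is exactly `l₁`.
  obtain ⟨v, σ₃, hσ₃, hv, hvl⟩ := S.compact (fun k => S.pos (u (σ₁ (σ₂ k)))) l₁
    (hl₁'.congr fun k => (hu _).1.2.symm)
  have hl₂' := hl₂.comp hσ₃.tendsto_atTop
  obtain ⟨w, σ₄, hσ₄, hw, hwl⟩ := S.compact (fun k => S.neg (u (σ₁ (σ₂ (σ₃ k))))) l₂
    (hl₂'.congr fun k => (hu _).2.2.symm)
  have hv4 := hv.comp hσ₄.tendsto_atTop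
  have hPv : S.power v = l₁ := tendsto_nhds_unique
    (S.tendsto_power hp (u := fun k => S.pos (u (σ₁ (σ₂ (σ₃ k))))) hv)
    (hl₁'.comp hσ₃.tendsto_atTop)
  have hPw : S.power w = l₂ := tendsto_nhds_unique
    (S.tendsto_power hp (u := fun k => S.neg (u (σ₁ (σ₂ (σ₃ (σ₄ k)))))) hw)
    (hl₂'.comp hσ₄.tendsto_atTop)
  obtain ⟨δ, hδ, hδN⟩ := S.exists_power_lower_bound hp
  have hl₁δ : δ ≤ l₁ := ge_of_tendsto hl₁ (Eventually.of_forall fun k => hδN _ (hu _).1)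
  have hl₂δ : δ ≤ l₂ := ge_of_tendsto hl₂ (Eventually.of_forall fun k => hδN _ (hu _).2)
  have hdl : d = (1 / 2 - 1 / p) * (l₁ + l₂) := by
    refine tendsto_nhds_unique (hd.comp (hσ₁.comp hσ₂).tendsto_atTop)
      (((hl₁'.add hl₂).const_mul _).congr fun k => ?_)
    exact (S.functional_of_nodal hp (hu _)).symm
  have hz : ∀ z : S.space, δ ≤ S.power z → ¬ (z : X → ℝ) =ᵐ[μ] 0 := by
    intro z hz h
    have : S.power z = S.power 0 := S.power_congr h
    have h0 : S.power 0 = 0 := by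
      simp [power, Real.zero_rpow (by linarith : p ≠ 0)]
    linarith
  -- Almost everywhere convergence along a common subsequence carries the signs and the disjointness
  -- of the supports over to `v` and `w`.
  obtain ⟨τ, hτ, hae⟩ := S.exists_subseq_ae hp
    (u := fun k => S.pos (u (σ₁ (σ₂ (σ₃ (σ₄ k)))))) hv4
  obtain ⟨τ', hτ', hae'⟩ := S.exists_subseq_ae hp
    (u := fun k => S.neg (u (σ₁ (σ₂ (σ₃ (σ₄ (τ k))))))) (hw.comp hτ.tendsto_atTop)
  obtain ⟨z, hzN, hzle⟩ := S.exists_combination_mem_nodal hp (v := v) (w := w)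
    (hae.mono fun x hx => ge_of_tendsto hx (Eventually.of_forall fun k => S.pos_nonneg _ x))
    (hae'.mono fun x hx => le_of_tendsto hx (Eventually.of_forall fun k => S.neg_nonpos _ x))
    (by
      filter_upwards [hae, hae'] with x h1 h2
      refine tendsto_nhds_unique ((h1.comp hτ'.tendsto_atTop).mul h2)
        (tendsto_const_nhds.congr fun k => ?_)
      exact (S.pos_mul_neg _ x).symm)
    (hz v (hPv ▸ hl₁δ)) (hz w (hPw ▸ hl₂δ))
  refine ⟨z, hzN, fun v' hv' => ?_⟩
  calc S.functional z ≤ d := by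
        rw [hdl, ← hPv, ← hPw]; exact hzle (hPv ▸ hvl) (hPw ▸ hwl)
    _ ≤ S.functional v' := csInf_le hbdd ⟨v', hv', rfl⟩

/-! #### The minimiser is a critical point -/

/-- The functional splits over the two parts, and each part, being on the Nehari set, maximises the
energy along its own ray. -/
theorem functional_parts_le (hp : 2 < p) {u : S.space} (hu : u ∈ S.nodalSet) {t s : ℝ}
    (ht : 0 ≤ t) (hs : 0 ≤ s) :
    S.functional (t • S.pos u + s • S.neg u) ≤ S.functional u := by
  have hvw := Eventually.of_forall (f := ae μ) (S.pos_mul_neg u)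
  have h1 := Eventually.of_forall (f := ae μ) (S.pos_nonneg u)
  have h2 := Eventually.of_forall (f := ae μ) (S.neg_nonpos u)
  have e1 := S.pos_combination h1 h2 hvw ht hs
  have e2 := S.neg_combination h1 h2 hvw ht hs
  rw [S.functional_eq_parts hp (t • S.pos u + s • S.neg u), S.functional_of_nodal hp hu]
  simp only [functional]
  rw [S.form_self_congr e1, S.form_self_congr e2, S.power_congr e1, S.power_congr e2,
    S.power_smul ht, S.power_smul hs, S.form_smul, S.form_smul, hu.1.2, hu.2.2]
  have a1 := mul_le_mul_of_nonneg_right (sq_le_rpow_add hp ht) (S.power_nonneg (S.pos u))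
  have a2 := mul_le_mul_of_nonneg_right (sq_le_rpow_add hp hs) (S.power_nonneg (S.neg u))
  linear_combination a1 + a2

/-- The supports of the two parts are disjoint, so the nonlinear term splits and is homogeneous of
degree `p - 1` in each factor. This makes the slope visibly continuous in `(t, s)`. -/
theorem integral_combination (hp : 2 < p) (u v : S.space) {t s : ℝ} (ht : 0 ≤ t) (hs : 0 ≤ s) :
    S.slope (t • S.pos u + s • S.neg u) v
      = t * S.form (S.pos u) v + s * S.form (S.neg u) v
        - (t ^ (p - 1) * ∫ x, |(S.pos u : X → ℝ) x| ^ (p - 2) * (S.pos u : X → ℝ) x *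
            (v : X → ℝ) x ∂μ
          + s ^ (p - 1) * ∫ x, |(S.neg u : X → ℝ) x| ^ (p - 2) * (S.neg u : X → ℝ) x *
            (v : X → ℝ) x ∂μ) := by
  rw [slope, ← integral_const_mul, ← integral_const_mul,
    ← integral_add ((S.integrable_mul hp _ v).const_mul _) ((S.integrable_mul hp _ v).const_mul _)]
  have e : ∀ r : ℝ, 0 ≤ r → ∀ y : ℝ, |r * y| ^ (p - 2) * (r * y)
      = r ^ (p - 1) * (|y| ^ (p - 2) * y) := by
    intro r hr y
    rcases eq_or_lt_of_le hr with rfl | hr'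
    · simp [Real.zero_rpow (by linarith : p - 1 ≠ 0)]
    · rw [abs_mul, abs_of_pos hr', Real.mul_rpow hr (abs_nonneg _),
        show p - 1 = p - 2 + 1 by ring, Real.rpow_add_one hr'.ne']
      ring
  congr 1
  · simp only [map_add, LinearMap.add_apply, map_smul, LinearMap.smul_apply, smul_eq_mul]
  · refine integral_congr_ae (Eventually.of_forall fun x => ?_)
    simp only [Submodule.coe_add, Submodule.coe_smul, Pi.add_apply, Pi.smul_apply, smul_eq_mul]
    rcases mul_eq_zero.1 (S.pos_mul_neg u x) with h | h
    · rw [h, mul_zero, zero_add, e s hs]; ring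
    · rw [h, mul_zero, add_zero, e t ht]; ring

/-- The three-parameter family `t u⁺ + s u⁻ + r v`. -/
def family (u v : S.space) (z : (ℝ × ℝ) × ℝ) : S.space :=
  z.1.1 • S.pos u + z.1.2 • S.neg u + z.2 • v

/-- Along the family the functions depend linearly on the parameters, so they converge in `L^p`, and
their form is a polynomial in the parameters. Sequential continuity is enough in finite dimension.
-/
theorem continuous_of_family (hp : 2 < p) (u v : S.space) (Φ : S.space → ℝ)
    (hΦ : ∀ (w : ℕ → S.space) (w₀ : S.space),
      Tendsto (fun k => eLpNorm ((w k : X → ℝ) - (w₀ : X → ℝ)) (ENNReal.ofReal p) μ) atTop (𝓝 0) →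
      Tendsto (fun k => S.form (w k) (w k)) atTop (𝓝 (S.form w₀ w₀)) →
      Tendsto (fun k => Φ (w k)) atTop (𝓝 (Φ w₀))) :
    Continuous fun z => Φ (S.family u v z) := by
  refine SeqContinuous.continuous fun z z₀ hz => ?_
  have h1 : Tendsto (fun k => (z k).1.1) atTop (𝓝 z₀.1.1) :=
    ((continuous_fst.comp continuous_fst).tendsto z₀).comp hz
  have h2 : Tendsto (fun k => (z k).1.2) atTop (𝓝 z₀.1.2) :=
    ((continuous_snd.comp continuous_fst).tendsto z₀).comp hz
  have h3 : Tendsto (fun k => (z k).2) atTop (𝓝 z₀.2) := (continuous_snd.tendsto z₀).comp hz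
  refine hΦ _ _ ?_ ?_
  · haveI : Fact (1 ≤ ENNReal.ofReal p) := ⟨by rw [ENNReal.one_le_ofReal]; linarith⟩
    refine (Lp.tendsto_Lp_iff_tendsto_eLpNorm'' (fun k => (S.family u v (z k) : X → ℝ))
      (fun k => S.memLp _) _ (S.memLp _)).1 ?_
    have e : ∀ y, (S.memLp (S.family u v y)).toLp (S.family u v y : X → ℝ)
        = y.1.1 • (S.memLp (S.pos u)).toLp _ + y.1.2 • (S.memLp (S.neg u)).toLp _
          + y.2 • (S.memLp v).toLp _ := fun y => rfl
    simp only [e]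
    exact ((h1.smul_const _).add (h2.smul_const _)).add (h3.smul_const _)
  · have : Continuous fun y => S.form (S.family u v y) (S.family u v y) := by
      simp only [family, map_add, LinearMap.add_apply, map_smul, LinearMap.smul_apply,
        smul_eq_mul]
      fun_prop
    exact (this.tendsto z₀).comp hz

theorem tendsto_power_pos (hp : 2 < p) (w : ℕ → S.space) (w₀ : S.space)
    (h : Tendsto (fun k => eLpNorm ((w k : X → ℝ) - (w₀ : X → ℝ)) (ENNReal.ofReal p) μ) atTop
      (𝓝 0)) :
    Tendsto (fun k => S.power (S.pos (w k))) atTop (𝓝 (S.power (S.pos w₀))) :=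
  S.tendsto_power hp (tendsto_of_tendsto_of_tendsto_of_le_of_le tendsto_const_nhds h
    (fun _ => zero_le) fun k => S.eLpNorm_pos_sub_le _ _)

/-- The defect `form - power` of each part changes sign across the corresponding pair of opposite
edges of a square about `(1, 1)` when `r = 0`, and still does so for small `r > 0`. A common zero of
the two defects is a competitor in the nodal set whose energy is below the minimum. -/
theorem slope_eq_zero_of_minimizer (hp : 2 < p) {u : S.space} (hu : u ∈ S.nodalSet)
    (hmin : ∀ v ∈ S.nodalSet, S.functional u ≤ S.functional v) (v : S.space) :
    S.slope u v = 0 := by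
  by_contra hne
  -- choose the sign of the direction so that the functional decreases
  obtain ⟨v, hv⟩ : ∃ v, S.slope u v < 0 := by
    rcases lt_or_gt_of_ne hne with h | h
    · exact ⟨v, h⟩
    · exact ⟨-v, by rw [slope_neg]; linarith⟩
  have hp1 : 0 < p - 1 := by linarith
  have hcP := S.continuous_of_family hp u v (fun w => S.power (S.pos w))
    (fun w w₀ h _ => S.tendsto_power_pos hp w w₀ h)
  have hcF := S.continuous_of_family hp u v (fun w => S.form (S.pos w) (S.pos w))
    (fun w w₀ h h' => S.tendsto_form_pos hp h h')
  have hcA := S.continuous_of_family hp u v (fun w => S.power w)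
    (fun w w₀ h _ => S.tendsto_power hp h)
  have hcB := S.continuous_of_family hp u v (fun w => S.form w w) (fun w w₀ _ h' => h')
  -- Form and power are additive over the two parts, so the quantities of the negative part are
  -- totals minus those of the positive part.
  have hcN : Continuous fun z => S.power (S.neg (S.family u v z)) := by
    refine (hcA.sub hcP).congr fun z => ?_
    rw [Pi.sub_apply, S.power_eq_parts hp (S.family u v z)]; ring
  have hcG : Continuous fun z => S.form (S.neg (S.family u v z)) (S.neg (S.family u v z)) := by
    refine (hcB.sub hcF).congr fun z => ?_
    rw [Pi.sub_apply, S.form_eq_parts (S.family u v z)]; ring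
  -- values on the plane `r = 0`
  have hvw := Eventually.of_forall (f := ae μ) (S.pos_mul_neg u)
  have h1 := Eventually.of_forall (f := ae μ) (S.pos_nonneg u)
  have h2 := Eventually.of_forall (f := ae μ) (S.neg_nonpos u)
  have hfam : ∀ t s : ℝ, S.family u v ((t, s), 0) = t • S.pos u + s • S.neg u := fun t s => by
    simp only [family, zero_smul, add_zero]
  have e1 : ∀ t s : ℝ, 0 ≤ t → 0 ≤ s → (S.pos (S.family u v ((t, s), 0)) : X → ℝ) =ᵐ[μ]
      ((t • S.pos u : S.space) : X → ℝ) := fun t s ht hs => by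
    rw [hfam]; exact S.pos_combination h1 h2 hvw ht hs
  have e2 : ∀ t s : ℝ, 0 ≤ t → 0 ≤ s → (S.neg (S.family u v ((t, s), 0)) : X → ℝ) =ᵐ[μ]
      ((s • S.neg u : S.space) : X → ℝ) := fun t s ht hs => by
    rw [hfam]; exact S.neg_combination h1 h2 hvw ht hs
  have hPp := S.power_pos hp hu.1.1
  have hPn := S.power_pos hp hu.2.1
  -- a square on which the slope stays negative
  let Q : ℝ × ℝ → ℝ := fun z => z.1 * S.form (S.pos u) v + z.2 * S.form (S.neg u) v
        - (z.1 ^ (p - 1) * ∫ x, |(S.pos u : X → ℝ) x| ^ (p - 2) * (S.pos u : X → ℝ) x *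
            (v : X → ℝ) x ∂μ
          + z.2 ^ (p - 1) * ∫ x, |(S.neg u : X → ℝ) x| ^ (p - 2) * (S.neg u : X → ℝ) x *
            (v : X → ℝ) x ∂μ)
  have hQc : Continuous Q := by
    have a1 : Continuous fun z : ℝ × ℝ => z.1 ^ (p - 1) :=
      continuous_fst.rpow_const fun _ => Or.inr hp1.le
    have a2 : Continuous fun z : ℝ × ℝ => z.2 ^ (p - 1) :=
      continuous_snd.rpow_const fun _ => Or.inr hp1.le
    fun_prop
  have hQ1 : Q (1, 1) = S.slope u v := by
    have := S.integral_combination hp u v zero_le_one zero_le_one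
    rw [one_smul, one_smul, S.pos_add_neg] at this
    exact this.symm
  have hQev : ∀ᶠ z in 𝓝 ((1 : ℝ), (1 : ℝ)), Q z < S.slope u v / 2 :=
    hQc.continuousAt.eventually_lt continuousAt_const (by rw [hQ1]; linarith)
  obtain ⟨δ₀, hδ₀, hball⟩ := Metric.eventually_nhds_iff.1 hQev
  obtain ⟨δ, hδ, hδ0, hδ1⟩ : ∃ δ : ℝ, 0 < δ ∧ δ < δ₀ ∧ δ < 1 :=
    ⟨min δ₀ 1 / 2, by positivity, by have := min_le_left δ₀ 1; have : 0 < min δ₀ 1 := by positivity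
                                     linarith,
      by have := min_le_right δ₀ 1; linarith⟩
  have hQ : ∀ t ∈ Set.Icc (1 - δ) (1 + δ), ∀ s ∈ Set.Icc (1 - δ) (1 + δ),
      Q (t, s) < S.slope u v / 2 := by
    intro t ht s hs
    refine hball (lt_of_le_of_lt ?_ hδ0)
    rw [Prod.dist_eq, max_le_iff]
    simp only [Real.dist_eq, abs_le]
    exact ⟨⟨by linarith [ht.1], by linarith [ht.2]⟩, ⟨by linarith [hs.1], by linarith [hs.2]⟩⟩
  have hI : ∀ t ∈ Set.Icc (1 - δ) (1 + δ), 0 < t := fun t ht => by linarith [ht.1]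
  have hlo : 1 - δ ∈ Set.Icc (1 - δ) (1 + δ) := ⟨le_rfl, by linarith⟩
  have hhi : 1 + δ ∈ Set.Icc (1 - δ) (1 + δ) := ⟨by linarith, le_rfl⟩
  -- tube argument in the variable `r`
  have tube : ∀ f : (ℝ × ℝ) × ℝ → ℝ, Continuous f → ∀ K : Set (ℝ × ℝ), IsCompact K →
      (∀ z ∈ K, 0 < f (z, 0)) → ∀ᶠ r in 𝓝 (0 : ℝ), ∀ z ∈ K, 0 < f (z, r) := by
    intro f hf K hK h
    refine hK.eventually_forall_of_forall_eventually fun z hz => ?_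
    have hc : Continuous fun y : ℝ × (ℝ × ℝ) => f (y.2, y.1) := by fun_prop
    exact continuousAt_const.eventually_lt (hc.continuousAt (x := ((0 : ℝ), z))) (h z hz)
  have hKI : IsCompact (Set.Icc (1 - δ) (1 + δ)) := isCompact_Icc
  have hsq : IsCompact (Set.Icc (1 - δ) (1 + δ) ×ˢ Set.Icc (1 - δ) (1 + δ)) := hKI.prod hKI
  -- The function `t² - t^p` is positive at `1 - δ` and negative at `1 + δ`. Multiplied by the power
  -- of a part, it is the defect `form - power` on the edges.
  have hlt : (1 - δ) ^ p < (1 - δ) ^ 2 := by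
    rw [← Real.rpow_natCast]
    exact Real.rpow_lt_rpow_of_exponent_gt (by linarith) (by linarith) (by push_cast; exact hp)
  have hgt : (1 + δ) ^ 2 < (1 + δ) ^ p := by
    rw [← Real.rpow_natCast]
    exact Real.rpow_lt_rpow_of_exponent_lt (by linarith) (by push_cast; exact hp)
  have T1 := tube _ (hcF.sub hcP) ({1 - δ} ×ˢ Set.Icc (1 - δ) (1 + δ))
    (isCompact_singleton.prod hKI) (by
      rintro ⟨t, s⟩ ⟨rfl : t = 1 - δ, hs⟩
      have := e1 (1 - δ) s (by linarith) (hI s hs).le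
      rw [Pi.sub_apply, S.form_self_congr this, S.power_congr this, S.form_smul,
        S.power_smul (by linarith), hu.1.2]
      nlinarith)
  have T2 := tube _ (hcP.sub hcF) ({1 + δ} ×ˢ Set.Icc (1 - δ) (1 + δ))
    (isCompact_singleton.prod hKI) (by
      rintro ⟨t, s⟩ ⟨rfl : t = 1 + δ, hs⟩
      have := e1 (1 + δ) s (by linarith) (hI s hs).le
      rw [Pi.sub_apply, S.form_self_congr this, S.power_congr this, S.form_smul,
        S.power_smul (by linarith), hu.1.2]
      nlinarith)
  have T3 := tube _ (hcG.sub hcN) (Set.Icc (1 - δ) (1 + δ) ×ˢ {1 - δ})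
    (hKI.prod isCompact_singleton) (by
      rintro ⟨t, s⟩ ⟨ht, rfl : s = 1 - δ⟩
      have := e2 t (1 - δ) (hI t ht).le (by linarith)
      rw [Pi.sub_apply, S.form_self_congr this, S.power_congr this, S.form_smul,
        S.power_smul (by linarith), hu.2.2]
      nlinarith)
  have T4 := tube _ (hcN.sub hcG) (Set.Icc (1 - δ) (1 + δ) ×ˢ {1 + δ})
    (hKI.prod isCompact_singleton) (by
      rintro ⟨t, s⟩ ⟨ht, rfl : s = 1 + δ⟩
      have := e2 t (1 + δ) (hI t ht).le (by linarith)
      rw [Pi.sub_apply, S.form_self_congr this, S.power_congr this, S.form_smul,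
        S.power_smul (by linarith), hu.2.2]
      nlinarith)
  -- `T5` and `T6` keep both parts nonzero on the perturbed square; `T7` keeps the quadratic term
  -- from outweighing the slope.
  have T5 := tube _ hcP _ hsq (by
      rintro ⟨t, s⟩ ⟨ht, hs⟩
      rw [S.power_congr (e1 t s (hI t ht).le (hI s hs).le), S.power_smul (hI t ht).le]
      have := Real.rpow_pos_of_pos (hI t ht) p
      positivity)
  have T6 := tube _ hcN _ hsq (by
      rintro ⟨t, s⟩ ⟨ht, hs⟩
      rw [S.power_congr (e2 t s (hI t ht).le (hI s hs).le), S.power_smul (hI s hs).le]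
      have := Real.rpow_pos_of_pos (hI s hs) p
      positivity)
  have T7 : ∀ᶠ r in 𝓝 (0 : ℝ), S.slope u v / 2 + r / 2 * S.form v v < 0 := by
    have : ContinuousAt (fun r : ℝ => S.slope u v / 2 + r / 2 * S.form v v) 0 := by fun_prop
    exact this.eventually_lt continuousAt_const (by simp; linarith)
  obtain ⟨r, hr0, T1, T2, T3, T4, T5, T6, T7⟩ : ∃ r : ℝ, 0 < r ∧ _ :=
    ((eventually_mem_nhdsWithin (a := (0 : ℝ)) (s := Set.Ioi 0)).and
      (((T1.and (T2.and (T3.and (T4.and (T5.and (T6.and T7)))))).filter_mono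
        nhdsWithin_le_nhds))).exists
  have hslice : Continuous fun z : ℝ × ℝ => (z, r) := by fun_prop
  obtain ⟨t, ht, s, hs, hz1, hz2⟩ := exists_zero_of_signs_on_boundary
    ((hcF.sub hcP).comp hslice) ((hcG.sub hcN).comp hslice) (a := 1 - δ) (b := 1 + δ)
    (by linarith)
    (fun y hy => T1 (1 - δ, y) ⟨rfl, hy⟩)
    (fun y hy => by have := T2 (1 + δ, y) ⟨rfl, hy⟩; simp only [Function.comp, Pi.sub_apply] at this ⊢; linarith)
    (fun x hx => T3 (x, 1 - δ) ⟨hx, rfl⟩)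
    (fun x hx => by have := T4 (x, 1 + δ) ⟨hx, rfl⟩; simp only [Function.comp, Pi.sub_apply] at this ⊢; linarith)
  simp only [Function.comp, Pi.sub_apply] at hz1 hz2
  have hnz : ∀ z : S.space, 0 < S.power z → ¬ (z : X → ℝ) =ᵐ[μ] 0 := by
    intro z hz h
    have : S.power z = S.power 0 := S.power_congr h
    have h0 : S.power 0 = 0 := by
      simp [power, Real.zero_rpow (by linarith : p ≠ 0)]
    linarith
  have hmem : S.family u v ((t, s), r) ∈ S.nodalSet :=
    ⟨⟨hnz _ (T5 (t, s) ⟨ht, hs⟩), by linarith⟩, ⟨hnz _ (T6 (t, s) ⟨ht, hs⟩), by linarith⟩⟩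
  have hle := hmin _ hmem
  have hup := S.functional_add_smul_le hp (t • S.pos u + s • S.neg u) v r
  rw [S.integral_combination hp u v (hI t ht).le (hI s hs).le] at hup
  have hq := hQ t ht s hs
  have hpl := S.functional_parts_le hp hu (hI t ht).le (hI s hs).le
  -- The step along `v` lowers the energy strictly below that of `t u⁺ + s u⁻`, which does not
  -- exceed the minimum.
  have : r * Q (t, s) + r ^ 2 / 2 * S.form v v < 0 := by
    have : r * (Q (t, s) + r / 2 * S.form v v) < 0 :=
      mul_neg_of_pos_of_neg hr0 (by linarith)
    nlinarith
  have hup' : S.functional (S.family u v ((t, s), r)) ≤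
    S.functional (t • S.pos u + s • S.neg u) + r * Q (t, s) + r ^ 2 / 2 * S.form v v := hup
  linarith

end CompactForm

end NodalYamabe

end

noncomputable section

namespace NodalYamabe

/-! ### Interpolation and lower semicontinuity -/

section Interpolation

variable {X : Type*} [MeasurableSpace X] {μ : Measure X}

/-- Hölder's inequality with weights `θ = (q - p)/(q - 2)` and `1 - θ`, chosen so that `p = 2θ + q(1
- θ)`. -/
theorem lintegral_rpow_interpolate {p q : ℝ} (hp : 2 < p) (hpq : p < q) {f : X → ℝ≥0∞}
    (hf : AEMeasurable f μ) :
    ∫⁻ x, f x ^ p ∂μ ≤ (∫⁻ x, f x ^ (2 : ℝ) ∂μ) ^ ((q - p) / (q - 2)) *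
      (∫⁻ x, f x ^ q ∂μ) ^ ((p - 2) / (q - 2)) := by
  have hq2 : 0 < q - 2 := by linarith
  have h := ENNReal.lintegral_mul_norm_pow_le (μ := μ) (f := fun x => f x ^ (2 : ℝ))
    (g := fun x => f x ^ q) (p := (q - p) / (q - 2)) (q := (p - 2) / (q - 2))
    (hf.pow_const _) (hf.pow_const _) (div_nonneg (by linarith) hq2.le)
    (div_nonneg (by linarith) hq2.le) (by field_simp; ring)
  refine le_trans (le_of_eq (lintegral_congr fun x => ?_)) h
  rw [← ENNReal.rpow_mul, ← ENNReal.rpow_mul, ← ENNReal.rpow_add_of_nonneg]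
  · congr 1; field_simp; ring
  · exact mul_nonneg (by norm_num) (div_nonneg (by linarith) hq2.le)
  · exact mul_nonneg (by linarith) (div_nonneg (by linarith) hq2.le)

theorem eLpNorm_ofReal_eq {E : Type*} [NormedAddCommGroup E] {p : ℝ} (hp : 0 < p) (f : X → E) :
    eLpNorm f (ENNReal.ofReal p) μ = (∫⁻ x, ‖f x‖ₑ ^ p ∂μ) ^ (1 / p) := by
  rw [eLpNorm_eq_lintegral_rpow_enorm_toReal (by simpa using hp) (by simp),
    ENNReal.toReal_ofReal hp.le]

/-- Rellich's theorem gives convergence in `L²` only; a bound at the critical exponent `q` upgrades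
it to every exponent strictly between `2` and `q`. -/
theorem tendsto_eLpNorm_interpolate {p q : ℝ} (hp : 2 < p) (hpq : p < q) {f : ℕ → X → ℝ}
    (hf : ∀ k, AEStronglyMeasurable (f k) μ) {C : ℝ≥0∞} (hC : C ≠ ⊤)
    (hb : ∀ k, eLpNorm (f k) (ENNReal.ofReal q) μ ≤ C)
    (h : Tendsto (fun k => eLpNorm (f k) 2 μ) atTop (𝓝 0)) :
    Tendsto (fun k => eLpNorm (f k) (ENNReal.ofReal p) μ) atTop (𝓝 0) := by
  have hq0 : 0 < q := by linarith
  have hp0 : 0 < p := by linarith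
  have h2 : Tendsto (fun k => ∫⁻ x, ‖f k x‖ₑ ^ (2 : ℝ) ∂μ) atTop (𝓝 0) := by
    have := (ENNReal.continuous_rpow_const (y := (2 : ℝ))).tendsto 0 |>.comp h
    rw [ENNReal.zero_rpow_of_pos (by norm_num)] at this
    refine this.congr fun k => ?_
    have e : (2 : ℝ≥0∞) = ENNReal.ofReal 2 := by simp
    simp only [Function.comp]
    rw [e, eLpNorm_ofReal_eq (by norm_num), ← ENNReal.rpow_mul]
    norm_num
  have hq : ∀ k, ∫⁻ x, ‖f k x‖ₑ ^ q ∂μ ≤ C ^ q := fun k => by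
    have := ENNReal.rpow_le_rpow (hb k) hq0.le
    rwa [eLpNorm_ofReal_eq hq0, ← ENNReal.rpow_mul, one_div_mul_cancel hq0.ne',
      ENNReal.rpow_one] at this
  have hθ : 0 < (q - p) / (q - 2) := div_pos (by linarith) (by linarith)
  have hθ' : 0 ≤ (p - 2) / (q - 2) := div_nonneg (by linarith) (by linarith)
  have hup : Tendsto (fun k => ((∫⁻ x, ‖f k x‖ₑ ^ (2 : ℝ) ∂μ) ^ ((q - p) / (q - 2)) *
      (C ^ q) ^ ((p - 2) / (q - 2))) ^ (1 / p)) atTop (𝓝 0) := by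
    have t1 := (ENNReal.continuous_rpow_const (y := (q - p) / (q - 2))).tendsto 0 |>.comp h2
    rw [ENNReal.zero_rpow_of_pos hθ] at t1
    have hfin : (C ^ q) ^ ((p - 2) / (q - 2)) ≠ ⊤ :=
      ENNReal.rpow_ne_top_of_nonneg hθ' (ENNReal.rpow_ne_top_of_nonneg hq0.le hC)
    have t2 := ENNReal.Tendsto.mul_const t1 (Or.inr hfin)
    rw [zero_mul] at t2
    have t3 := (ENNReal.continuous_rpow_const (y := 1 / p)).tendsto 0 |>.comp t2
    rw [ENNReal.zero_rpow_of_pos (by positivity)] at t3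
    exact t3
  refine tendsto_of_tendsto_of_tendsto_of_le_of_le tendsto_const_nhds hup (fun _ => zero_le)
    fun k => ?_
  beta_reduce
  rw [eLpNorm_ofReal_eq hp0]
  refine ENNReal.rpow_le_rpow ?_ (by positivity)
  refine (lintegral_rpow_interpolate hp hpq (hf k).enorm).trans ?_
  gcongr
  exact hq k

end Interpolation

section LowerSemicontinuity

variable {W Y : Type*} [NormedAddCommGroup W] [NormedSpace ℝ W] [CompleteSpace W]
  [NormedAddCommGroup Y] [NormedSpace ℝ Y]

/-- Convex combinations of tails of a sequence of bounded energy converge strongly; hence the energy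
is lower semicontinuous for the convergence of the images under any continuous linear map. -/
theorem exists_limit_of_coercive (B : W →L[ℝ] W →L[ℝ] ℝ) (hsymm : ∀ a b, B a b = B b a) {c : ℝ}
    (hc : 0 < c) (hB : ∀ a, c * ‖a‖ ^ 2 ≤ B a a) (T : W →L[ℝ] Y) {h : ℕ → W} {l : ℝ} {y : Y}
    (hl : Tendsto (fun k => B (h k) (h k)) atTop (𝓝 l))
    (hy : Tendsto (fun k => T (h k)) atTop (𝓝 y)) :
    ∃ w, T w = y ∧ B w w ≤ l := by
  have hnn : ∀ a, 0 ≤ B a a := fun a => le_trans (by positivity) (hB a)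
  -- `K k` is the convex hull of a tail and `α k` is the infimum of the form on it. As the hulls
  -- shrink, `α` increases to a limit `A ≤ l`, and almost minimising points `w k ∈ K k` turn out to
  -- be a Cauchy sequence.
  let K : ℕ → Set W := fun k => convexHull ℝ (h '' Set.Ici k)
  have hK : Antitone K := fun i j hij => convexHull_mono (Set.image_mono (Set.Ici_subset_Ici.2 hij))
  let Q : W → ℝ := fun a => B a a
  have hhK : ∀ k j, k ≤ j → h j ∈ K k := fun k j hkj => subset_convexHull ℝ _ ⟨j, hkj, rfl⟩
  have hne : ∀ k, (Q '' K k).Nonempty := fun k => ⟨_, h k, hhK k k le_rfl, rfl⟩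
  have hbdd : ∀ k, BddBelow (Q '' K k) := fun k => ⟨0, by rintro _ ⟨a, -, rfl⟩; exact hnn a⟩
  let α : ℕ → ℝ := fun k => sInf (Q '' K k)
  have hαle : ∀ k a, a ∈ K k → α k ≤ B a a := fun k a ha => csInf_le (hbdd k) ⟨a, ha, rfl⟩
  have hαl : ∀ k, α k ≤ l := fun k =>
    ge_of_tendsto hl ((eventually_ge_atTop k).mono fun j hj => hαle k _ (hhK k j hj))
  have hαm : Monotone α := fun i j hij =>
    csInf_le_csInf (hbdd i) (hne j) (Set.image_mono (hK hij))
  have hαt : Tendsto α atTop (𝓝 (⨆ k, α k)) :=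
    tendsto_atTop_ciSup hαm ⟨l, by rintro _ ⟨k, rfl⟩; exact hαl k⟩
  set A := ⨆ k, α k
  have hαA : ∀ k, α k ≤ A := fun k => le_ciSup ⟨l, by rintro _ ⟨k, rfl⟩; exact hαl k⟩ k
  have hAl : A ≤ l := ciSup_le hαl
  have hex : ∀ k : ℕ, ∃ w ∈ K k, B w w < α k + 1 / ((k : ℝ) + 1) := fun k => by
    obtain ⟨_, ⟨w, hw, rfl⟩, hlt⟩ := exists_lt_of_csInf_lt (hne k)
      (lt_add_of_pos_right (sInf (Q '' K k)) (by positivity : (0 : ℝ) < 1 / ((k : ℝ) + 1)))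
    exact ⟨w, hw, hlt⟩
  choose w hwK hwlt using hex
  have hzero : Tendsto (fun k : ℕ => 1 / ((k : ℝ) + 1)) atTop (𝓝 0) :=
    tendsto_one_div_add_atTop_nhds_zero_nat
  have hpar : ∀ k j, k ≤ j → B (w k - w j) (w k - w j) ≤ 2 * (A - α k) + 4 * (1 / ((k : ℝ) + 1)) := by
    intro k j hkj
    -- The midpoint lies in `K k`, so its form is at least `α k`; the parallelogram identity then
    -- bounds the form of `w k - w j`.
    have hmid : (1 / 2 : ℝ) • w k + (1 / 2 : ℝ) • w j ∈ K k :=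
      (convex_convexHull ℝ _) (hwK k) (hK hkj (hwK j)) (by norm_num) (by norm_num) (by norm_num)
    have h1 := hαle k _ hmid
    have h2 := hwlt k
    have h3 := hwlt j
    have h4 : 1 / ((j : ℝ) + 1) ≤ 1 / ((k : ℝ) + 1) :=
      one_div_le_one_div_of_le (by positivity) (by exact_mod_cast Nat.succ_le_succ hkj)
    have h5 := hαA j
    simp only [map_add, map_sub, map_smul, _root_.add_apply,
      _root_.sub_apply, _root_.smul_apply, smul_eq_mul,
      hsymm (w j) (w k)] at h1 ⊢
    linarith
  have hcauchy : CauchySeq w := by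
    rw [Metric.cauchySeq_iff']
    intro ε hε
    have ht : Tendsto (fun k : ℕ => 2 * (A - α k) + 4 * (1 / ((k : ℝ) + 1))) atTop (𝓝 0) := by
      have := ((tendsto_const_nhds (x := A)).sub hαt).const_mul 2 |>.add (hzero.const_mul 4)
      simpa using this
    obtain ⟨N, hN⟩ := (ht.eventually_lt_const (u := c * ε ^ 2) (by positivity)).exists
    refine ⟨N, fun j hj => ?_⟩
    have h1 := (hB (w N - w j)).trans_lt ((hpar N j hj).trans_lt hN)
    rw [dist_eq_norm, norm_sub_rev]
    exact lt_of_pow_lt_pow_left₀ 2 hε.le (lt_of_mul_lt_mul_left h1 hc.le)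
  obtain ⟨w₀, hw₀⟩ := cauchySeq_tendsto_of_complete hcauchy
  refine ⟨w₀, ?_, ?_⟩
  · refine tendsto_nhds_unique ((T.continuous.tendsto w₀).comp hw₀) ?_
    rw [Metric.tendsto_atTop]
    intro ε hε
    obtain ⟨N, hN⟩ := (Metric.tendsto_atTop.1 hy) ε hε
    refine ⟨N, fun k hk => ?_⟩
    -- Balls are convex, so once the images of a tail lie in a ball about `y`, so do the images of
    -- its convex combinations.
    have hsub : K k ⊆ T ⁻¹' (Metric.ball y ε) := by
      refine convexHull_min ?_ ((convex_ball y ε).is_linear_preimage T.toLinearMap.isLinear)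
      rintro _ ⟨j, hj, rfl⟩
      exact hN j (le_trans hk hj)
    exact hsub (hwK k)
  · have hQc : Continuous fun a => B a a := by fun_prop
    refine le_trans (le_of_tendsto_of_tendsto ((hQc.tendsto w₀).comp hw₀) (hαt.add hzero)
      (Eventually.of_forall fun k => (hwlt k).le)) ?_
    simpa using hAl

end LowerSemicontinuity

end NodalYamabe

end

noncomputable section

namespace NodalYamabe

/-! ### Sobolev spaces defined by closing a gradient -/

section Tools

variable {X : Type*} [MeasurableSpace X] {μ : Measure X} {E : Type*} [NormedAddCommGroup E]

theorem tendsto_eLpNorm_two_of_dominated {F : ℕ → X → E} {G : X → ℝ}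
    (hF : ∀ k, AEStronglyMeasurable (F k) μ) (hG : MemLp G 2 μ)
    (hb : ∀ k, ∀ᵐ x ∂μ, ‖F k x‖ ≤ G x) (h : ∀ᵐ x ∂μ, Tendsto (fun k => F k x) atTop (𝓝 0)) :
    Tendsto (fun k => eLpNorm (F k) 2 μ) atTop (𝓝 0) := by
  have e2 : (2 : ℝ≥0∞) = ENNReal.ofReal 2 := by simp
  have e : ∀ k, eLpNorm (F k) 2 μ = (∫⁻ x, ‖F k x‖ₑ ^ (2 : ℝ) ∂μ) ^ (1 / (2 : ℝ)) := fun k => by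
    rw [e2, eLpNorm_ofReal_eq (by norm_num)]
  simp only [e]
  have hG' : ∫⁻ x, ‖G x‖ₑ ^ (2 : ℝ) ∂μ ≠ ⊤ := by
    have := hG.2
    rw [e2, eLpNorm_ofReal_eq (by norm_num)] at this
    intro h
    rw [h] at this
    norm_num at this
  have hlim := tendsto_lintegral_of_dominated_convergence' (μ := μ)
    (F := fun k x => ‖F k x‖ₑ ^ (2 : ℝ)) (f := fun _ => 0) (fun x => ‖G x‖ₑ ^ (2 : ℝ))
    (fun k => (hF k).enorm.pow_const _)
    (fun k => (hb k).mono fun x hx => by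
      refine ENNReal.rpow_le_rpow ?_ (by norm_num)
      exact enorm_le_iff_norm_le.2 (hx.trans (le_abs_self _))) hG'
    (h.mono fun x hx => by
      have := (ENNReal.continuous_rpow_const (y := (2 : ℝ))).tendsto _ |>.comp hx.enorm
      simpa [Function.comp_def] using this)
  have := (ENNReal.continuous_rpow_const (y := 1 / (2 : ℝ))).tendsto _ |>.comp hlim
  simpa [Function.comp_def] using this

/-- Smooth approximations of the positive part. -/
def smoothPos (k : ℕ) (t : ℝ) : ℝ := t * Real.smoothTransition (((k : ℝ) + 1) * t)

theorem contDiff_smoothPos (k : ℕ) : ContDiff ℝ ∞ (smoothPos k) :=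
  contDiff_id.mul (Real.smoothTransition.contDiff.comp (contDiff_const.mul contDiff_id))

theorem deriv_smoothPos (k : ℕ) (t : ℝ) : deriv (smoothPos k) t =
    Real.smoothTransition (((k : ℝ) + 1) * t) +
      (((k : ℝ) + 1) * t) * deriv Real.smoothTransition (((k : ℝ) + 1) * t) := by
  have hS : Differentiable ℝ Real.smoothTransition :=
    (Real.smoothTransition.contDiff (n := 1)).differentiable (by norm_num)
  have h1 : HasDerivAt (fun t : ℝ => ((k : ℝ) + 1) * t) ((k : ℝ) + 1) t := by
    simpa using (hasDerivAt_id t).const_mul ((k : ℝ) + 1)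
  have h2 := (hS (((k : ℝ) + 1) * t)).hasDerivAt.comp t h1
  have h3 := ((hasDerivAt_id t).mul h2).deriv
  refine Eq.trans ?_ (h3.trans ?_)
  · rfl
  · simp only [id, Function.comp]; ring

theorem deriv_smoothTransition_of_one_lt {y : ℝ} (hy : 1 < y) :
    deriv Real.smoothTransition y = 0 := by
  have : Real.smoothTransition =ᶠ[𝓝 y] fun _ => 1 :=
    (lt_mem_nhds hy).mono fun z hz => Real.smoothTransition.one_of_one_le (le_of_lt hz)
  rw [this.deriv_eq, deriv_const]

theorem deriv_smoothTransition_of_neg {y : ℝ} (hy : y < 0) :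
    deriv Real.smoothTransition y = 0 := by
  have : Real.smoothTransition =ᶠ[𝓝 y] fun _ => 0 :=
    (gt_mem_nhds hy).mono fun z hz => Real.smoothTransition.zero_of_nonpos (le_of_lt hz)
  rw [this.deriv_eq, deriv_const]

/-- In terms of `y = (k + 1) t` the derivative is `S(y) + y S'(y)`, with `S` the smooth transition.
This expression does not involve `k`, and `S'` vanishes off `[0, 1]`. -/
theorem exists_bound_deriv_smoothPos : ∃ C : ℝ, 0 ≤ C ∧ ∀ k t, |deriv (smoothPos k) t| ≤ C := by
  have hc : Continuous (deriv Real.smoothTransition) :=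
    (Real.smoothTransition.contDiff (n := 1)).continuous_deriv (by norm_num)
  obtain ⟨C, hC⟩ := (isCompact_Icc (a := (0 : ℝ)) (b := 1)).exists_bound_of_continuousOn
    (f := fun y => y * deriv Real.smoothTransition y) (by fun_prop)
  have hC0 : 0 ≤ C := (norm_nonneg _).trans (hC 0 (by simp))
  refine ⟨1 + C, by linarith, fun k t => ?_⟩
  rw [deriv_smoothPos]
  set y := ((k : ℝ) + 1) * t
  refine (abs_add_le _ _).trans (add_le_add ?_ ?_)
  · rw [abs_of_nonneg (Real.smoothTransition.nonneg y)]
    exact Real.smoothTransition.le_one y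
  · by_cases hy : y ∈ Set.Icc (0 : ℝ) 1
    · exact hC y hy
    · rw [Set.mem_Icc, not_and_or, not_le, not_le] at hy
      rcases hy with hy | hy
      · simp [deriv_smoothTransition_of_neg hy, hC0]
      · simp [deriv_smoothTransition_of_one_lt hy, hC0]

theorem tendsto_smoothPos (t : ℝ) : Tendsto (fun k => smoothPos k t) atTop (𝓝 (max t 0)) := by
  rcases le_or_gt t 0 with h | h
  · refine tendsto_const_nhds.congr fun k => ?_
    rw [max_eq_right h, smoothPos, Real.smoothTransition.zero_of_nonpos, mul_zero]
    exact mul_nonpos_of_nonneg_of_nonpos (by positivity) h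
  · obtain ⟨N, hN⟩ := exists_nat_gt (1 / t)
    refine tendsto_const_nhds.congr' ((eventually_ge_atTop N).mono fun k hk => ?_)
    beta_reduce
    rw [max_eq_left h.le, smoothPos, Real.smoothTransition.one_of_one_le, mul_one]
    rw [div_lt_iff₀ h] at hN
    have : (N : ℝ) ≤ k := by exact_mod_cast hk
    nlinarith

/-- The limit at `t = 0` is `0` because `S(0) = 0` and the second term carries the factor `y = 0`.
So the convergence holds at every point, and nothing has to be known about the gradient on `{u =
0}`. -/
theorem tendsto_deriv_smoothPos (t : ℝ) :
    Tendsto (fun k => deriv (smoothPos k) t) atTop (𝓝 (if 0 < t then 1 else 0)) := by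
  rcases lt_trichotomy t 0 with h | h | h
  · refine tendsto_const_nhds.congr fun k => ?_
    have : ((k : ℝ) + 1) * t < 0 := mul_neg_of_pos_of_neg (by positivity) h
    rw [deriv_smoothPos, Real.smoothTransition.zero_of_nonpos this.le,
      deriv_smoothTransition_of_neg this, if_neg (not_lt.2 h.le)]
    ring
  · subst h
    refine tendsto_const_nhds.congr fun k => ?_
    rw [deriv_smoothPos]
    simp
  · obtain ⟨N, hN⟩ := exists_nat_gt (1 / t)
    refine tendsto_const_nhds.congr' ((eventually_ge_atTop N).mono fun k hk => ?_)
    rw [div_lt_iff₀ h] at hN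
    have : (N : ℝ) ≤ k := by exact_mod_cast hk
    have h1 : 1 < ((k : ℝ) + 1) * t := by nlinarith
    beta_reduce
    rw [deriv_smoothPos, Real.smoothTransition.one_of_one_le h1.le,
      deriv_smoothTransition_of_one_lt h1, if_pos h]
    ring

theorem abs_smoothPos_le (k : ℕ) (t : ℝ) : |smoothPos k t| ≤ |t| := by
  rw [smoothPos, abs_mul, abs_of_nonneg (Real.smoothTransition.nonneg _)]
  exact mul_le_of_le_one_right (abs_nonneg _) (Real.smoothTransition.le_one _)

end Tools

/-- A space of smooth functions with a closable gradient that satisfies the chain rule, a Sobolev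
inequality with exponent `q` and Rellich's theorem. -/
structure GradientData {X : Type*} [MeasurableSpace X] (μ : Measure X) (E : Type*)
    [NormedAddCommGroup E] [NormedSpace ℝ E] (q : ℝ) where
  smooth : Submodule ℝ (X → ℝ)
  grad : smooth →ₗ[ℝ] (X → E)
  memLp : ∀ φ : smooth, MemLp (φ : X → ℝ) 2 μ
  memLp_grad : ∀ φ : smooth, MemLp (grad φ) 2 μ
  comp : ∀ (φ : smooth) (f : ℝ → ℝ), ContDiff ℝ ∞ f → ∃ ψ : smooth,
    (ψ : X → ℝ) = (fun x => f ((φ : X → ℝ) x)) ∧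
      grad ψ = fun x => deriv f ((φ : X → ℝ) x) • grad φ x
  closable : ∀ (φ : ℕ → smooth) (F : X → E), MemLp F 2 μ →
    Tendsto (fun k => eLpNorm (φ k : X → ℝ) 2 μ) atTop (𝓝 0) →
    Tendsto (fun k => eLpNorm (grad (φ k) - F) 2 μ) atTop (𝓝 0) → F =ᵐ[μ] 0
  const : ℝ≥0∞
  const_ne_top : const ≠ ⊤
  sobolev : ∀ φ : smooth, eLpNorm (φ : X → ℝ) (ENNReal.ofReal q) μ ≤
    const * (eLpNorm (φ : X → ℝ) 2 μ + eLpNorm (grad φ) 2 μ)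
  rellich : ∀ (φ : ℕ → smooth) (C : ℝ≥0∞), C ≠ ⊤ → (∀ k, eLpNorm (φ k : X → ℝ) 2 μ ≤ C) →
    (∀ k, eLpNorm (grad (φ k)) 2 μ ≤ C) → ∃ (σ : ℕ → ℕ) (u : X → ℝ), StrictMono σ ∧ MemLp u 2 μ ∧
      Tendsto (fun k => eLpNorm ((φ (σ k) : X → ℝ) - u) 2 μ) atTop (𝓝 0)

namespace GradientData

variable {X : Type*} [MeasurableSpace X] {μ : Measure X} {E : Type*}
    [NormedAddCommGroup E] [NormedSpace ℝ E] {q : ℝ} (D : GradientData μ E q)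

/-- The graph of the gradient in `L² × L²`. -/
def graph : Submodule ℝ (Lp ℝ 2 μ × Lp E 2 μ) :=
  LinearMap.range (
    { toFun := fun φ => ((D.memLp φ).toLp _, (D.memLp_grad φ).toLp _)
      map_add' := fun φ ψ => Prod.ext rfl (by
        simp only [map_add]
        exact MemLp.toLp_add (D.memLp_grad φ) (D.memLp_grad ψ))
      map_smul' := fun a φ => Prod.ext rfl (by
        simp only [map_smul]
        exact MemLp.toLp_const_smul a (D.memLp_grad φ)) } :
      D.smooth →ₗ[ℝ] Lp ℝ 2 μ × Lp E 2 μ)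

theorem mk_mem_graph (φ : D.smooth) :
    ((D.memLp φ).toLp _, (D.memLp_grad φ).toLp _) ∈ D.graph := ⟨φ, rfl⟩

/-- The Sobolev space as a closed subspace of `L² × L²`. -/
def closedGraph : Submodule ℝ (Lp ℝ 2 μ × Lp E 2 μ) := D.graph.topologicalClosure

/-- `F` is the Sobolev gradient of `u`. -/
structure IsGrad (u : X → ℝ) (F : X → E) : Prop where
  memLp : MemLp u 2 μ
  memLp_grad : MemLp F 2 μ
  mem : (memLp.toLp u, memLp_grad.toLp F) ∈ D.closedGraph

variable {D}

theorem isGrad_smooth (φ : D.smooth) : D.IsGrad (φ : X → ℝ) (D.grad φ) :=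
  ⟨D.memLp φ, D.memLp_grad φ, D.graph.le_topologicalClosure (D.mk_mem_graph φ)⟩

theorem isGrad_of_mem {h : Lp ℝ 2 μ × Lp E 2 μ} (hh : h ∈ D.closedGraph) : D.IsGrad h.1 h.2 :=
  ⟨Lp.memLp _, Lp.memLp _, by rwa [Lp.toLp_coeFn, Lp.toLp_coeFn]⟩

theorem IsGrad.add {u u' : X → ℝ} {F F' : X → E} (h : D.IsGrad u F) (h' : D.IsGrad u' F') :
    D.IsGrad (u + u') (F + F') :=
  ⟨h.memLp.add h'.memLp, h.memLp_grad.add h'.memLp_grad, D.closedGraph.add_mem h.mem h'.mem⟩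

theorem IsGrad.smul {u : X → ℝ} {F : X → E} (a : ℝ) (h : D.IsGrad u F) :
    D.IsGrad (a • u) (a • F) :=
  ⟨h.memLp.const_smul a, h.memLp_grad.const_smul a, D.closedGraph.smul_mem a h.mem⟩

theorem IsGrad.of_tendsto {u : ℕ → X → ℝ} {F : ℕ → X → E} {u₀ : X → ℝ} {F₀ : X → E}
    (h : ∀ k, D.IsGrad (u k) (F k)) (hu₀ : MemLp u₀ 2 μ) (hF₀ : MemLp F₀ 2 μ)
    (hu : Tendsto (fun k => eLpNorm (u k - u₀) 2 μ) atTop (𝓝 0))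
    (hF : Tendsto (fun k => eLpNorm (F k - F₀) 2 μ) atTop (𝓝 0)) : D.IsGrad u₀ F₀ := by
  refine ⟨hu₀, hF₀, ?_⟩
  have hclosed : IsClosed (D.closedGraph : Set (Lp ℝ 2 μ × Lp E 2 μ)) :=
    Submodule.isClosed_topologicalClosure _
  refine hclosed.mem_of_tendsto (b := atTop)
    (f := fun k => ((h k).memLp.toLp (u k), (h k).memLp_grad.toLp (F k)))
    (Tendsto.prodMk_nhds ?_ ?_) (Eventually.of_forall fun k => (h k).mem)
  · exact (Lp.tendsto_Lp_iff_tendsto_eLpNorm'' _ _ _ _).2 hu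
  · exact (Lp.tendsto_Lp_iff_tendsto_eLpNorm'' _ _ _ _).2 hF

theorem IsGrad.exists_approx {u : X → ℝ} {F : X → E} (h : D.IsGrad u F) :
    ∃ φ : ℕ → D.smooth, Tendsto (fun k => eLpNorm ((φ k : X → ℝ) - u) 2 μ) atTop (𝓝 0) ∧
      Tendsto (fun k => eLpNorm (D.grad (φ k) - F) 2 μ) atTop (𝓝 0) := by
  obtain ⟨x, hx, hlim⟩ := mem_closure_iff_seq_limit.1 h.mem
  choose φ hφ using hx
  refine ⟨φ, ?_, ?_⟩
  · refine (Lp.tendsto_Lp_iff_tendsto_eLpNorm'' (fun k => (φ k : X → ℝ)) (fun k => D.memLp (φ k))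
      u h.memLp).1 ?_
    refine ((continuous_fst.tendsto _).comp hlim).congr fun k => ?_
    rw [Function.comp, ← hφ k]; rfl
  · refine (Lp.tendsto_Lp_iff_tendsto_eLpNorm'' (fun k => D.grad (φ k))
      (fun k => D.memLp_grad (φ k)) F h.memLp_grad).1 ?_
    refine ((continuous_snd.tendsto _).comp hlim).congr fun k => ?_
    rw [Function.comp, ← hφ k]; rfl

/-- Closability is assumed for sequences of smooth functions, and every pair in the closed graph is
a limit of such a sequence. It makes the Sobolev gradient unique. -/
theorem IsGrad.eq_zero {u : X → ℝ} {F : X → E} (h : D.IsGrad u F) (hu : u =ᵐ[μ] 0) :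
    F =ᵐ[μ] 0 := by
  obtain ⟨φ, h1, h2⟩ := h.exists_approx
  refine D.closable φ F h.memLp_grad (h1.congr fun k => ?_) h2
  refine eLpNorm_congr_ae (hu.mono fun x hx => ?_)
  simp [hx]

theorem IsGrad.unique {u u' : X → ℝ} {F F' : X → E} (h : D.IsGrad u F) (h' : D.IsGrad u' F')
    (hu : u =ᵐ[μ] u') : F =ᵐ[μ] F' := by
  have := (h.add (h'.smul (-1))).eq_zero (hu.mono fun x hx => by simp [hx])
  filter_upwards [this] with x hx
  simp only [Pi.add_apply, Pi.smul_apply, neg_smul, one_smul, Pi.zero_apply] at hx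
  exact add_neg_eq_zero.1 hx

theorem exists_subseq_ae_of_eLpNorm {u : ℕ → X → ℝ} {u₀ : X → ℝ} (hm : ∀ k, MemLp (u k) 2 μ)
    (hm₀ : MemLp u₀ 2 μ) (h : Tendsto (fun k => eLpNorm (u k - u₀) 2 μ) atTop (𝓝 0)) :
    ∃ σ : ℕ → ℕ, StrictMono σ ∧ ∀ᵐ x ∂μ, Tendsto (fun k => u (σ k) x) atTop (𝓝 (u₀ x)) :=
  (tendstoInMeasure_of_tendsto_eLpNorm (by norm_num)
    (fun k => (hm k).aestronglyMeasurable) hm₀.aestronglyMeasurable h).exists_seq_tendsto_ae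

theorem lipschitz_of_deriv_bound {f : ℝ → ℝ} (hf : ContDiff ℝ ∞ f) {C : ℝ}
    (hC : ∀ t, |deriv f t| ≤ C) (a b : ℝ) : |f a - f b| ≤ C * |a - b| :=
  Convex.norm_image_sub_le_of_norm_deriv_le
    (fun x _ => (hf.differentiable (by simp)).differentiableAt) (fun x _ => hC x)
    convex_univ (Set.mem_univ b) (Set.mem_univ a)

/-- The chain rule for smooth approximations passes to the limit: the functions converge because `f`
is Lipschitz, the gradients along a subsequence that converges almost everywhere. -/
theorem IsGrad.comp {u : X → ℝ} {F : X → E} (h : D.IsGrad u F) {f : ℝ → ℝ} (hf : ContDiff ℝ ∞ f)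
    (hf0 : f 0 = 0) {C : ℝ} (hC : ∀ t, |deriv f t| ≤ C) :
    D.IsGrad (fun x => f (u x)) (fun x => deriv f (u x) • F x) := by
  have hC0 : 0 ≤ C := (abs_nonneg _).trans (hC 0)
  have hfc : Continuous f := hf.continuous
  have hf'c : Continuous (deriv f) := hf.continuous_deriv (by simp)
  have hlip := lipschitz_of_deriv_bound hf hC
  have hm1 : MemLp (fun x => f (u x)) 2 μ := by
    refine h.memLp.of_le_mul (c := C) (hfc.comp_aestronglyMeasurable h.memLp.aestronglyMeasurable)
      (Eventually.of_forall fun x => ?_)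
    simpa [hf0] using hlip (u x) 0
  have hm2 : MemLp (fun x => deriv f (u x) • F x) 2 μ := by
    refine h.memLp_grad.of_le_mul (c := C)
      ((hf'c.comp_aestronglyMeasurable h.memLp.aestronglyMeasurable).smul
        h.memLp_grad.aestronglyMeasurable) (Eventually.of_forall fun x => ?_)
    rw [norm_smul]
    exact mul_le_mul_of_nonneg_right (hC _) (norm_nonneg _)
  obtain ⟨φ, hφ1, hφ2⟩ := h.exists_approx
  obtain ⟨σ, hσ, hae⟩ := exists_subseq_ae_of_eLpNorm (fun k => D.memLp (φ k)) h.memLp hφ1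
  choose ψ hψ1 hψ2 using fun k => D.comp (φ (σ k)) f hf
  have t1 := hφ1.comp hσ.tendsto_atTop
  have t2 := hφ2.comp hσ.tendsto_atTop
  refine IsGrad.of_tendsto (fun k => isGrad_smooth (ψ k)) hm1 hm2 ?_ ?_
  · have := ENNReal.Tendsto.const_mul (a := ENNReal.ofReal C) t1 (Or.inr ENNReal.ofReal_ne_top)
    rw [mul_zero] at this
    refine tendsto_of_tendsto_of_tendsto_of_le_of_le tendsto_const_nhds this (fun _ => zero_le)
      fun k => ?_
    refine eLpNorm_le_mul_eLpNorm_of_ae_le_mul (Eventually.of_forall fun x => ?_) 2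
    simp only [hψ1, Pi.sub_apply, Real.norm_eq_abs]
    exact hlip _ _
  · have b1 := ENNReal.Tendsto.const_mul (a := ENNReal.ofReal C) t2 (Or.inr ENNReal.ofReal_ne_top)
    rw [mul_zero] at b1
    have b2 : Tendsto (fun k => eLpNorm (fun x => (deriv f ((φ (σ k) : X → ℝ) x) - deriv f (u x)) •
        F x) 2 μ) atTop (𝓝 0) := by
      refine tendsto_eLpNorm_two_of_dominated (G := fun x => (2 * C) * ‖F x‖) (fun k => ?_)
        (h.memLp_grad.norm.const_mul _) (fun k => Eventually.of_forall fun x => ?_) ?_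
      · exact ((hf'c.comp_aestronglyMeasurable (D.memLp _).aestronglyMeasurable).sub
          (hf'c.comp_aestronglyMeasurable h.memLp.aestronglyMeasurable)).smul
          h.memLp_grad.aestronglyMeasurable
      · rw [norm_smul]
        refine mul_le_mul_of_nonneg_right ?_ (norm_nonneg _)
        refine (abs_sub _ _).trans ?_
        linarith [hC ((φ (σ k) : X → ℝ) x), hC (u x)]
      · filter_upwards [hae] with x hx
        have := (((hf'c.tendsto _).comp hx).sub_const (deriv f (u x))).smul_const (F x)
        simpa using this
    have b3 := b1.add b2
    rw [add_zero] at b3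
    refine tendsto_of_tendsto_of_tendsto_of_le_of_le tendsto_const_nhds b3 (fun _ => zero_le)
      fun k => ?_
    -- The first summand is small because `f'` is bounded and the gradients converge in `L²`. The
    -- second tends to zero by dominated convergence, because `f'` is continuous.
    have e : (D.grad (ψ k) - fun x => deriv f (u x) • F x)
        = (fun x => deriv f ((φ (σ k) : X → ℝ) x) • (D.grad (φ (σ k)) x - F x))
          + fun x => (deriv f ((φ (σ k) : X → ℝ) x) - deriv f (u x)) • F x := by
      funext x
      simp only [hψ2, Pi.sub_apply, Pi.add_apply, smul_sub, sub_smul]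
      abel
    rw [e]
    refine (eLpNorm_add_le ?_ ?_ (by norm_num)).trans (add_le_add ?_ le_rfl)
    · exact (hf'c.comp_aestronglyMeasurable (D.memLp _).aestronglyMeasurable).smul
        ((D.memLp_grad _).aestronglyMeasurable.sub h.memLp_grad.aestronglyMeasurable)
    · exact ((hf'c.comp_aestronglyMeasurable (D.memLp _).aestronglyMeasurable).sub
          (hf'c.comp_aestronglyMeasurable h.memLp.aestronglyMeasurable)).smul
          h.memLp_grad.aestronglyMeasurable
    · refine eLpNorm_le_mul_eLpNorm_of_ae_le_mul (Eventually.of_forall fun x => ?_) 2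
      rw [norm_smul]
      exact mul_le_mul_of_nonneg_right (hC _) (norm_nonneg _)

/-- Compose with the smooth approximations of the positive part. Their derivatives are uniformly
bounded and converge pointwise, so dominated convergence applies and the graph is closed. -/
theorem IsGrad.posPart {u : X → ℝ} {F : X → E} (h : D.IsGrad u F) :
    D.IsGrad (fun x => max (u x) 0) (fun x => (if 0 < u x then (1 : ℝ) else 0) • F x) := by
  obtain ⟨C, hC0, hC⟩ := exists_bound_deriv_smoothPos
  have hk : ∀ k, D.IsGrad (fun x => smoothPos k (u x)) (fun x => deriv (smoothPos k) (u x) • F x) :=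
    fun k => h.comp (contDiff_smoothPos k) (by simp [smoothPos]) (hC k)
  have hm1 : MemLp (fun x => max (u x) 0) 2 μ := by
    refine h.memLp.of_le ((continuous_id.max continuous_const).comp_aestronglyMeasurable
      h.memLp.aestronglyMeasurable) (Eventually.of_forall fun x => ?_)
    have := abs_max_sub_max_le_abs (u x) 0 0
    simpa using this
  have hite : AEStronglyMeasurable (fun x => if 0 < u x then (1 : ℝ) else 0) μ :=
    aestronglyMeasurable_of_tendsto_ae atTop (f := fun k x => deriv (smoothPos k) (u x))
      (fun k => ((contDiff_smoothPos k).continuous_deriv (by simp)).comp_aestronglyMeasurable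
        h.memLp.aestronglyMeasurable)
      (Eventually.of_forall fun x => tendsto_deriv_smoothPos (u x))
  have hib : ∀ x, ‖(if 0 < u x then (1 : ℝ) else 0)‖ ≤ 1 := fun x => by split_ifs <;> simp
  have hm2 : MemLp (fun x => (if 0 < u x then (1 : ℝ) else 0) • F x) 2 μ := by
    refine h.memLp_grad.of_le (hite.smul h.memLp_grad.aestronglyMeasurable)
      (Eventually.of_forall fun x => ?_)
    rw [norm_smul]
    exact mul_le_of_le_one_left (norm_nonneg _) (hib x)
  refine IsGrad.of_tendsto hk hm1 hm2 ?_ ?_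
  · refine tendsto_eLpNorm_two_of_dominated (G := fun x => 2 * ‖u x‖)
      (fun k => (hk k).memLp.aestronglyMeasurable.sub hm1.aestronglyMeasurable)
      (h.memLp.norm.const_mul _) (fun k => Eventually.of_forall fun x => ?_)
      (Eventually.of_forall fun x => ?_)
    · simp only [Pi.sub_apply]
      have h1 := abs_smoothPos_le k (u x)
      have h2 : |max (u x) 0| ≤ |u x| := by simpa using abs_max_sub_max_le_abs (u x) 0 0
      refine (norm_sub_le _ _).trans ?_
      simp only [Real.norm_eq_abs]
      linarith
    · simpa using (tendsto_smoothPos (u x)).sub_const (max (u x) 0)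
  · refine tendsto_eLpNorm_two_of_dominated (G := fun x => (C + 1) * ‖F x‖)
      (fun k => (hk k).memLp_grad.aestronglyMeasurable.sub hm2.aestronglyMeasurable)
      (h.memLp_grad.norm.const_mul _) (fun k => Eventually.of_forall fun x => ?_)
      (Eventually.of_forall fun x => ?_)
    · simp only [Pi.sub_apply, ← sub_smul]
      rw [norm_smul]
      refine mul_le_mul_of_nonneg_right ?_ (norm_nonneg _)
      exact (norm_sub_le _ _).trans (add_le_add (hC k _) (hib x))
    · have := ((tendsto_deriv_smoothPos (u x)).sub_const (if 0 < u x then (1 : ℝ) else 0)).smul_const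
        (F x)
      simpa [sub_smul] using this

/-- The inequality extends from smooth functions by Fatou's lemma along an almost everywhere
convergent subsequence. -/
theorem IsGrad.sobolev {u : X → ℝ} {F : X → E} (h : D.IsGrad u F) :
    eLpNorm u (ENNReal.ofReal q) μ ≤ D.const * (eLpNorm u 2 μ + eLpNorm F 2 μ) := by
  obtain ⟨φ, hφ1, hφ2⟩ := h.exists_approx
  obtain ⟨σ, hσ, hae⟩ := exists_subseq_ae_of_eLpNorm (fun k => D.memLp (φ k)) h.memLp hφ1
  have t1 := hφ1.comp hσ.tendsto_atTop
  have t2 := hφ2.comp hσ.tendsto_atTop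
  refine (Lp.eLpNorm_lim_le_liminf_eLpNorm (fun k => (D.memLp (φ (σ k))).aestronglyMeasurable) u
    hae).trans ?_
  have hup : Tendsto (fun k => D.const * ((eLpNorm ((φ (σ k) : X → ℝ) - u) 2 μ + eLpNorm u 2 μ)
      + (eLpNorm (D.grad (φ (σ k)) - F) 2 μ + eLpNorm F 2 μ))) atTop
      (𝓝 (D.const * ((0 + eLpNorm u 2 μ) + (0 + eLpNorm F 2 μ)))) :=
    ENNReal.Tendsto.const_mul ((t1.add tendsto_const_nhds).add (t2.add tendsto_const_nhds))
      (Or.inr D.const_ne_top)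
  rw [zero_add, zero_add] at hup
  rw [← hup.liminf_eq]
  refine liminf_le_liminf (Eventually.of_forall fun k => (D.sobolev _).trans ?_)
  have a1 : eLpNorm (φ (σ k) : X → ℝ) 2 μ ≤ eLpNorm ((φ (σ k) : X → ℝ) - u) 2 μ + eLpNorm u 2 μ := by
    have := eLpNorm_add_le (μ := μ) (p := 2) ((D.memLp (φ (σ k))).sub h.memLp).aestronglyMeasurable
      h.memLp.aestronglyMeasurable (by norm_num)
    rwa [sub_add_cancel] at this
  have a2 : eLpNorm (D.grad (φ (σ k))) 2 μ ≤ eLpNorm (D.grad (φ (σ k)) - F) 2 μ + eLpNorm F 2 μ := by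
    have := eLpNorm_add_le (μ := μ) (p := 2)
      ((D.memLp_grad (φ (σ k))).sub h.memLp_grad).aestronglyMeasurable
      h.memLp_grad.aestronglyMeasurable (by norm_num)
    rwa [sub_add_cancel] at this
  gcongr

end GradientData

end NodalYamabe

end

/-! ### Elliptic forms on `L² × L²` -/

noncomputable section

namespace NodalYamabe

/-- A measurable field of uniformly elliptic symmetric bilinear forms with a potential. -/
structure EllipticForm {X : Type*} [MeasurableSpace X] (μ : Measure X) (E : Type*)
    [NormedAddCommGroup E] [NormedSpace ℝ E] where
  b : X → E →ₗ[ℝ] E →ₗ[ℝ] ℝ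
  V : X → ℝ
  lower : ℝ
  upper : ℝ
  lower_pos : 0 < lower
  symm : ∀ x v w, b x v w = b x w v
  lower_le : ∀ x v, lower * ‖v‖ ^ 2 ≤ b x v v
  le_upper : ∀ x v w, |b x v w| ≤ upper * (‖v‖ * ‖w‖)
  lower_le_V : ∀ x, lower ≤ V x
  V_le_upper : ∀ x, V x ≤ upper
  meas : ∀ F F' : X → E, AEStronglyMeasurable F μ → AEStronglyMeasurable F' μ →
    AEStronglyMeasurable (fun x => b x (F x) (F' x)) μ
  meas_V : AEStronglyMeasurable V μ

namespace EllipticForm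

variable {X : Type*} [MeasurableSpace X] {μ : Measure X} {E : Type*}
    [NormedAddCommGroup E] [NormedSpace ℝ E] (A : EllipticForm μ E)

/-- The density `b(F, F') + V u v`. -/
def density (u : X → ℝ) (F : X → E) (v : X → ℝ) (F' : X → E) (x : X) : ℝ :=
  A.b x (F x) (F' x) + A.V x * (u x * v x)

theorem upper_nonneg [Nonempty X] : 0 ≤ A.upper := by
  obtain ⟨x⟩ := ‹Nonempty X›
  exact A.lower_pos.le.trans ((A.lower_le_V x).trans (A.V_le_upper x))

theorem abs_density_le (u : X → ℝ) (F : X → E) (v : X → ℝ) (F' : X → E) (x : X) :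
    |A.density u F v F' x| ≤ A.upper * ((‖F x‖ ^ 2 + ‖u x‖ ^ 2) + (‖F' x‖ ^ 2 + ‖v x‖ ^ 2)) := by
  haveI : Nonempty X := ⟨x⟩
  have hC := A.upper_nonneg
  have h1 := A.le_upper x (F x) (F' x)
  have hV : |A.V x| ≤ A.upper := by
    rw [abs_of_nonneg (A.lower_pos.le.trans (A.lower_le_V x))]
    exact A.V_le_upper x
  have h2 : |A.V x * (u x * v x)| ≤ A.upper * (‖u x‖ * ‖v x‖) := by
    rw [abs_mul, abs_mul]
    exact mul_le_mul_of_nonneg_right hV (by positivity)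
  have h3 : ‖F x‖ * ‖F' x‖ ≤ ‖F x‖ ^ 2 + ‖F' x‖ ^ 2 := by
    nlinarith [sq_nonneg (‖F x‖ - ‖F' x‖), sq_nonneg ‖F x‖, sq_nonneg ‖F' x‖]
  have h4 : ‖u x‖ * ‖v x‖ ≤ ‖u x‖ ^ 2 + ‖v x‖ ^ 2 := by
    nlinarith [sq_nonneg (‖u x‖ - ‖v x‖), sq_nonneg ‖u x‖, sq_nonneg ‖v x‖]
  have h5 := mul_le_mul_of_nonneg_left h3 hC
  have h6 := mul_le_mul_of_nonneg_left h4 hC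
  refine (abs_add_le _ _).trans ?_
  linarith

theorem integrable_norm_sq {G : Type*} [NormedAddCommGroup G] {f : X → G} (hf : MemLp f 2 μ) :
    Integrable (fun x => ‖f x‖ ^ 2) μ := by
  have := hf.integrable_norm_rpow (by norm_num) (by norm_num)
  simpa using this

theorem integral_norm_sq {G : Type*} [NormedAddCommGroup G] (f : Lp G 2 μ) :
    ∫ x, ‖f x‖ ^ 2 ∂μ = ‖f‖ ^ 2 := by
  rw [Lp.norm_def, (Lp.memLp f).eLpNorm_eq_integral_rpow_norm (by norm_num) (by norm_num),
    ENNReal.toReal_ofReal (by positivity), ← Real.rpow_natCast, ← Real.rpow_mul (by positivity)]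
  simp

theorem integrable_density {u v : X → ℝ} {F F' : X → E} (hu : MemLp u 2 μ) (hF : MemLp F 2 μ)
    (hv : MemLp v 2 μ) (hF' : MemLp F' 2 μ) : Integrable (A.density u F v F') μ := by
  refine ((((integrable_norm_sq hF).add (integrable_norm_sq hu)).add
    ((integrable_norm_sq hF').add (integrable_norm_sq hv))).const_mul A.upper).mono' ?_
    (Eventually.of_forall fun x => A.abs_density_le u F v F' x)
  exact (A.meas F F' hF.1 hF'.1).add (A.meas_V.mul (hu.1.mul hv.1))

theorem integral_density_congr {u u' v v' : X → ℝ} {F F' G G' : X → E} (hu : u =ᵐ[μ] u')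
    (hF : F =ᵐ[μ] F') (hv : v =ᵐ[μ] v') (hG : G =ᵐ[μ] G') :
    ∫ x, A.density u F v G x ∂μ = ∫ x, A.density u' F' v' G' x ∂μ := by
  refine integral_congr_ae ?_
  filter_upwards [hu, hF, hv, hG] with x h1 h2 h3 h4
  simp only [density, h1, h2, h3, h4]

theorem density_comm (u v : X → ℝ) (F F' : X → E) (x : X) :
    A.density u F v F' x = A.density v F' u F x := by
  simp only [density, A.symm x (F x), mul_comm (u x)]

/-- The bilinear form `∫ b(F, F') + V u v` on `L² × L²`, as a linear map. -/
def bilinear : (Lp ℝ 2 μ × Lp E 2 μ) →ₗ[ℝ] (Lp ℝ 2 μ × Lp E 2 μ) →ₗ[ℝ] ℝ := by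
  have hadd : ∀ a a' d : Lp ℝ 2 μ × Lp E 2 μ,
      ∫ x, A.density (a + a').1 (a + a').2 d.1 d.2 x ∂μ
        = ∫ x, A.density a.1 a.2 d.1 d.2 x ∂μ + ∫ x, A.density a'.1 a'.2 d.1 d.2 x ∂μ := by
    intro a a' d
    rw [← integral_add (A.integrable_density (Lp.memLp _) (Lp.memLp _) (Lp.memLp _) (Lp.memLp _))
      (A.integrable_density (Lp.memLp _) (Lp.memLp _) (Lp.memLp _) (Lp.memLp _))]
    refine integral_congr_ae ?_
    filter_upwards [Lp.coeFn_add a.1 a'.1, Lp.coeFn_add a.2 a'.2] with x h1 h2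
    simp only [density, Prod.fst_add, Prod.snd_add, h1, h2, Pi.add_apply, map_add,
      LinearMap.add_apply]
    ring
  have hsmul : ∀ (r : ℝ) (a d : Lp ℝ 2 μ × Lp E 2 μ),
      ∫ x, A.density (r • a).1 (r • a).2 d.1 d.2 x ∂μ
        = r • ∫ x, A.density a.1 a.2 d.1 d.2 x ∂μ := by
    intro r a d
    rw [smul_eq_mul, ← integral_const_mul]
    refine integral_congr_ae ?_
    filter_upwards [Lp.coeFn_smul r a.1, Lp.coeFn_smul r a.2] with x h1 h2
    simp only [density, Prod.smul_fst, Prod.smul_snd, h1, h2, Pi.smul_apply, map_smul,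
      LinearMap.smul_apply, smul_eq_mul]
    ring
  have hcomm : ∀ a d : Lp ℝ 2 μ × Lp E 2 μ, ∫ x, A.density a.1 a.2 d.1 d.2 x ∂μ
      = ∫ x, A.density d.1 d.2 a.1 a.2 x ∂μ := fun a d =>
    integral_congr_ae (Eventually.of_forall fun x => A.density_comm _ _ _ _ x)
  exact LinearMap.mk₂ ℝ (fun a d => ∫ x, A.density a.1 a.2 d.1 d.2 x ∂μ) hadd hsmul
    (fun a d d' => by rw [hcomm, hadd, hcomm d, hcomm d'])
    (fun r a d => by rw [hcomm, hsmul, hcomm d])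

theorem bilinear_apply (a d : Lp ℝ 2 μ × Lp E 2 μ) :
    A.bilinear a d = ∫ x, A.density a.1 a.2 d.1 d.2 x ∂μ := rfl

theorem bilinear_symm (a d : Lp ℝ 2 μ × Lp E 2 μ) : A.bilinear a d = A.bilinear d a :=
  integral_congr_ae (Eventually.of_forall fun x => A.density_comm _ _ _ _ x)

theorem norm_sq_le (a : Lp ℝ 2 μ × Lp E 2 μ) : ‖a‖ ^ 2 ≤ ‖a.2‖ ^ 2 + ‖a.1‖ ^ 2 := by
  rw [Prod.norm_def]
  rcases max_cases ‖a.1‖ ‖a.2‖ with ⟨h, -⟩ | ⟨h, -⟩ <;> rw [h] <;>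
    nlinarith [sq_nonneg ‖a.1‖, sq_nonneg ‖a.2‖]

theorem le_bilinear (a : Lp ℝ 2 μ × Lp E 2 μ) : A.lower * ‖a‖ ^ 2 ≤ A.bilinear a a := by
  have h1 : A.lower * (‖a.2‖ ^ 2 + ‖a.1‖ ^ 2) ≤ A.bilinear a a := by
    rw [← integral_norm_sq, ← integral_norm_sq, ← integral_add (integrable_norm_sq (Lp.memLp _))
      (integrable_norm_sq (Lp.memLp _)), ← integral_const_mul, bilinear_apply]
    refine integral_mono (((integrable_norm_sq (Lp.memLp _)).add
      (integrable_norm_sq (Lp.memLp _))).const_mul _)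
      (A.integrable_density (Lp.memLp _) (Lp.memLp _) (Lp.memLp _) (Lp.memLp _)) fun x => ?_
    have h1 := A.lower_le x (a.2 x)
    have h2 := mul_le_mul_of_nonneg_right (A.lower_le_V x) (mul_self_nonneg (a.1 x))
    simp only [density, Real.norm_eq_abs, sq_abs]
    nlinarith
  exact (mul_le_mul_of_nonneg_left (norm_sq_le a) A.lower_pos.le).trans h1

theorem abs_bilinear_le [Nonempty X] (a d : Lp ℝ 2 μ × Lp E 2 μ) :
    |A.bilinear a d| ≤ A.upper * (2 * ‖a‖ ^ 2 + 2 * ‖d‖ ^ 2) := by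
  have hle : |A.bilinear a d| ≤ A.upper * ((‖a.2‖ ^ 2 + ‖a.1‖ ^ 2) + (‖d.2‖ ^ 2 + ‖d.1‖ ^ 2)) := by
    have hi : ∀ z : Lp ℝ 2 μ × Lp E 2 μ, Integrable (fun x => ‖z.2 x‖ ^ 2 + ‖z.1 x‖ ^ 2) μ :=
      fun z => (integrable_norm_sq (Lp.memLp _)).add (integrable_norm_sq (Lp.memLp _))
    simp only [← integral_norm_sq]
    rw [← integral_add (integrable_norm_sq (Lp.memLp _)) (integrable_norm_sq (Lp.memLp _)),
      ← integral_add (integrable_norm_sq (Lp.memLp _)) (integrable_norm_sq (Lp.memLp _)),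
      ← integral_add (hi a) (hi d), ← integral_const_mul, bilinear_apply, ← Real.norm_eq_abs]
    refine norm_integral_le_of_norm_le (((hi a).add (hi d)).const_mul _)
      (Eventually.of_forall fun x => ?_)
    exact A.abs_density_le _ _ _ _ x
  refine hle.trans (mul_le_mul_of_nonneg_left ?_ A.upper_nonneg)
  have h : ∀ z : Lp ℝ 2 μ × Lp E 2 μ, ‖z.2‖ ^ 2 + ‖z.1‖ ^ 2 ≤ 2 * ‖z‖ ^ 2 := fun z => by
    have h1 : ‖z.1‖ ^ 2 ≤ ‖z‖ ^ 2 := by gcongr; exact norm_fst_le z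
    have h2 : ‖z.2‖ ^ 2 ≤ ‖z‖ ^ 2 := by gcongr; exact norm_snd_le z
    linarith
  linarith [h a, h d]

/-- The bilinear form `∫ b(F, F') + V u v` on `L² × L²`, as a continuous bilinear map. -/
def continuousBilinear [Nonempty X] :
    (Lp ℝ 2 μ × Lp E 2 μ) →L[ℝ] (Lp ℝ 2 μ × Lp E 2 μ) →L[ℝ] ℝ :=
  LinearMap.mkContinuous₂ A.bilinear (A.upper * 4) (by
    intro a d
    rcases eq_or_ne a 0 with rfl | ha
    · simp
    rcases eq_or_ne d 0 with rfl | hd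
    · simp
    have ha' : 0 < ‖a‖ := norm_pos_iff.2 ha
    have hd' : 0 < ‖d‖ := norm_pos_iff.2 hd
    -- Normalising both arguments turns the bound by a sum of squares into a bound by the product of
    -- the norms, with constant `2 + 2`.
    have h := A.abs_bilinear_le (‖a‖⁻¹ • a) (‖d‖⁻¹ • d)
    have hna : ‖‖a‖⁻¹ • a‖ = 1 := by rw [norm_smul, norm_inv, norm_norm, inv_mul_cancel₀ ha'.ne']
    have hnd : ‖‖d‖⁻¹ • d‖ = 1 := by rw [norm_smul, norm_inv, norm_norm, inv_mul_cancel₀ hd'.ne']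
    rw [hna, hnd] at h
    simp only [map_smul, LinearMap.smul_apply, smul_eq_mul, abs_mul, abs_inv, abs_norm] at h
    rw [Real.norm_eq_abs]
    rw [← mul_assoc, ← mul_inv, ← div_eq_inv_mul, div_le_iff₀ (by positivity)] at h
    refine h.trans (le_of_eq ?_)
    ring)

end EllipticForm

/-! ### The Sobolev space as a compact form -/

namespace GradientData

variable {X : Type*} [MeasurableSpace X] {μ : Measure X} {E : Type*}
    [NormedAddCommGroup E] [NormedSpace ℝ E] {q : ℝ} (D : GradientData μ E q)

/-- The Sobolev space as a space of functions. -/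
def space : Submodule ℝ (X → ℝ) where
  carrier := {u | ∃ F, D.IsGrad u F}
  add_mem' := by rintro u v ⟨F, hF⟩ ⟨G, hG⟩; exact ⟨F + G, hF.add hG⟩
  zero_mem' := ⟨_, D.isGrad_smooth 0⟩
  smul_mem' := by rintro a u ⟨F, hF⟩; exact ⟨a • F, hF.smul a⟩

/-- A Sobolev gradient of `u`. -/
def gradOf (u : D.space) : X → E := Classical.choose u.2

theorem isGrad_gradOf (u : D.space) : D.IsGrad (u : X → ℝ) (D.gradOf u) := Classical.choose_spec u.2

/-- The class of `(u, ∇u)` in `L² × L²`. -/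
def lift : D.space →ₗ[ℝ] D.closedGraph where
  toFun u := ⟨((D.isGrad_gradOf u).memLp.toLp _, (D.isGrad_gradOf u).memLp_grad.toLp _),
    (D.isGrad_gradOf u).mem⟩
  -- The chosen gradients need not be additive pointwise; uniqueness makes their classes in `L²`
  -- additive.
  map_add' u v := by
    refine Subtype.ext (Prod.ext rfl ?_)
    exact (MemLp.toLp_eq_toLp_iff (D.isGrad_gradOf (u + v)).memLp_grad
      ((D.isGrad_gradOf u).memLp_grad.add
      (D.isGrad_gradOf v).memLp_grad)).2 ((D.isGrad_gradOf (u + v)).unique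
      ((D.isGrad_gradOf u).add (D.isGrad_gradOf v)) (ae_eq_refl _))
  map_smul' a u := by
    refine Subtype.ext (Prod.ext rfl ?_)
    exact (MemLp.toLp_eq_toLp_iff (D.isGrad_gradOf (a • u)).memLp_grad
      ((D.isGrad_gradOf u).memLp_grad.const_smul a)).2
      ((D.isGrad_gradOf (a • u)).unique ((D.isGrad_gradOf u).smul a) (ae_eq_refl _))

variable {D}

theorem lift_fst (u : D.space) : ((D.lift u).1.1 : X → ℝ) =ᵐ[μ] (u : X → ℝ) :=
  MemLp.coeFn_toLp (D.isGrad_gradOf u).memLp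

theorem lift_snd {u : D.space} {F : X → E} (h : D.IsGrad (u : X → ℝ) F) :
    ((D.lift u).1.2 : X → E) =ᵐ[μ] F :=
  (MemLp.coeFn_toLp (D.isGrad_gradOf u).memLp_grad).trans ((D.isGrad_gradOf u).unique h (ae_eq_refl _))

theorem norm_lift_eq {u : D.space} {F : X → E} (h : D.IsGrad (u : X → ℝ) F) :
    (eLpNorm (u : X → ℝ) 2 μ).toReal = ‖(D.lift u).1.1‖ ∧ (eLpNorm F 2 μ).toReal = ‖(D.lift u).1.2‖ := by
  constructor
  · rw [Lp.norm_def, eLpNorm_congr_ae (lift_fst u)]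
  · rw [Lp.norm_def, eLpNorm_congr_ae (lift_snd h)]

/-- The form `∫ b(∇u, ∇v) + V u v`. -/
def form (A : EllipticForm μ E) : D.space →ₗ[ℝ] D.space →ₗ[ℝ] ℝ :=
  (A.bilinear.compl₁₂ D.closedGraph.subtype D.closedGraph.subtype).compl₁₂ D.lift D.lift

theorem form_apply (A : EllipticForm μ E) (u v : D.space) :
    form A u v = A.bilinear (D.lift u).1 (D.lift v).1 := rfl

theorem form_eq (A : EllipticForm μ E) {u v : D.space} {F F' : X → E}
    (hF : D.IsGrad (u : X → ℝ) F) (hF' : D.IsGrad (v : X → ℝ) F') :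
    form A u v = ∫ x, A.density u F v F' x ∂μ := by
  rw [form_apply, A.bilinear_apply]
  exact A.integral_density_congr (lift_fst u) (lift_snd hF) (lift_fst v) (lift_snd hF')

theorem IsGrad.memLp_top {u : X → ℝ} {F : X → E} (h : D.IsGrad u F) :
    MemLp u (ENNReal.ofReal q) μ :=
  ⟨h.memLp.1, h.sobolev.trans_lt (ENNReal.mul_lt_top D.const_ne_top.lt_top
    (ENNReal.add_lt_top.2 ⟨h.memLp.2, h.memLp_grad.2⟩))⟩

theorem eLpNorm_le_norm_lift (u : D.space) :
    eLpNorm (u : X → ℝ) (ENNReal.ofReal q) μ ≤ D.const * (2 * ENNReal.ofReal ‖D.lift u‖) := by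
  have h := (D.isGrad_gradOf u)
  refine h.sobolev.trans ?_
  gcongr
  obtain ⟨h1, h2⟩ := norm_lift_eq h
  have a1 : eLpNorm (u : X → ℝ) 2 μ ≤ ENNReal.ofReal ‖D.lift u‖ := by
    rw [← ENNReal.ofReal_toReal h.memLp.2.ne, h1]
    exact ENNReal.ofReal_le_ofReal (norm_fst_le (D.lift u).1)
  have a2 : eLpNorm (D.gradOf u) 2 μ ≤ ENNReal.ofReal ‖D.lift u‖ := by
    rw [← ENNReal.ofReal_toReal h.memLp_grad.2.ne, h2]
    exact ENNReal.ofReal_le_ofReal (norm_snd_le (D.lift u).1)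
  rw [two_mul]
  exact add_le_add a1 a2

/-- The Sobolev inequality at `q`, Hölder's inequality on a finite measure space to descend to `p`,
and coercivity of the form. -/
theorem exists_bound (A : EllipticForm μ E) [IsFiniteMeasure μ] {p : ℝ} (hp : 2 < p) (hpq : p < q) :
    ∃ K : ℝ, 0 < K ∧ ∀ u : D.space, (∫ x, |(u : X → ℝ) x| ^ p ∂μ) ^ (2 / p) ≤ K * form A u u := by
  have hp0 : 0 < p := by linarith
  set m : ℝ≥0∞ := μ Set.univ ^ (1 / p - 1 / q)
  have hm : m ≠ ⊤ := ENNReal.rpow_ne_top_of_nonneg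
    (sub_nonneg.2 (one_div_le_one_div_of_le hp0 hpq.le)) (measure_ne_top _ _)
  set K₀ : ℝ := (D.const * 2 * m).toReal
  have hK₀ : 0 ≤ K₀ := ENNReal.toReal_nonneg
  -- The summand `1` only makes the constant positive, as `K₀` may vanish.
  refine ⟨K₀ ^ 2 / A.lower + 1, by have := A.lower_pos; positivity, fun u => ?_⟩
  have hmem : MemLp (u : X → ℝ) (ENNReal.ofReal p) μ :=
    (D.isGrad_gradOf u).memLp_top.mono_exponent (ENNReal.ofReal_le_ofReal hpq.le)
  have h1 : eLpNorm (u : X → ℝ) (ENNReal.ofReal p) μ ≤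
      (D.const * 2 * m) * ENNReal.ofReal ‖D.lift u‖ := by
    have := eLpNorm_le_eLpNorm_mul_rpow_measure_univ (μ := μ)
      (ENNReal.ofReal_le_ofReal hpq.le : ENNReal.ofReal p ≤ ENNReal.ofReal q) hmem.1
    rw [ENNReal.toReal_ofReal hp0.le, ENNReal.toReal_ofReal (by linarith)] at this
    refine this.trans ((mul_le_mul_left (eLpNorm_le_norm_lift u) m).trans (le_of_eq ?_))
    ring
  have h2 : (∫ x, |(u : X → ℝ) x| ^ p ∂μ) ^ (1 / p) ≤ K₀ * ‖D.lift u‖ := by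
    have h3 := ENNReal.toReal_mono (ENNReal.mul_ne_top (ENNReal.mul_ne_top (ENNReal.mul_ne_top
      D.const_ne_top (by norm_num)) hm) ENNReal.ofReal_ne_top) h1
    rw [ENNReal.toReal_mul, ENNReal.toReal_ofReal (norm_nonneg _),
      hmem.eLpNorm_eq_integral_rpow_norm (by simpa using hp0) (by simp),
      ENNReal.toReal_ofReal (by positivity), ENNReal.toReal_ofReal hp0.le] at h3
    simpa only [Real.norm_eq_abs, one_div] using h3
  have h0 : 0 ≤ ∫ x, |(u : X → ℝ) x| ^ p ∂μ := integral_nonneg fun x => by positivity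
  calc (∫ x, |(u : X → ℝ) x| ^ p ∂μ) ^ (2 / p)
      = ((∫ x, |(u : X → ℝ) x| ^ p ∂μ) ^ (1 / p)) ^ 2 := by
        rw [← Real.rpow_natCast, ← Real.rpow_mul h0]; congr 1; push_cast; ring
    _ ≤ (K₀ * ‖D.lift u‖) ^ 2 := by gcongr
    _ = K₀ ^ 2 / A.lower * (A.lower * ‖D.lift u‖ ^ 2) := by
        have := A.lower_pos.ne'; field_simp
    _ ≤ K₀ ^ 2 / A.lower * form A u u :=
        mul_le_mul_of_nonneg_left (A.le_bilinear (D.lift u).1)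
          (div_nonneg (sq_nonneg _) A.lower_pos.le)
    _ ≤ (K₀ ^ 2 / A.lower + 1) * form A u u := by
        have : 0 ≤ form A u u := le_trans
          (mul_nonneg A.lower_pos.le (sq_nonneg _)) (A.le_bilinear (D.lift u).1)
        nlinarith

theorem exists_smooth_near {u : X → ℝ} {F : X → E} (h : D.IsGrad u F) {ε : ℝ≥0∞} (hε : 0 < ε) :
    ∃ φ : D.smooth, eLpNorm ((φ : X → ℝ) - u) 2 μ < ε ∧ eLpNorm (D.grad φ - F) 2 μ < ε := by
  obtain ⟨φ, h1, h2⟩ := h.exists_approx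
  obtain ⟨k, hk⟩ := ((h1.eventually_lt_const hε).and (h2.eventually_lt_const hε)).exists
  exact ⟨φ k, hk⟩

/-- A bounded form bounds the sequence in the graph norm. Smooth functions at distance `1/(k+1)`
carry Rellich's theorem over to it, `exists_limit_of_coercive` gives lower semicontinuity, and
interpolation lifts the `L²` convergence to `L^p`. -/
theorem exists_compact_limit (A : EllipticForm μ E) [IsFiniteMeasure μ] [Nonempty X]
    [CompleteSpace E] {p : ℝ} (hp : 2 < p) (hpq : p < q) (u : ℕ → D.space) (l : ℝ)
    (hl : Tendsto (fun k => form A (u k) (u k)) atTop (𝓝 l)) :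
    ∃ (v : D.space) (σ : ℕ → ℕ), StrictMono σ ∧
      Tendsto (fun k => eLpNorm ((u (σ k) : X → ℝ) - (v : X → ℝ)) (ENNReal.ofReal p) μ) atTop
        (𝓝 0) ∧ form A v v ≤ l := by
  obtain ⟨B, hB⟩ := hl.bddAbove_range
  have hlow := A.lower_pos
  obtain ⟨R, hR⟩ : ∃ R : ℝ, ∀ k, ‖D.lift (u k)‖ ≤ R := by
    refine ⟨Real.sqrt (B / A.lower), fun k => Real.le_sqrt_of_sq_le ?_⟩
    rw [le_div_iff₀ hlow, mul_comm]
    exact (A.le_bilinear (D.lift (u k)).1).trans (hB ⟨k, rfl⟩)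
  choose φ hφ1 hφ2 using fun k : ℕ => exists_smooth_near (D.isGrad_gradOf (u k))
    (ε := ENNReal.ofReal (1 / ((k : ℝ) + 1))) (by simp; positivity)
  have hsmall : ∀ k : ℕ, ENNReal.ofReal (1 / ((k : ℝ) + 1)) ≤ 1 := fun k => by
    rw [ENNReal.ofReal_le_one, div_le_one (by positivity)]
    linarith [(Nat.cast_nonneg k : (0 : ℝ) ≤ k)]
  have hn1 : ∀ k, eLpNorm (u k : X → ℝ) 2 μ ≤ ENNReal.ofReal R := fun k => by
    have h := D.isGrad_gradOf (u k)
    rw [← ENNReal.ofReal_toReal h.memLp.2.ne, (norm_lift_eq h).1]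
    exact ENNReal.ofReal_le_ofReal ((norm_fst_le (D.lift (u k)).1).trans (hR k))
  have hn2 : ∀ k, eLpNorm (D.gradOf (u k)) 2 μ ≤ ENNReal.ofReal R := fun k => by
    have h := D.isGrad_gradOf (u k)
    rw [← ENNReal.ofReal_toReal h.memLp_grad.2.ne, (norm_lift_eq h).2]
    exact ENNReal.ofReal_le_ofReal ((norm_snd_le (D.lift (u k)).1).trans (hR k))
  have hb1 : ∀ k, eLpNorm (φ k : X → ℝ) 2 μ ≤ 1 + ENNReal.ofReal R := fun k => by
    have := eLpNorm_add_le (μ := μ) (p := 2)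
      ((D.memLp (φ k)).sub (D.isGrad_gradOf (u k)).memLp).aestronglyMeasurable
      (D.isGrad_gradOf (u k)).memLp.aestronglyMeasurable (by norm_num)
    rw [sub_add_cancel] at this
    exact this.trans (add_le_add ((hφ1 k).le.trans (hsmall k)) (hn1 k))
  have hb2 : ∀ k, eLpNorm (D.grad (φ k)) 2 μ ≤ 1 + ENNReal.ofReal R := fun k => by
    have := eLpNorm_add_le (μ := μ) (p := 2)
      ((D.memLp_grad (φ k)).sub (D.isGrad_gradOf (u k)).memLp_grad).aestronglyMeasurable
      (D.isGrad_gradOf (u k)).memLp_grad.aestronglyMeasurable (by norm_num)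
    rw [sub_add_cancel] at this
    exact this.trans (add_le_add ((hφ2 k).le.trans (hsmall k)) (hn2 k))
  obtain ⟨σ, u₀, hσ, hu₀, hlim⟩ := D.rellich φ _ (by simp) hb1 hb2
  have hzero : Tendsto (fun k : ℕ => ENNReal.ofReal (1 / ((k : ℝ) + 1))) atTop (𝓝 0) := by
    have := ENNReal.tendsto_ofReal (tendsto_one_div_add_atTop_nhds_zero_nat (𝕜 := ℝ))
    simpa using this
  have hu2 : Tendsto (fun k => eLpNorm ((u (σ k) : X → ℝ) - u₀) 2 μ) atTop (𝓝 0) := by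
    have hs := (hzero.comp hσ.tendsto_atTop).add hlim
    rw [add_zero] at hs
    refine tendsto_of_tendsto_of_tendsto_of_le_of_le tendsto_const_nhds hs (fun _ => zero_le)
      fun k => ?_
    have e : (u (σ k) : X → ℝ) - u₀ = -((φ (σ k) : X → ℝ) - (u (σ k) : X → ℝ))
        + ((φ (σ k) : X → ℝ) - u₀) := by abel
    have hm := (D.memLp (φ (σ k))).sub (D.isGrad_gradOf (u (σ k))).memLp
    beta_reduce
    rw [e]
    refine (eLpNorm_add_le hm.neg.aestronglyMeasurable
      ((D.memLp _).sub hu₀).aestronglyMeasurable (by norm_num)).trans ?_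
    rw [eLpNorm_neg]
    exact add_le_add (hφ1 _).le le_rfl
  haveI : CompleteSpace D.closedGraph :=
    (Submodule.isClosed_topologicalClosure D.graph).completeSpace_coe
  -- The form is restricted to the closed graph, which is complete; the linear map is the projection
  -- `(u, ∇u) ↦ u`. Hence the limit found there is a function together with its gradient.
  let B' : D.closedGraph →L[ℝ] D.closedGraph →L[ℝ] ℝ :=
    A.continuousBilinear.bilinearComp D.closedGraph.subtypeL D.closedGraph.subtypeL
  obtain ⟨w, hw1, hw2⟩ := exists_limit_of_coercive B' (fun a d => A.bilinear_symm a.1 d.1) hlow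
    (fun a => A.le_bilinear a.1)
    ((ContinuousLinearMap.fst ℝ (Lp ℝ 2 μ) (Lp E 2 μ)).comp D.closedGraph.subtypeL)
    (h := fun k => D.lift (u (σ k))) (l := l) (y := hu₀.toLp u₀)
    (hl.comp hσ.tendsto_atTop)
    ((Lp.tendsto_Lp_iff_tendsto_eLpNorm'' (fun k => (u (σ k) : X → ℝ))
      (fun k => (D.isGrad_gradOf (u (σ k))).memLp) u₀ hu₀).2 hu2)
  have hw := isGrad_of_mem w.2
  have hwu : (w.1.1 : X → ℝ) =ᵐ[μ] u₀ := by
    have : w.1.1 = hu₀.toLp u₀ := hw1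
    rw [this]
    exact MemLp.coeFn_toLp _
  let v : D.space := ⟨w.1.1, _, hw⟩
  have hvf : form A v v ≤ l := by
    rw [form_eq A hw hw]
    exact hw2
  refine ⟨v, σ, hσ, ?_, hvf⟩
  refine tendsto_eLpNorm_interpolate hp hpq (C := D.const * (2 * ENNReal.ofReal (R + ‖D.lift v‖)))
    (fun k => ((D.isGrad_gradOf (u (σ k))).memLp.sub hw.memLp).aestronglyMeasurable)
    (ENNReal.mul_ne_top D.const_ne_top (ENNReal.mul_ne_top (by norm_num) ENNReal.ofReal_ne_top))
    (fun k => ?_) (hu2.congr fun k => ?_)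
  · refine (eLpNorm_le_norm_lift (u (σ k) - v)).trans ?_
    gcongr
    rw [map_sub]
    exact (norm_sub_le _ _).trans (add_le_add (hR _) le_rfl)
  · exact eLpNorm_congr_ae (hwu.mono fun x hx => by simp only [Pi.sub_apply, v, hx])

/-- The compact form attached to a gradient and an elliptic form. -/
def compactForm (D : GradientData μ E q) (A : EllipticForm μ E) [IsFiniteMeasure μ] [Nonempty X]
    [CompleteSpace E] {p : ℝ} (hp : 2 < p) (hpq : p < q) : CompactForm μ p where
  space := D.space
  form := form A
  symm u v := A.bilinear_symm _ _
  posPart_mem u hu := by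
    obtain ⟨F, hF⟩ := hu
    exact ⟨_, hF.posPart⟩
  form_eq_zero u hu v := by
    have h0 := (D.isGrad_gradOf u).eq_zero hu
    rw [form_eq A (D.isGrad_gradOf u) (D.isGrad_gradOf v),
      A.integral_density_congr (u' := 0) (F' := 0) hu h0 (ae_eq_refl _) (ae_eq_refl _)]
    simp [EllipticForm.density]
  form_parts u v w hv hw := by
    have hF := D.isGrad_gradOf u
    have h1 := hF.posPart
    rw [← hv] at h1
    -- The negative part is `-((-u)⁺)`, so its gradient carries the indicator of `{-u > 0}`, which
    -- is disjoint from `{u > 0}`. The density of the mixed term therefore vanishes at every point.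
    have h2 := ((hF.smul (-1)).posPart).smul (-1)
    have e : (w : X → ℝ) = (-1 : ℝ) • (fun x => max (((-1 : ℝ) • (u : X → ℝ)) x) 0) := by
      rw [hw]
      funext x
      simp only [Pi.smul_apply, smul_eq_mul, neg_mul, one_mul]
      rcases le_total ((u : X → ℝ) x) 0 with h | h
      · rw [max_eq_left (by linarith), min_eq_left h, neg_neg]
      · rw [max_eq_right (by linarith), min_eq_right h, neg_zero]
    rw [← e] at h2
    rw [form_eq A h1 h2]
    refine integral_eq_zero_of_ae (Eventually.of_forall fun x => ?_)
    simp only [EllipticForm.density, hv, hw, Pi.smul_apply, smul_eq_mul, neg_mul, one_mul,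
      Pi.zero_apply, neg_smul, one_smul]
    rcases lt_trichotomy ((u : X → ℝ) x) 0 with h | h | h
    · simp [h, h.le, not_lt.2 h.le]
    · simp [h]
    · simp [h, h.le, not_lt.2 h.le]
  memLp u := (D.isGrad_gradOf u).memLp_top.mono_exponent (ENNReal.ofReal_le_ofReal hpq.le)
  const := Classical.choose (exists_bound (D := D) A hp hpq)
  const_pos := (Classical.choose_spec (exists_bound (D := D) A hp hpq)).1
  bound := (Classical.choose_spec (exists_bound (D := D) A hp hpq)).2
  compact u l hl := exists_compact_limit A hp hpq u l hl

end GradientData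

end NodalYamabe

end

noncomputable section

namespace NodalYamabe

/-! ### Rellich's theorem in Euclidean space -/

/-- Sequential Banach–Alaoglu in the dual of a separable space, transported by the Riesz
isomorphism. The weak limit itself is not needed, only the convergence of the pairings. -/
theorem exists_weakly_convergent_subseq {H : Type*} [NormedAddCommGroup H] [InnerProductSpace ℝ H]
    [CompleteSpace H] [TopologicalSpace.SeparableSpace H] {x : ℕ → H} {R : ℝ}
    (hx : ∀ k, ‖x k‖ ≤ R) :
    ∃ σ : ℕ → ℕ, StrictMono σ ∧ ∀ w : H, ∃ l : ℝ,
      Tendsto (fun k => inner ℝ (x (σ k)) w) atTop (𝓝 l) := by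
  have hseq := WeakDual.isSeqCompact_closedBall ℝ H (0 : StrongDual ℝ H) R
  let y : ℕ → WeakDual ℝ H := fun k =>
    StrongDual.toWeakDual (InnerProductSpace.toDual ℝ H (x k))
  obtain ⟨l, -, σ, hσ, hl⟩ := hseq (x := y) (fun k => by
    simp only [Set.mem_preimage, Metric.mem_closedBall, dist_zero_right, y]
    exact ((InnerProductSpace.toDual ℝ H).norm_map (x k)).le.trans (hx k))
  refine ⟨σ, hσ, fun w => ⟨l w, ?_⟩⟩
  have := ((WeakDual.eval_continuous w).tendsto l).comp hl
  exact this

theorem sq_lintegral_le {Ω : Type*} [MeasurableSpace Ω] {ν : Measure Ω} [IsProbabilityMeasure ν]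
    {g : Ω → ℝ≥0∞} (hg : AEMeasurable g ν) : (∫⁻ x, g x ∂ν) ^ 2 ≤ ∫⁻ x, g x ^ 2 ∂ν := by
  have h := ENNReal.lintegral_mul_norm_pow_le (μ := ν) (f := fun x => g x ^ 2) (g := fun _ => 1)
    (p := 1 / 2) (q := 1 / 2) (hg.pow_const 2) aemeasurable_const (by norm_num) (by norm_num)
    (by norm_num)
  have e : ∀ z : ℝ≥0∞, (z ^ 2) ^ (1 / 2 : ℝ) = z := fun z => by
    rw [← ENNReal.rpow_natCast, ← ENNReal.rpow_mul]; norm_num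
  simp only [ENNReal.one_rpow, mul_one, lintegral_const, measure_univ, e] at h
  calc (∫⁻ x, g x ∂ν) ^ 2 ≤ ((∫⁻ x, g x ^ 2 ∂ν) ^ (1 / 2 : ℝ)) ^ 2 := by gcongr
    _ = ∫⁻ x, g x ^ 2 ∂ν := by
      rw [← ENNReal.rpow_natCast, ← ENNReal.rpow_mul]; norm_num

section Euclidean

variable {n : ℕ}

local notation "𝔼" => EuclideanSpace ℝ (Fin n)

/-- The fundamental theorem of calculus on the segment from `x` to `x + h`, followed by the
Cauchy–Schwarz inequality on `[0, 1]`. -/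
theorem enorm_translate_sub_le {f : 𝔼 → ℝ} (hf : ContDiff ℝ 1 f) (x h : 𝔼) :
    ‖f (x + h) - f x‖ₑ ^ 2 ≤
      ‖h‖ₑ ^ 2 * ∫⁻ t in Set.Icc (0 : ℝ) 1, ‖fderiv ℝ f (x + t • h)‖ₑ ^ 2 := by
  have hfd : Continuous (fderiv ℝ f) := hf.continuous_fderiv (by norm_num)
  have hc : Continuous fun t : ℝ => fderiv ℝ f (x + t • h) := by fun_prop
  have hder : ∀ t ∈ Set.uIcc (0 : ℝ) 1, HasDerivAt (fun t : ℝ => f (x + t • h))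
      (fderiv ℝ f (x + t • h) h) t := fun t _ => by
    have h1 : HasDerivAt (fun t : ℝ => x + t • h) h t := by
      simpa using ((hasDerivAt_id t).smul_const h).const_add x
    exact ((hf.differentiable (by norm_num)).differentiableAt.hasFDerivAt).comp_hasDerivAt t h1
  have hcon : Continuous fun t : ℝ => fderiv ℝ f (x + t • h) h := hc.clm_apply continuous_const
  have hint := intervalIntegral.integral_eq_sub_of_hasDerivAt hder (hcon.intervalIntegrable _ _)
  simp only [one_smul, zero_smul, add_zero] at hint
  rw [intervalIntegral.integral_of_le zero_le_one, ← integral_Icc_eq_integral_Ioc] at hint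
  haveI : IsProbabilityMeasure (volume.restrict (Set.Icc (0 : ℝ) 1)) :=
    ⟨by simp⟩
  have h1 : ‖f (x + h) - f x‖ₑ ≤
      ‖h‖ₑ * ∫⁻ t in Set.Icc (0 : ℝ) 1, ‖fderiv ℝ f (x + t • h)‖ₑ := by
    rw [← hint, ← lintegral_const_mul _ (hc.enorm.measurable)]
    refine (enorm_integral_le_lintegral_enorm _).trans (lintegral_mono fun t => ?_)
    rw [mul_comm]
    exact ContinuousLinearMap.le_opENorm _ _
  calc ‖f (x + h) - f x‖ₑ ^ 2
      ≤ (‖h‖ₑ * ∫⁻ t in Set.Icc (0 : ℝ) 1, ‖fderiv ℝ f (x + t • h)‖ₑ) ^ 2 := by gcongr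
    _ = ‖h‖ₑ ^ 2 * (∫⁻ t in Set.Icc (0 : ℝ) 1, ‖fderiv ℝ f (x + t • h)‖ₑ) ^ 2 := mul_pow _ _ _
    _ ≤ _ := by gcongr; exact sq_lintegral_le hc.enorm.measurable.aemeasurable

/-- Integrate the pointwise bound over `x`, exchange the integrals, and use that Lebesgue measure is
translation invariant. -/
theorem lintegral_translate_sub_le {f : 𝔼 → ℝ} (hf : ContDiff ℝ 1 f) (h : 𝔼) :
    ∫⁻ x, ‖f (x + h) - f x‖ₑ ^ 2 ≤ ‖h‖ₑ ^ 2 * ∫⁻ x, ‖fderiv ℝ f x‖ₑ ^ 2 := by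
  have hfd : Continuous (fderiv ℝ f) := hf.continuous_fderiv (by norm_num)
  have hc : Continuous fun z : 𝔼 × ℝ => ‖fderiv ℝ f (z.1 + z.2 • h)‖ₑ ^ 2 :=
    (ENNReal.continuous_pow 2).comp (by fun_prop)
  calc ∫⁻ x, ‖f (x + h) - f x‖ₑ ^ 2
      ≤ ∫⁻ x, ‖h‖ₑ ^ 2 * ∫⁻ t in Set.Icc (0 : ℝ) 1, ‖fderiv ℝ f (x + t • h)‖ₑ ^ 2 :=
        lintegral_mono fun x => enorm_translate_sub_le hf x h
    _ = ‖h‖ₑ ^ 2 * ∫⁻ x, ∫⁻ t in Set.Icc (0 : ℝ) 1, ‖fderiv ℝ f (x + t • h)‖ₑ ^ 2 :=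
        lintegral_const_mul _ hc.measurable.lintegral_prod_right'
    _ = ‖h‖ₑ ^ 2 * ∫⁻ t in Set.Icc (0 : ℝ) 1, ∫⁻ x, ‖fderiv ℝ f (x + t • h)‖ₑ ^ 2 := by
        rw [lintegral_lintegral_swap hc.measurable.aemeasurable]
    _ = ‖h‖ₑ ^ 2 * ∫⁻ x, ‖fderiv ℝ f x‖ₑ ^ 2 := by
        congr 1
        have : ∀ t : ℝ, ∫⁻ x, ‖fderiv ℝ f (x + t • h)‖ₑ ^ 2 = ∫⁻ x, ‖fderiv ℝ f x‖ₑ ^ 2 := fun t =>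
          lintegral_add_right_eq_self (fun x => ‖fderiv ℝ f x‖ₑ ^ 2) (t • h)
        simp [this]

/-- The uniform probability measure on the ball of radius `δ` about the origin. -/
def ballMeasure (n : ℕ) (δ : ℝ) : Measure (EuclideanSpace ℝ (Fin n)) :=
  (volume (Metric.ball (0 : EuclideanSpace ℝ (Fin n)) δ))⁻¹ •
    volume.restrict (Metric.ball (0 : EuclideanSpace ℝ (Fin n)) δ)

theorem isProbabilityMeasure_ballMeasure {δ : ℝ} (hδ : 0 < δ) :
    IsProbabilityMeasure (ballMeasure n δ) :=
  ⟨by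
    simp only [ballMeasure, Measure.smul_apply, Measure.restrict_apply MeasurableSet.univ,
      Set.univ_inter, smul_eq_mul]
    exact ENNReal.inv_mul_cancel (Metric.measure_ball_pos _ _ hδ).ne' measure_ball_lt_top.ne⟩

/-- The average of `f` over the ball of radius `δ` about `x`. -/
def ballAverage (δ : ℝ) (f : 𝔼 → ℝ) (x : 𝔼) : ℝ := ∫ h, f (x + h) ∂(ballMeasure n δ)

theorem integrable_translate {f : 𝔼 → ℝ} (hf : Continuous f) (hs : HasCompactSupport f) {δ : ℝ}
    (hδ : 0 < δ) (x : 𝔼) : Integrable (fun h => f (x + h)) (ballMeasure n δ) := by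
  haveI := isProbabilityMeasure_ballMeasure (n := n) hδ
  obtain ⟨C, hC⟩ := hs.exists_bound_of_continuous hf
  exact Integrable.of_bound (by fun_prop) C (Eventually.of_forall fun h => hC _)

theorem stronglyMeasurable_ballAverage {f : 𝔼 → ℝ} (hf : Continuous f) {δ : ℝ} (hδ : 0 < δ) :
    StronglyMeasurable (ballAverage δ f) := by
  haveI := isProbabilityMeasure_ballMeasure (n := n) hδ
  have : Continuous fun z : 𝔼 × 𝔼 => f (z.1 + z.2) := by fun_prop
  exact this.stronglyMeasurable.integral_prod_right'

/-- The difference is an average of translation differences with shifts shorter than `δ`, so the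
error of averaging is controlled by the gradient, uniformly over the sequence in Rellich's theorem.
-/
theorem lintegral_sub_ballAverage_le {f : 𝔼 → ℝ} (hf : ContDiff ℝ 1 f) (hs : HasCompactSupport f)
    {δ : ℝ} (hδ : 0 < δ) :
    ∫⁻ x, ‖f x - ballAverage δ f x‖ₑ ^ 2 ≤ ENNReal.ofReal δ ^ 2 * ∫⁻ x, ‖fderiv ℝ f x‖ₑ ^ 2 := by
  haveI := isProbabilityMeasure_ballMeasure (n := n) hδ
  have hfc := hf.continuous
  have hc : Continuous fun z : 𝔼 × 𝔼 => ‖f (z.1 + z.2) - f z.1‖ₑ ^ 2 :=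
    (ENNReal.continuous_pow 2).comp (by fun_prop)
  have hpt : ∀ x, ‖f x - ballAverage δ f x‖ₑ ^ 2 ≤
      ∫⁻ h, ‖f (x + h) - f x‖ₑ ^ 2 ∂(ballMeasure n δ) := fun x => by
    have e : f x - ballAverage δ f x = ∫ h, (f x - f (x + h)) ∂(ballMeasure n δ) := by
      rw [integral_sub (integrable_const _) (integrable_translate hfc hs hδ x)]
      simp [ballAverage]
    have e2 : ∀ h, ‖f x - f (x + h)‖ₑ = ‖f (x + h) - f x‖ₑ := fun h => enorm_sub_rev _ _
    have hc' : Continuous fun h => ‖f (x + h) - f x‖ₑ := by fun_prop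
    calc ‖f x - ballAverage δ f x‖ₑ ^ 2
        ≤ (∫⁻ h, ‖f (x + h) - f x‖ₑ ∂(ballMeasure n δ)) ^ 2 := by
          rw [e]
          gcongr
          refine (enorm_integral_le_lintegral_enorm _).trans (le_of_eq ?_)
          simp only [e2]
      _ ≤ _ := sq_lintegral_le hc'.measurable.aemeasurable
  calc ∫⁻ x, ‖f x - ballAverage δ f x‖ₑ ^ 2
      ≤ ∫⁻ x, ∫⁻ h, ‖f (x + h) - f x‖ₑ ^ 2 ∂(ballMeasure n δ) := lintegral_mono hpt
    _ = ∫⁻ h, (∫⁻ x, ‖f (x + h) - f x‖ₑ ^ 2) ∂(ballMeasure n δ) :=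
        lintegral_lintegral_swap hc.measurable.aemeasurable
    _ ≤ ∫⁻ _, (ENNReal.ofReal δ ^ 2 * ∫⁻ x, ‖fderiv ℝ f x‖ₑ ^ 2) ∂(ballMeasure n δ) := by
        refine lintegral_mono_ae ?_
        have hball : ∀ᵐ h ∂(ballMeasure n δ), h ∈ Metric.ball (0 : 𝔼) δ := by
          refine Measure.ae_smul_measure ?_ _
          exact ae_restrict_mem measurableSet_ball
        filter_upwards [hball] with h hh
        refine (lintegral_translate_sub_le hf h).trans ?_
        gcongr
        rw [← ofReal_norm_eq_enorm]
        exact ENNReal.ofReal_le_ofReal (by simpa using (mem_ball_zero_iff.1 hh).le)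
    _ = _ := by simp

/-- For fixed `δ` the averages are bounded pointwise by the `L²` norm; this supplies the dominating
constant in `tendsto_ballAverage`. -/
theorem enorm_ballAverage_le {f : 𝔼 → ℝ} (hf : Continuous f) {δ : ℝ} (hδ : 0 < δ) (x : 𝔼) :
    ‖ballAverage δ f x‖ₑ ^ 2 ≤
      (volume (Metric.ball (0 : EuclideanSpace ℝ (Fin n)) δ))⁻¹ * ∫⁻ y, ‖f y‖ₑ ^ 2 := by
  haveI := isProbabilityMeasure_ballMeasure (n := n) hδ
  have hc' : Continuous fun h => ‖f (x + h)‖ₑ := by fun_prop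
  calc ‖ballAverage δ f x‖ₑ ^ 2 ≤ (∫⁻ h, ‖f (x + h)‖ₑ ∂(ballMeasure n δ)) ^ 2 := by
        gcongr; exact enorm_integral_le_lintegral_enorm _
    _ ≤ ∫⁻ h, ‖f (x + h)‖ₑ ^ 2 ∂(ballMeasure n δ) := sq_lintegral_le hc'.measurable.aemeasurable
    _ ≤ _ := by
        rw [ballMeasure, lintegral_smul_measure, smul_eq_mul]
        rw [← lintegral_add_left_eq_self (fun y => ‖f y‖ₑ ^ 2) x]
        gcongr
        exact Measure.restrict_le_self

/-- Written as a pairing with the indicator of a ball, the average at each point converges as soon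
as the functions converge weakly in `L²`. -/
theorem ballAverage_eq {f : 𝔼 → ℝ} {δ : ℝ} (x : 𝔼) :
    ballAverage δ f x = ∫ y, ((volume (Metric.ball (0 : 𝔼) δ)).toReal)⁻¹ *
      ((Metric.ball x δ).indicator (fun _ => (1 : ℝ)) y * f y) := by
  rw [ballAverage, ballMeasure, integral_smul_measure, integral_const_mul, smul_eq_mul,
    ENNReal.toReal_inv]
  congr 1
  rw [← integral_indicator measurableSet_ball,
    ← integral_add_left_eq_self (fun y => (Metric.ball x δ).indicator (fun _ => (1 : ℝ)) y * f y) x]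
  refine integral_congr_ae (Eventually.of_forall fun h => ?_)
  by_cases hh : h ∈ Metric.ball (0 : 𝔼) δ
  · have : x + h ∈ Metric.ball x δ := by simpa using hh
    simp only [Set.indicator_of_mem hh, Set.indicator_of_mem this, one_mul]
  · have : x + h ∉ Metric.ball x δ := by simpa using hh
    simp only [Set.indicator_of_notMem hh, Set.indicator_of_notMem this, zero_mul]

theorem ballAverage_eq_zero {f : 𝔼 → ℝ} {K : Set 𝔼} (hs : Function.support f ⊆ K) {δ : ℝ} {x : 𝔼}
    (hx : x ∉ Metric.thickening δ K) : ballAverage δ f x = 0 := by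
  rw [ballAverage_eq]
  refine integral_eq_zero_of_ae (Eventually.of_forall fun y => ?_)
  simp only [Pi.zero_apply, mul_eq_zero]
  right
  by_cases hy : y ∈ Metric.ball x δ
  · right
    by_contra h
    exact hx (Metric.mem_thickening_iff.2 ⟨y, hs h, by rw [dist_comm]; exact hy⟩)
  · left
    exact Set.indicator_of_notMem hy _

theorem eLpNorm_two_eq {Ω G : Type*} [MeasurableSpace Ω] {μ : Measure Ω} [NormedAddCommGroup G]
    (f : Ω → G) : eLpNorm f 2 μ ^ 2 = ∫⁻ x, ‖f x‖ₑ ^ 2 ∂μ := by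
  have e : (2 : ℝ≥0∞) = ENNReal.ofReal 2 := by simp
  rw [e, eLpNorm_ofReal_eq (by norm_num), ← ENNReal.rpow_natCast, ← ENNReal.rpow_mul]
  norm_num

theorem le_of_sq_le_sq' {a b : ℝ≥0∞} (h : a ^ 2 ≤ b ^ 2) : a ≤ b := by
  by_contra hlt
  push Not at hlt
  exact absurd h (not_le.2 (ENNReal.pow_right_strictMono (by norm_num) hlt))

/-- For fixed `δ` the averages converge pointwise, are uniformly bounded and vanish off a bounded
thickening of `K`, so dominated convergence yields convergence in `L²`. -/
theorem tendsto_ballAverage {f : ℕ → 𝔼 → ℝ} {K : Set 𝔼} (hK : IsCompact K)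
    (hf : ∀ k, Continuous (f k)) (hs : ∀ k, Function.support (f k) ⊆ K) {C : ℝ≥0∞} (hC : C ≠ ⊤)
    (hb : ∀ k, eLpNorm (f k) 2 volume ≤ C) {δ : ℝ} (hδ : 0 < δ)
    (hw : ∀ x, ∃ l, Tendsto (fun k => ballAverage δ (f k) x) atTop (𝓝 l)) :
    ∃ G : 𝔼 → ℝ, MemLp G 2 volume ∧
      Tendsto (fun k => eLpNorm (ballAverage δ (f k) - G) 2 volume) atTop (𝓝 0) := by
  choose G hG using hw
  set v := (volume (Metric.ball (0 : 𝔼) δ))⁻¹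
  have hv : v ≠ ⊤ := ENNReal.inv_ne_top.2 (Metric.measure_ball_pos _ _ hδ).ne'
  set M : ℝ := Real.sqrt ((v * C ^ 2).toReal)
  have hbound : ∀ k x, |ballAverage δ (f k) x| ≤ M := fun k x => by
    refine Real.le_sqrt_of_sq_le ?_
    have h1 := enorm_ballAverage_le (hf k) hδ x
    rw [← eLpNorm_two_eq] at h1
    have h2 : ‖ballAverage δ (f k) x‖ₑ ^ 2 ≤ v * C ^ 2 := h1.trans (by gcongr; exact hb k)
    have h3 := ENNReal.toReal_mono (ENNReal.mul_ne_top hv (ENNReal.pow_ne_top hC)) h2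
    simpa using h3
  have hGb : ∀ x, |G x| ≤ M := fun x =>
    le_of_tendsto (hG x).abs (Eventually.of_forall fun k => hbound k x)
  set S := Metric.thickening δ K
  have hSm : MeasurableSet S := Metric.isOpen_thickening.measurableSet
  have hSf : volume S ≠ ⊤ := hK.isBounded.thickening.measure_lt_top.ne
  have h0 : ∀ k, ∀ x ∉ S, ballAverage δ (f k) x = 0 := fun k x hx => ballAverage_eq_zero (hs k) hx
  have hG0 : ∀ x ∉ S, G x = 0 := fun x hx =>
    tendsto_nhds_unique (hG x) (tendsto_const_nhds.congr fun k => (h0 k x hx).symm)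
  have hGm : StronglyMeasurable G := stronglyMeasurable_of_tendsto atTop
    (fun k => stronglyMeasurable_ballAverage (hf k) hδ) (tendsto_pi_nhds.2 hG)
  have hind : ∀ c : ℝ, MemLp (S.indicator fun _ => c) 2 volume := fun c =>
    memLp_indicator_const 2 hSm c (Or.inr hSf)
  have hGL : MemLp G 2 volume := by
    refine (hind M).of_le hGm.aestronglyMeasurable (Eventually.of_forall fun x => ?_)
    by_cases hx : x ∈ S
    · rw [Set.indicator_of_mem hx]
      exact (hGb x).trans (le_abs_self _)
    · rw [hG0 x hx, Set.indicator_of_notMem hx]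
  refine ⟨G, hGL, tendsto_eLpNorm_two_of_dominated (G := S.indicator fun _ => 2 * M)
    (fun k => (stronglyMeasurable_ballAverage (hf k) hδ).aestronglyMeasurable.sub
      hGm.aestronglyMeasurable) (hind _) (fun k => Eventually.of_forall fun x => ?_)
    (Eventually.of_forall fun x => ?_)⟩
  · by_cases hx : x ∈ S
    · rw [Set.indicator_of_mem hx, Pi.sub_apply]
      refine (norm_sub_le _ _).trans ?_
      simp only [Real.norm_eq_abs]
      linarith [hbound k x, hGb x]
    · rw [Set.indicator_of_notMem hx, Pi.sub_apply, h0 k x hx, hG0 x hx]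
      simp
  · simpa using (hG x).sub_const (G x)

/-- **Rellich's theorem** for continuously differentiable functions supported in a fixed compact
set. -/
theorem rellich_euclidean {f : ℕ → 𝔼 → ℝ} {K : Set 𝔼} (hK : IsCompact K)
    (hf : ∀ k, ContDiff ℝ 1 (f k)) (hs : ∀ k, Function.support (f k) ⊆ K) {C : ℝ≥0∞} (hC : C ≠ ⊤)
    (hb : ∀ k, eLpNorm (f k) 2 volume ≤ C) (hb' : ∀ k, eLpNorm (fderiv ℝ (f k)) 2 volume ≤ C) :
    ∃ (σ : ℕ → ℕ), StrictMono σ ∧ ∀ ε : ℝ≥0∞, 0 < ε → ∃ N, ∀ k ≥ N, ∀ l ≥ N,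
      eLpNorm (f (σ k) - f (σ l)) 2 volume < ε := by
  have hcs : ∀ k, HasCompactSupport (f k) := fun k =>
    HasCompactSupport.of_support_subset_isCompact hK (hs k)
  have hmem : ∀ k, MemLp (f k) 2 volume := fun k =>
    (hf k).continuous.memLp_of_hasCompactSupport (hcs k)
  haveI : Fact ((2 : ℝ≥0∞) ≠ ⊤) := ⟨by norm_num⟩
  obtain ⟨σ, hσ, hweak⟩ := exists_weakly_convergent_subseq (H := Lp ℝ 2 (volume : Measure 𝔼))
    (x := fun k => (hmem k).toLp (f k)) (R := C.toReal) (fun k => by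
      rw [Lp.norm_toLp]; exact ENNReal.toReal_mono hC (hb k))
  refine ⟨σ, hσ, fun ε hε => ?_⟩
  -- choose the radius of averaging
  obtain ⟨δ, hδ, hδε⟩ : ∃ δ : ℝ, 0 < δ ∧ ENNReal.ofReal δ * C < ε / 4 := by
    have ht : Tendsto (fun δ : ℝ => ENNReal.ofReal δ * C) (𝓝[>] 0) (𝓝 0) := by
      have := ENNReal.Tendsto.mul_const (ENNReal.tendsto_ofReal
        (tendsto_id (x := 𝓝[>] (0 : ℝ)) |>.mono_right nhdsWithin_le_nhds)) (Or.inr hC) (b := C)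
      simpa using this
    have h4 : 0 < ε / 4 := ENNReal.div_pos hε.ne' (by norm_num)
    obtain ⟨δ, h1, h2⟩ := ((ht.eventually_lt_const h4).and
      (eventually_mem_nhdsWithin (a := (0 : ℝ)) (s := Set.Ioi 0))).exists
    exact ⟨δ, h2, h1⟩
  -- Weak convergence is tested against the indicator of the ball about `x`.
  obtain ⟨G, hG, hlim⟩ := tendsto_ballAverage (f := fun k => f (σ k)) hK
    (fun k => (hf _).continuous) (fun k => hs _) hC (fun k => hb _) hδ (fun x => by
      set c := ((volume (Metric.ball (0 : 𝔼) δ)).toReal)⁻¹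
      have hκ : MemLp ((Metric.ball x δ).indicator (fun _ => (1 : ℝ))) 2 (volume : Measure 𝔼) :=
        memLp_indicator_const 2 measurableSet_ball 1 (Or.inr measure_ball_lt_top.ne)
      obtain ⟨l, hl⟩ := hweak (hκ.toLp _)
      refine ⟨c * l, (hl.const_mul c).congr fun k => ?_⟩
      rw [ballAverage_eq, integral_const_mul, L2.inner_def]
      congr 1
      refine integral_congr_ae ?_
      filter_upwards [hκ.coeFn_toLp, (hmem (σ k)).coeFn_toLp] with y h1 h2
      rw [h1, h2]
      simp [mul_comm])
  have hav : ∀ k, eLpNorm (f k - ballAverage δ (f k)) 2 volume < ε / 4 := fun k => by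
    refine lt_of_le_of_lt (le_of_sq_le_sq' ?_) hδε
    rw [eLpNorm_two_eq, mul_pow]
    refine (lintegral_sub_ballAverage_le (hf k) (hcs k) hδ).trans ?_
    rw [← eLpNorm_two_eq]
    gcongr
    exact hb' k
  have h4 : 0 < ε / 4 := ENNReal.div_pos hε.ne' (by norm_num)
  obtain ⟨N, hN⟩ := eventually_atTop.1 (hlim.eventually_lt_const h4)
  refine ⟨N, fun k hk l hl => ?_⟩
  have hm1 : ∀ k, AEStronglyMeasurable (f (σ k) - ballAverage δ (f (σ k))) volume := fun k =>
    (hf _).continuous.aestronglyMeasurable.sub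
      (stronglyMeasurable_ballAverage (hf _).continuous hδ).aestronglyMeasurable
  have hm2 : ∀ k, AEStronglyMeasurable (ballAverage δ (f (σ k)) - G) volume := fun k =>
    (stronglyMeasurable_ballAverage (hf _).continuous hδ).aestronglyMeasurable.sub
      hG.aestronglyMeasurable
  have hdist : ∀ k ≥ N, eLpNorm (f (σ k) - G) 2 volume < ε / 4 + ε / 4 := fun k hk => by
    have e : f (σ k) - G = (f (σ k) - ballAverage δ (f (σ k))) + (ballAverage δ (f (σ k)) - G) := by
      abel
    rw [e]
    exact (eLpNorm_add_le (hm1 k) (hm2 k) (by norm_num)).trans_lt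
      (ENNReal.add_lt_add (hav _) (hN k hk))
  have e : f (σ k) - f (σ l) = (f (σ k) - G) + -(f (σ l) - G) := by abel
  have hm3 : ∀ k, AEStronglyMeasurable (f (σ k) - G) volume := fun k =>
    (hf _).continuous.aestronglyMeasurable.sub hG.aestronglyMeasurable
  rw [e]
  refine (eLpNorm_add_le (hm3 k) (hm3 l).neg (by norm_num)).trans_lt ?_
  rw [eLpNorm_neg]
  refine (ENNReal.add_lt_add (hdist k hk) (hdist l hl)).trans_le (le_of_eq ?_)
  have : ε / 4 + ε / 4 + (ε / 4 + ε / 4) = 4 * (ε / 4) := by ring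
  rw [this]
  exact ENNReal.mul_div_cancel (by norm_num) (by norm_num)

end Euclidean

end NodalYamabe

end

noncomputable section

namespace NodalYamabe

/-! ### Invariance of the scalar curvature under changes of coordinates -/

section Connection

set_option synthInstance.maxHeartbeats 400000
set_option maxHeartbeats 1000000

variable {E : Type*} [NormedAddCommGroup E] [NormedSpace ℝ E]

theorem _root_.ContDiffOn.differentiableAt_of_isOpen {F : Type*} [NormedAddCommGroup F]
    [NormedSpace ℝ F] {U : Set E} (hU : IsOpen U) {f : E → F} (hf : ContDiffOn ℝ ∞ f U) {z : E}
    (hz : z ∈ U) : DifferentiableAt ℝ f z :=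
  (hf.differentiableOn (by simp)).differentiableAt (hU.mem_nhds hz)

/-- A smooth metric `B` on the open set `U` with Levi-Civita connection `Γ`, which is determined by
the Koszul formula. -/
structure IsLeviCivita (B : E → E →L[ℝ] E →L[ℝ] ℝ) (Γ : E → E →L[ℝ] E →L[ℝ] E) (U : Set E) :
    Prop where
  isOpen : IsOpen U
  contDiffOn_form : ContDiffOn ℝ ∞ B U
  contDiffOn_conn : ContDiffOn ℝ ∞ Γ U
  symm : ∀ z ∈ U, ∀ u v, B z u v = B z v u
  pos : ∀ z ∈ U, ∀ u, u ≠ 0 → 0 < B z u u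
  koszul : ∀ z ∈ U, ∀ u v w, 2 * B z (Γ z u v) w
    = fderiv ℝ B z u v w + fderiv ℝ B z v u w - fderiv ℝ B z w u v

/-- The curvature `R(u, v) w` of the connection `Γ`. -/
def curvature (Γ : E → E →L[ℝ] E →L[ℝ] E) (z u v w : E) : E :=
  fderiv ℝ Γ z u v w - fderiv ℝ Γ z v u w + Γ z u (Γ z v w) - Γ z v (Γ z u w)

variable {B B' : E → E →L[ℝ] E →L[ℝ] ℝ} {Γ Γ' : E → E →L[ℝ] E →L[ℝ] E} {U U' : Set E} {τ : E → E}

/-- A vector in the kernel of the derivative of `τ` would have length zero for the pulled back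
metric. In finite dimension the derivative is then invertible, with no inverse of `τ` assumed. -/
theorem IsLeviCivita.injective (h : IsLeviCivita B Γ U)
    (hB : ∀ z ∈ U, ∀ u v, B z u v = B' (τ z) (fderiv ℝ τ z u) (fderiv ℝ τ z v)) {z : E}
    (hz : z ∈ U) : Function.Injective (fderiv ℝ τ z) := by
  rw [injective_iff_map_eq_zero]
  intro u hu
  by_contra hne
  have := h.pos z hz u hne
  rw [hB z hz, hu] at this
  simp at this

theorem fderiv_form_comp (h : IsLeviCivita B Γ U) (h' : IsLeviCivita B' Γ' U')
    (hτ : ContDiffOn ℝ ∞ τ U) (hm : Set.MapsTo τ U U')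
    (hB : ∀ z ∈ U, ∀ u v, B z u v = B' (τ z) (fderiv ℝ τ z u) (fderiv ℝ τ z v)) {z : E}
    (hz : z ∈ U) (a u v : E) :
    fderiv ℝ B z a u v = fderiv ℝ B' (τ z) (fderiv ℝ τ z a) (fderiv ℝ τ z u) (fderiv ℝ τ z v)
      + B' (τ z) (fderiv ℝ (fderiv ℝ τ) z a u) (fderiv ℝ τ z v)
      + B' (τ z) (fderiv ℝ τ z u) (fderiv ℝ (fderiv ℝ τ) z a v) := by
  have hτ1 : ContDiffOn ℝ ∞ (fderiv ℝ τ) U := hτ.fderiv_of_isOpen h.isOpen (by simp)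
  have d1 := (hτ.differentiableAt_of_isOpen h.isOpen hz).hasFDerivAt
  have d2 := (hτ1.differentiableAt_of_isOpen h.isOpen hz).hasFDerivAt
  have d3 := (h'.contDiffOn_form.differentiableAt_of_isOpen h'.isOpen (hm hz)).hasFDerivAt
  have d31 : HasFDerivAt (fun y => B' (τ y)) ((fderiv ℝ B' (τ z)).comp (fderiv ℝ τ z)) z :=
    d3.comp z d1
  have e1 := (((d31.clm_apply (d2.clm_apply (hasFDerivAt_const u z)))).clm_apply
    (d2.clm_apply (hasFDerivAt_const v z)))
  have e2 := (((h.contDiffOn_form.differentiableAt_of_isOpen h.isOpen hz).hasFDerivAt.clm_apply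
    (hasFDerivAt_const u z)).clm_apply (hasFDerivAt_const v z))
  have e3 : (fun y => B y u v) =ᶠ[𝓝 z] fun y => B' (τ y) (fderiv ℝ τ y u) (fderiv ℝ τ y v) := by
    filter_upwards [h.isOpen.mem_nhds hz] with y hy using hB y hy u v
  have e4 := DFunLike.congr_fun (e2.unique (e1.congr_of_eventuallyEq e3)) a
  simp at e4
  rw [e4]
  ring

theorem IsLeviCivita.fderiv_comm (hU : IsOpen U) {F : Type*} [NormedAddCommGroup F]
    [NormedSpace ℝ F] {f : E → F} (hf : ContDiffOn ℝ ∞ f U) {z : E} (hz : z ∈ U) (u v : E) :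
    fderiv ℝ (fderiv ℝ f) z u v = fderiv ℝ (fderiv ℝ f) z v u :=
  ((hf.contDiffAt (hU.mem_nhds hz)).isSymmSndFDerivAt
    (by simpa using WithTop.coe_le_coe.2 (le_top : (2 : ℕ∞) ≤ ⊤))) u v

/-- Inserting the derivative of the pulled back metric into the Koszul formula, the second
derivatives of `τ` cancel by symmetry except for `2 B'(D²τ(u, v), Dτ w)`. As `Dτ` is onto and `B'`
is positive definite, the vectors themselves agree. -/
theorem IsLeviCivita.conn_comp [FiniteDimensional ℝ E] (h : IsLeviCivita B Γ U)
    (h' : IsLeviCivita B' Γ' U')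
    (hτ : ContDiffOn ℝ ∞ τ U) (hm : Set.MapsTo τ U U')
    (hB : ∀ z ∈ U, ∀ u v, B z u v = B' (τ z) (fderiv ℝ τ z u) (fderiv ℝ τ z v)) {z : E}
    (hz : z ∈ U) (u v : E) :
    fderiv ℝ τ z (Γ z u v) = Γ' (τ z) (fderiv ℝ τ z u) (fderiv ℝ τ z v)
      + fderiv ℝ (fderiv ℝ τ) z u v := by
  have hs : Function.Surjective (fderiv ℝ τ z) :=
    LinearMap.injective_iff_surjective.1 (h.injective hB hz : Function.Injective
      (fderiv ℝ τ z).toLinearMap)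
  have key : ∀ w, B' (τ z) (fderiv ℝ τ z (Γ z u v)) (fderiv ℝ τ z w)
      = B' (τ z) (Γ' (τ z) (fderiv ℝ τ z u) (fderiv ℝ τ z v) + fderiv ℝ (fderiv ℝ τ) z u v)
        (fderiv ℝ τ z w) := by
    intro w
    have k := h.koszul z hz u v w
    have k' := h'.koszul _ (hm hz) (fderiv ℝ τ z u) (fderiv ℝ τ z v) (fderiv ℝ τ z w)
    rw [hB z hz] at k
    simp only [fderiv_form_comp h h' hτ hm hB hz] at k
    rw [fderiv_comm h.isOpen hτ hz v u, fderiv_comm h.isOpen hτ hz w u,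
      fderiv_comm h.isOpen hτ hz w v, h'.symm _ (hm hz) (fderiv ℝ τ z v)] at k
    rw [(B' (τ z)).map_add, _root_.add_apply]
    linarith
  by_contra hne
  obtain ⟨w, hw⟩ := hs (fderiv ℝ τ z (Γ z u v) -
    (Γ' (τ z) (fderiv ℝ τ z u) (fderiv ℝ τ z v) + fderiv ℝ (fderiv ℝ τ) z u v))
  have := h'.pos _ (hm hz) _ (sub_ne_zero.2 hne)
  rw [(B' (τ z)).map_sub, _root_.sub_apply, ← hw, key w, sub_self] at this
  exact lt_irrefl _ this

/-- Differentiate the transformation law of the connection and antisymmetrise in `u` and `v`. The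
third derivatives of `τ` cancel by symmetry; the remaining second derivatives cancel against the
terms quadratic in the connection. -/
theorem IsLeviCivita.curvature_comp [FiniteDimensional ℝ E] (h : IsLeviCivita B Γ U)
    (h' : IsLeviCivita B' Γ' U')
    (hτ : ContDiffOn ℝ ∞ τ U) (hm : Set.MapsTo τ U U')
    (hB : ∀ z ∈ U, ∀ u v, B z u v = B' (τ z) (fderiv ℝ τ z u) (fderiv ℝ τ z v)) {z : E}
    (hz : z ∈ U) (u v w : E) :
    fderiv ℝ τ z (curvature Γ z u v w)
      = curvature Γ' (τ z) (fderiv ℝ τ z u) (fderiv ℝ τ z v) (fderiv ℝ τ z w) := by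
  have hτ1 : ContDiffOn ℝ ∞ (fderiv ℝ τ) U := hτ.fderiv_of_isOpen h.isOpen (by simp)
  have hτ2 : ContDiffOn ℝ ∞ (fderiv ℝ (fderiv ℝ τ)) U :=
    hτ1.fderiv_of_isOpen h.isOpen (by simp)
  have d1 := (hτ.differentiableAt_of_isOpen h.isOpen hz).hasFDerivAt
  have d2 := (hτ1.differentiableAt_of_isOpen h.isOpen hz).hasFDerivAt
  have d3 := (hτ2.differentiableAt_of_isOpen h.isOpen hz).hasFDerivAt
  have d4 := (h.contDiffOn_conn.differentiableAt_of_isOpen h.isOpen hz).hasFDerivAt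
  have d5 := (h'.contDiffOn_conn.differentiableAt_of_isOpen h'.isOpen (hm hz)).hasFDerivAt
  have d51 : HasFDerivAt (fun y => Γ' (τ y)) ((fderiv ℝ Γ' (τ z)).comp (fderiv ℝ τ z)) z :=
    d5.comp z d1
  have key : ∀ u v, fderiv ℝ τ z (fderiv ℝ Γ z u v w)
      = fderiv ℝ Γ' (τ z) (fderiv ℝ τ z u) (fderiv ℝ τ z v) (fderiv ℝ τ z w)
        + Γ' (τ z) (fderiv ℝ (fderiv ℝ τ) z u v) (fderiv ℝ τ z w)
        + Γ' (τ z) (fderiv ℝ τ z v) (fderiv ℝ (fderiv ℝ τ) z u w)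
        + fderiv ℝ (fderiv ℝ (fderiv ℝ τ)) z u v w
        - fderiv ℝ (fderiv ℝ τ) z u (Γ z v w) := by
    intro u v
    have e1 := d2.clm_apply ((d4.clm_apply (hasFDerivAt_const v z)).clm_apply
      (hasFDerivAt_const w z))
    have e2 := ((d51.clm_apply (d2.clm_apply (hasFDerivAt_const v z))).clm_apply
      (d2.clm_apply (hasFDerivAt_const w z))).add ((d3.clm_apply (hasFDerivAt_const v z)).clm_apply
      (hasFDerivAt_const w z))
    have e3 : (fun y => fderiv ℝ τ y (Γ y v w)) =ᶠ[𝓝 z]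
        ((fun y => Γ' (τ y) (fderiv ℝ τ y v) (fderiv ℝ τ y w))
          + fun y => fderiv ℝ (fderiv ℝ τ) y v w) := by
      filter_upwards [h.isOpen.mem_nhds hz] with y hy using h.conn_comp h' hτ hm hB hy v w
    have e4 := DFunLike.congr_fun (e1.unique (e2.congr_of_eventuallyEq e3)) u
    simp at e4
    rw [eq_sub_iff_add_eq, e4]
    abel
  rw [curvature, curvature]
  simp only [map_add, map_sub, key, h.conn_comp h' hτ hm hB hz]
  rw [fderiv_comm h.isOpen hτ hz v u, fderiv_comm h.isOpen hτ1 hz v u]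
  abel

/-- The sum is the trace of `u ↦ R(u, v) w`, and the derivative of `τ` conjugates one such
endomorphism into the other. -/
theorem IsLeviCivita.sum_coord_curvature_comp [FiniteDimensional ℝ E] {ι : Type*} [Fintype ι]
    [DecidableEq ι] (b : Module.Basis ι ℝ E) (h : IsLeviCivita B Γ U) (h' : IsLeviCivita B' Γ' U')
    (hτ : ContDiffOn ℝ ∞ τ U) (hm : Set.MapsTo τ U U')
    (hB : ∀ z ∈ U, ∀ u v, B z u v = B' (τ z) (fderiv ℝ τ z u) (fderiv ℝ τ z v)) {z : E}
    (hz : z ∈ U) (v w : E) :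
    ∑ i, b.coord i (curvature Γ z (b i) v w)
      = ∑ i, b.coord i (curvature Γ' (τ z) (b i) (fderiv ℝ τ z v) (fderiv ℝ τ z w)) := by
  let R (Γ : E → E →L[ℝ] E →L[ℝ] E) (z v w : E) : E →ₗ[ℝ] E :=
    { toFun := fun u => curvature Γ z u v w
      map_add' := fun a b => by
        simp only [curvature, map_add, _root_.add_apply]
        abel
      map_smul' := fun c a => by
        simp only [curvature, map_smul, _root_.smul_apply, RingHom.id_apply, smul_sub, smul_add] }
  have htr : ∀ Γ z v w, ∑ i, b.coord i (curvature Γ z (b i) v w) = LinearMap.trace ℝ E (R Γ z v w) :=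
    fun Γ z v w => by
      rw [LinearMap.trace_eq_matrix_trace ℝ b]
      exact Finset.sum_congr rfl fun i _ => by simp [LinearMap.toMatrix_apply, R]
  rw [htr, htr]
  let e : E ≃ₗ[ℝ] E := LinearEquiv.ofInjectiveEndo (fderiv ℝ τ z).toLinearMap (h.injective hB hz)
  have he : ∀ u, e u = fderiv ℝ τ z u := fun u => rfl
  have hconj : R Γ' (τ z) (fderiv ℝ τ z v) (fderiv ℝ τ z w) = e.conj (R Γ z v w) := by
    ext u
    obtain ⟨u, rfl⟩ := e.surjective u
    rw [LinearEquiv.conj_apply_apply, LinearEquiv.symm_apply_apply]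
    exact (h.curvature_comp h' hτ hm hB hz u v w).symm
  rw [hconj, LinearMap.trace_conj']

/-- Metric and Ricci matrices both transform by the congruence `A ↦ Pᵀ A P`, under which the trace
of `A⁻¹ Kᵀ` is invariant. Symmetry of the Ricci tensor is not used. -/
theorem IsLeviCivita.scalar_comp [FiniteDimensional ℝ E] {ι : Type*} [Fintype ι]
    [DecidableEq ι] (b : Module.Basis ι ℝ E) (h : IsLeviCivita B Γ U) (h' : IsLeviCivita B' Γ' U')
    (hτ : ContDiffOn ℝ ∞ τ U) (hm : Set.MapsTo τ U U')
    (hB : ∀ z ∈ U, ∀ u v, B z u v = B' (τ z) (fderiv ℝ τ z u) (fderiv ℝ τ z v)) {z : E}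
    (hz : z ∈ U) :
    ∑ j, ∑ k, (Matrix.of fun i j => B z (b i) (b j))⁻¹ j k
        * ∑ i, b.coord i (curvature Γ z (b i) (b j) (b k))
      = ∑ j, ∑ k, (Matrix.of fun i j => B' (τ z) (b i) (b j))⁻¹ j k
        * ∑ i, b.coord i (curvature Γ' (τ z) (b i) (b j) (b k)) := by
  set P : Matrix ι ι ℝ := LinearMap.toMatrix b b (fderiv ℝ τ z).toLinearMap with hP
  have hPb : ∀ j, fderiv ℝ τ z (b j) = ∑ k, P k j • b k := fun j => by
    conv_lhs => rw [← b.sum_repr (fderiv ℝ τ z (b j))]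
    simp [hP, LinearMap.toMatrix_apply]
  have hPu : IsUnit P.det := by
    rw [hP, LinearMap.det_toMatrix]
    exact (LinearEquiv.ofInjectiveEndo (fderiv ℝ τ z).toLinearMap (h.injective hB hz)).isUnit_det'
  have hbil : ∀ (C : E → E → ℝ), (∀ u v w, C (u + v) w = C u w + C v w) →
      (∀ (a : ℝ) u w, C (a • u) w = a * C u w) → (∀ u v w, C u (v + w) = C u v + C u w) →
      (∀ (a : ℝ) u w, C u (a • w) = a * C u w) →
      (Matrix.of fun i j => C (fderiv ℝ τ z (b i)) (fderiv ℝ τ z (b j)))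
        = P.transpose * (Matrix.of fun i j => C (b i) (b j)) * P := by
    intro C h1 h2 h3 h4
    let L := LinearMap.mk₂ ℝ C h1 h2 h3 h4
    ext i j
    have e : C (fderiv ℝ τ z (b i)) (fderiv ℝ τ z (b j)) = L (∑ k, P k i • b k) (∑ l, P l j • b l) := by
      rw [← hPb, ← hPb]
      rfl
    rw [Matrix.of_apply, e]
    simp only [map_sum, LinearMap.sum_apply, map_smul, LinearMap.smul_apply, smul_eq_mul,
      Matrix.mul_apply, Matrix.transpose_apply, Matrix.of_apply, Finset.sum_mul]
    refine Finset.sum_congr rfl fun k _ => ?_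
    rw [Finset.mul_sum]
    refine Finset.sum_congr rfl fun l _ => ?_
    simp only [L, LinearMap.mk₂_apply]
    ring
  set A' : Matrix ι ι ℝ := Matrix.of fun i j => B' (τ z) (b i) (b j) with hA'
  have hA : (Matrix.of fun i j => B z (b i) (b j)) = P.transpose * A' * P := by
    rw [hA', ← hbil (fun u v => B' (τ z) u v) (by simp) (by simp) (by simp) (by simp)]
    ext i j
    exact hB z hz _ _
  set K' : Matrix ι ι ℝ := Matrix.of fun j k => ∑ i, b.coord i (curvature Γ' (τ z) (b i) (b j) (b k))
    with hK'
  have hK : (Matrix.of fun j k => ∑ i, b.coord i (curvature Γ z (b i) (b j) (b k)))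
      = P.transpose * K' * P := by
    rw [hK', ← hbil (fun v w => ∑ i, b.coord i (curvature Γ' (τ z) (b i) v w))]
    · ext i j
      exact h.sum_coord_curvature_comp b h' hτ hm hB hz _ _
    · intro u v w
      rw [← Finset.sum_add_distrib]
      refine Finset.sum_congr rfl fun i _ => ?_
      simp only [curvature, map_add, _root_.add_apply, map_sub]
      ring
    · intro a u w
      rw [Finset.mul_sum]
      refine Finset.sum_congr rfl fun i _ => ?_
      simp only [curvature, map_add, map_smul, _root_.smul_apply, map_sub, smul_eq_mul]
      ring
    · intro u v w
      rw [← Finset.sum_add_distrib]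
      refine Finset.sum_congr rfl fun i _ => ?_
      simp only [curvature, map_add, _root_.add_apply, map_sub]
      ring
    · intro a u w
      rw [Finset.mul_sum]
      refine Finset.sum_congr rfl fun i _ => ?_
      simp only [curvature, map_add, map_smul, _root_.smul_apply, map_sub, smul_eq_mul]
      ring
  have htr : ∀ A K : Matrix ι ι ℝ, ∑ j, ∑ k, A j k * K j k = (A * K.transpose).trace := by
    intro A K
    simp [Matrix.trace, Matrix.mul_apply]
  have e1 : ∑ j, ∑ k, (Matrix.of fun i j => B z (b i) (b j))⁻¹ j k
        * ∑ i, b.coord i (curvature Γ z (b i) (b j) (b k))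
      = ((P.transpose * A' * P)⁻¹ * (P.transpose * K' * P).transpose).trace := by
    rw [← hA, ← hK, ← htr]
    rfl
  have e2 : ∑ j, ∑ k, A'⁻¹ j k * ∑ i, b.coord i (curvature Γ' (τ z) (b i) (b j) (b k))
      = (A'⁻¹ * K'.transpose).trace := by
    rw [← htr]
    rfl
  rw [e1, e2]
  have hPt : IsUnit P.transpose.det := by rwa [Matrix.det_transpose]
  rw [Matrix.mul_inv_rev, Matrix.mul_inv_rev, Matrix.transpose_mul, Matrix.transpose_mul,
    Matrix.transpose_transpose]
  have e3 : P⁻¹ * (A'⁻¹ * P.transpose⁻¹) * (P.transpose * (K'.transpose * P))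
      = P⁻¹ * (A'⁻¹ * K'.transpose * P) := by
    simp only [Matrix.mul_assoc]
    rw [← Matrix.mul_assoc P.transpose⁻¹, Matrix.nonsing_inv_mul _ hPt, Matrix.one_mul]
  rw [e3, Matrix.trace_mul_comm, Matrix.mul_assoc, Matrix.mul_nonsing_inv _ hPu, Matrix.mul_one]

end Connection

end NodalYamabe

end

/-! ### The Levi-Civita connection and its curvature in components -/

noncomputable section

namespace NodalYamabe

section Components

set_option synthInstance.maxHeartbeats 400000
set_option maxHeartbeats 1000000

variable {E : Type*} [NormedAddCommGroup E] [NormedSpace ℝ E] {ι : Type*} [Fintype ι]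
  [DecidableEq ι] {c : ι → E →L[ℝ] ℝ} {b : Module.Basis ι ℝ E}

/-- The bilinear form with components `A` with respect to the coordinate functionals `c`. -/
def formOf (c : ι → E →L[ℝ] ℝ) (A : Matrix ι ι ℝ) : E →L[ℝ] E →L[ℝ] ℝ :=
  ∑ i, ∑ j, A i j • (c i).smulRight (c j)

/-- The vector-valued bilinear form with components `Γ k i j`. -/
def connOf (c : ι → E →L[ℝ] ℝ) (b : Module.Basis ι ℝ E) (Γ : ι → ι → ι → ℝ) :
    E →L[ℝ] E →L[ℝ] E :=
  ∑ i, ∑ j, ∑ k, Γ k i j • (c i).smulRight ((c j).smulRight (b k))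

theorem formOf_apply (A : Matrix ι ι ℝ) (u v : E) :
    formOf c A u v = ∑ i, ∑ j, A i j * (c i u * c j v) := by
  simp [formOf]

theorem formOf_basis (hc : ∀ i j, c i (b j) = if i = j then 1 else 0) (A : Matrix ι ι ℝ) (i j : ι) :
    formOf c A (b i) (b j) = A i j := by
  simp [formOf_apply, hc]

theorem connOf_basis (hc : ∀ i j, c i (b j) = if i = j then 1 else 0) (Γ : ι → ι → ι → ℝ)
    (i j k : ι) : c k (connOf c b Γ (b i) (b j)) = Γ k i j := by
  simp [connOf, hc]

theorem fderiv_apply_apply {F F' F'' : Type*} [NormedAddCommGroup F] [NormedSpace ℝ F]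
    [NormedAddCommGroup F'] [NormedSpace ℝ F'] [NormedAddCommGroup F''] [NormedSpace ℝ F'']
    {f : E → F →L[ℝ] F' →L[ℝ] F''} {z : E} (hf : DifferentiableAt ℝ f z) (u : E) (v : F) (w : F') :
    fderiv ℝ (fun y => f y v w) z u = fderiv ℝ f z u v w := by
  have h := (hf.hasFDerivAt.clm_apply (hasFDerivAt_const v z)).clm_apply (hasFDerivAt_const w z)
  rw [h.fderiv]
  simp

theorem _root_.ContDiffOn.smul_fixed {F : Type*} [NormedAddCommGroup F] [NormedSpace ℝ F]
    {f : E → ℝ} {U : Set E} (hf : ContDiffOn ℝ ∞ f U) (x : F) :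
    ContDiffOn ℝ ∞ (fun z => f z • x) U :=
  hf.smul contDiffOn_const

theorem _root_.ContinuousLinearMap.fderiv_comp_apply {F F' : Type*} [NormedAddCommGroup F]
    [NormedSpace ℝ F] [NormedAddCommGroup F'] [NormedSpace ℝ F'] (L : F →L[ℝ] F') {f : E → F}
    {z : E} (hf : DifferentiableAt ℝ f z) (u : E) :
    L (fderiv ℝ f z u) = fderiv ℝ (fun y => L (f y)) z u := by
  have h : HasFDerivAt (fun y => L (f y)) (L.comp (fderiv ℝ f z)) z :=
    L.hasFDerivAt.comp z hf.hasFDerivAt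
  rw [h.fderiv]
  rfl

theorem contDiffOn_connOf {Γ : ι → ι → ι → E → ℝ} {U : Set E}
    (hΓ : ∀ k i j, ContDiffOn ℝ ∞ (Γ k i j) U) :
    ContDiffOn ℝ ∞ (fun z => connOf c b fun k i j => Γ k i j z) U :=
  ContDiffOn.sum fun i _ => ContDiffOn.sum fun j _ => ContDiffOn.sum fun k _ =>
    (hΓ k i j).smul_fixed _

/-- The Christoffel formula is the Koszul formula on basis vectors, with the metric matrix inverted.
Both sides of the Koszul formula are trilinear, so basis vectors suffice. -/
theorem isLeviCivita_of_components (hc : ∀ i j, c i (b j) = if i = j then 1 else 0)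
    {G : E → Matrix ι ι ℝ} {Γ : ι → ι → ι → E → ℝ} {U : Set E} (hU : IsOpen U)
    (hG : ∀ i j, ContDiffOn ℝ ∞ (fun z => G z i j) U)
    (hΓ : ∀ k i j, ContDiffOn ℝ ∞ (Γ k i j) U) (hpos : ∀ z ∈ U, (G z).PosDef)
    (hΓG : ∀ k i j z, Γ k i j z = (1 / 2) * ∑ l, (G z)⁻¹ k l *
      (fderiv ℝ (fun z => G z j l) z (b i) + fderiv ℝ (fun z => G z i l) z (b j)
        - fderiv ℝ (fun z => G z i j) z (b l))) :
    IsLeviCivita (fun z => formOf c (G z)) (fun z => connOf c b fun k i j => Γ k i j z) U := by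
  have hcb : ∀ v : E, v = ∑ i, c i v • b i := by
    intro v
    have h2 : ∀ i, c i v = b.repr v i := fun i => by
      conv_lhs => rw [← b.sum_repr v, map_sum]
      simp [hc]
    simp only [h2, b.sum_repr]
  have hcont : ContDiffOn ℝ ∞ (fun z => formOf c (G z)) U :=
    ContDiffOn.sum fun i _ => ContDiffOn.sum fun j _ => (hG i j).smul_fixed _
  have hsym : ∀ z ∈ U, ∀ a b, G z a b = G z b a := fun z hz a b => by
    simpa using (hpos z hz).isHermitian.apply b a
  refine ⟨hU, hcont, contDiffOn_connOf hΓ, ?_, ?_, ?_⟩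
  · intro z hz u v
    rw [formOf_apply, formOf_apply, Finset.sum_comm]
    refine Finset.sum_congr rfl fun i _ => Finset.sum_congr rfl fun j _ => ?_
    rw [hsym z hz, mul_comm (c j u)]
  · intro z hz u hu
    have hu' : (fun i => c i u) ≠ 0 := fun h0 => hu <| by
      rw [hcb u]
      exact Finset.sum_eq_zero fun i _ => by rw [show c i u = 0 from congrFun h0 i, zero_smul]
    refine ((hpos z hz).dotProduct_mulVec_pos hu').trans_eq ?_
    rw [formOf_apply]
    simp only [dotProduct, Matrix.mulVec, Finset.mul_sum, star_trivial]
    exact Finset.sum_congr rfl fun i _ => Finset.sum_congr rfl fun j _ => by ring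
  · intro z hz u v w
    set D := fderiv ℝ (fun z => formOf c (G z)) z with hD
    have hpd : ∀ i j l, D (b i) (b j) (b l) = fderiv ℝ (fun z => G z j l) z (b i) := by
      intro i j l
      rw [hD, ← fderiv_apply_apply (hcont.differentiableAt_of_isOpen hU hz)]
      simp only [formOf_basis hc]
    -- The defect in the Koszul formula, a trilinear expression that vanishes on the basis.
    let T : E → E → E → ℝ := fun u v w =>
      2 * formOf c (G z) (connOf c b (fun k i j => Γ k i j z) u v) w
        - (D u v w + D v u w - D w u v)
    have hbasis : ∀ i j m, T (b i) (b j) (b m) = 0 := by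
      intro i j m
      simp only [T, hpd]
      set K : ι → ℝ := fun l => fderiv ℝ (fun z => G z j l) z (b i)
        + fderiv ℝ (fun z => G z i l) z (b j) - fderiv ℝ (fun z => G z i j) z (b l) with hK
      have hΓ' : ∀ k, Γ k i j z = 1 / 2 * ((G z)⁻¹.mulVec K) k := fun k => hΓG k i j z
      have h1 : (G z).mulVec ((G z)⁻¹.mulVec K) m = K m := by
        rw [Matrix.mulVec_mulVec, Matrix.mul_nonsing_inv _ (hpos z hz).det_pos.ne'.isUnit,
          Matrix.one_mulVec]
      have h2 : formOf c (G z) (connOf c b (fun k i j => Γ k i j z) (b i) (b j)) (b m)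
          = 1 / 2 * (G z).mulVec ((G z)⁻¹.mulVec K) m := by
        rw [formOf_apply]
        simp only [connOf_basis hc, hΓ']
        conv_rhs => rw [Matrix.mulVec, dotProduct, Finset.mul_sum]
        refine Finset.sum_congr rfl fun k _ => ?_
        rw [Finset.sum_eq_single m]
        · rw [hsym z hz m k, hc, if_pos rfl]
          ring
        · intro l _ hl
          rw [hc, if_neg hl]
          ring
        · simp
      rw [h2, h1, hK]
      ring
    have h3 : T u v w = ∑ i, ∑ j, ∑ k, (c i u * c j v * c k w) * T (b i) (b j) (b k) := by
      have a1 : ∀ u v w, T u v w = ∑ i, c i u * T (b i) v w := by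
        intro u v w
        conv_lhs => rw [hcb u]
        simp only [T, map_sum, map_smul, _root_.sum_apply, _root_.smul_apply, smul_eq_mul,
          Finset.mul_sum, ← Finset.sum_add_distrib, ← Finset.sum_sub_distrib]
        exact Finset.sum_congr rfl fun i _ => by ring
      have a2 : ∀ u v w, T u v w = ∑ i, c i v * T u (b i) w := by
        intro u v w
        conv_lhs => rw [hcb v]
        simp only [T, map_sum, map_smul, _root_.sum_apply, _root_.smul_apply, smul_eq_mul,
          Finset.mul_sum, ← Finset.sum_add_distrib, ← Finset.sum_sub_distrib]
        exact Finset.sum_congr rfl fun i _ => by ring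
      have a3 : ∀ u v w, T u v w = ∑ i, c i w * T u v (b i) := by
        intro u v w
        conv_lhs => rw [hcb w]
        simp only [T, map_sum, map_smul, _root_.sum_apply, _root_.smul_apply, smul_eq_mul,
          Finset.mul_sum, ← Finset.sum_add_distrib, ← Finset.sum_sub_distrib]
        exact Finset.sum_congr rfl fun i _ => by ring
      rw [a1]
      refine Finset.sum_congr rfl fun i _ => ?_
      rw [a2, Finset.mul_sum]
      refine Finset.sum_congr rfl fun j _ => ?_
      rw [a3, Finset.mul_sum, Finset.mul_sum]
      exact Finset.sum_congr rfl fun k _ => by ring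
    have h4 : T u v w = 0 := by
      rw [h3]
      exact Finset.sum_eq_zero fun i _ => Finset.sum_eq_zero fun j _ => Finset.sum_eq_zero
        fun k _ => by rw [hbasis, mul_zero]
    exact sub_eq_zero.1 h4

/-- The basis vectors do not depend on the point, so derivatives fall only on the components of the
connection, and the contraction becomes the coordinate formula in `ricci`. -/
theorem sum_coord_curvature_connOf (hc : ∀ i j, c i (b j) = if i = j then 1 else 0)
    {Γ : ι → ι → ι → E → ℝ} {U : Set E} (hU : IsOpen U) (hΓ : ∀ k i j, ContDiffOn ℝ ∞ (Γ k i j) U)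
    {z : E} (hz : z ∈ U) (j k : ι) :
    ∑ i, c i (curvature (fun z => connOf c b fun k i j => Γ k i j z) z (b i) (b j) (b k))
      = (∑ i, (fderiv ℝ (Γ i j k) z (b i) - fderiv ℝ (Γ i i k) z (b j)))
        + ∑ i, ∑ p, (Γ i i p z * Γ p j k z - Γ i j p z * Γ p i k z) := by
  have hd : DifferentiableAt ℝ (fun z => connOf c b fun k i j => Γ k i j z) z :=
    (contDiffOn_connOf hΓ).differentiableAt_of_isOpen hU hz
  have hpd : ∀ l k i j, c k (fderiv ℝ (fun z => connOf c b fun k i j => Γ k i j z) z (b l) (b i)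
      (b j)) = fderiv ℝ (Γ k i j) z (b l) := by
    intro l k i j
    have hd' : DifferentiableAt ℝ (fun z => connOf c b (fun k i j => Γ k i j z) (b i) (b j)) z :=
      (hd.clm_apply (differentiableAt_const _)).clm_apply (differentiableAt_const _)
    rw [← fderiv_apply_apply hd, (c k).fderiv_comp_apply hd']
    simp only [connOf_basis hc]
  have hex : ∀ v w, connOf c b (fun k i j => Γ k i j z) v w
      = ∑ p, c p w • connOf c b (fun k i j => Γ k i j z) v (b p) := by
    intro v w
    conv_lhs => rw [show w = ∑ p, c p w • b p from by
      have h2 : ∀ i, c i w = b.repr w i := fun i => by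
        conv_lhs => rw [← b.sum_repr w, map_sum]
        simp [hc]
      simp only [h2, b.sum_repr]]
    simp only [map_sum, map_smul]
  rw [← Finset.sum_add_distrib]
  refine Finset.sum_congr rfl fun i _ => ?_
  simp only [curvature, map_add, map_sub, hpd]
  rw [hex (b i) (connOf c b _ _ _), hex (b j) (connOf c b _ _ _)]
  simp only [map_sum, map_smul, connOf_basis hc, smul_eq_mul]
  rw [Finset.sum_sub_distrib, add_sub_assoc]
  congr 2 <;> exact Finset.sum_congr rfl fun p _ => mul_comm _ _

end Components

section Curvature

variable {n : ℕ}

local notation "𝔼" => EuclideanSpace ℝ (Fin n)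

/-- The components of a Riemannian metric on an open set. -/
structure IsMetricOn (G : 𝔼 → Matrix (Fin n) (Fin n) ℝ) (U : Set 𝔼) : Prop where
  isOpen : IsOpen U
  contDiffOn : ∀ i j, ContDiffOn ℝ ∞ (fun z => G z i j) U
  posDef : ∀ z ∈ U, (G z).PosDef

theorem contDiffOn_det {ι : Type*} [Fintype ι] [DecidableEq ι] {A : 𝔼 → Matrix ι ι ℝ} {U : Set 𝔼}
    (h : ∀ i j, ContDiffOn ℝ ∞ (fun z => A z i j) U) : ContDiffOn ℝ ∞ (fun z => (A z).det) U := by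
  simp only [Matrix.det_apply']
  exact ContDiffOn.sum fun σ _ => contDiffOn_const.mul (contDiffOn_prod fun i _ => h _ _)

/-- Cramer's rule writes an entry of the inverse as a quotient of determinants, with nonzero
denominator by positive definiteness. -/
theorem IsMetricOn.contDiffOn_inv {G : 𝔼 → Matrix (Fin n) (Fin n) ℝ} {U : Set 𝔼}
    (h : IsMetricOn G U) (k l : Fin n) : ContDiffOn ℝ ∞ (fun z => (G z)⁻¹ k l) U := by
  have e : ∀ z, (G z)⁻¹ k l = ((G z).det)⁻¹ * ((G z).updateRow l (Pi.single k 1)).det := fun z => by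
    rw [Matrix.inv_def, Matrix.smul_apply, Matrix.adjugate_apply, Ring.inverse_eq_inv', smul_eq_mul]
  simp only [e]
  refine ((contDiffOn_det h.contDiffOn).inv fun z hz => (h.posDef z hz).det_pos.ne').mul
    (contDiffOn_det fun i j => ?_)
  by_cases hi : i = l
  · subst hi
    simp only [Matrix.updateRow_self]
    exact contDiffOn_const
  · simp only [Matrix.updateRow_ne hi]
    exact h.contDiffOn i j

theorem contDiffOn_partialD {f : 𝔼 → ℝ} {U : Set 𝔼} (hU : IsOpen U) (h : ContDiffOn ℝ ∞ f U)
    (i : Fin n) : ContDiffOn ℝ ∞ (partialD i f) U :=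
  (h.fderiv_of_isOpen hU (m := ∞) (by simp)).clm_apply contDiffOn_const

theorem IsMetricOn.contDiffOn_christoffel {G : 𝔼 → Matrix (Fin n) (Fin n) ℝ} {U : Set 𝔼}
    (h : IsMetricOn G U) (k i j : Fin n) : ContDiffOn ℝ ∞ (christoffel G k i j) U :=
  contDiffOn_const.mul (ContDiffOn.sum fun l _ => (h.contDiffOn_inv k l).mul
    (((contDiffOn_partialD h.isOpen (h.contDiffOn j l) i).add
      (contDiffOn_partialD h.isOpen (h.contDiffOn i l) j)).sub
      (contDiffOn_partialD h.isOpen (h.contDiffOn i j) l)))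

theorem IsMetricOn.continuousOn_coordScalarCurvature {G : 𝔼 → Matrix (Fin n) (Fin n) ℝ}
    {U : Set 𝔼} (h : IsMetricOn G U) : ContinuousOn (coordScalarCurvature G) U := by
  have hc : ∀ k i j, ContinuousOn (christoffel G k i j) U := fun k i j =>
    (h.contDiffOn_christoffel k i j).continuousOn
  have hd : ∀ l k i j, ContinuousOn (partialD l (christoffel G k i j)) U := fun l k i j =>
    (contDiffOn_partialD h.isOpen (h.contDiffOn_christoffel k i j) l).continuousOn
  refine continuousOn_finsetSum _ fun j _ => continuousOn_finsetSum _ fun k _ =>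
    (h.contDiffOn_inv j k).continuousOn.mul (ContinuousOn.add ?_ ?_)
  · exact continuousOn_finsetSum _ fun i _ => (hd _ _ _ _).sub (hd _ _ _ _)
  · exact continuousOn_finsetSum _ fun i _ => continuousOn_finsetSum _ fun p _ =>
      ((hc _ _ _).mul (hc _ _ _)).sub ((hc _ _ _).mul (hc _ _ _))

/-- The formulas in `christoffel` and `ricci` are matched with the coordinate-free connection and
curvature, for which `scalar_comp` gives the invariance. -/
theorem IsMetricOn.coordScalarCurvature_comp {G G' : 𝔼 → Matrix (Fin n) (Fin n) ℝ} {U U' : Set 𝔼}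
    (h : IsMetricOn G U) (h' : IsMetricOn G' U') {τ : 𝔼 → 𝔼} (hτ : ContDiffOn ℝ ∞ τ U)
    (hm : Set.MapsTo τ U U')
    (hG : ∀ z ∈ U, ∀ i j, G z i j = ∑ k, ∑ l, G' (τ z) k l *
      (fderiv ℝ τ z (EuclideanSpace.single i 1) k * fderiv ℝ τ z (EuclideanSpace.single j 1) l))
    {z : 𝔼} (hz : z ∈ U) : coordScalarCurvature G z = coordScalarCurvature G' (τ z) := by
  let b : Module.Basis (Fin n) ℝ 𝔼 := (EuclideanSpace.basisFun (Fin n) ℝ).toBasis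
  let c : Fin n → 𝔼 →L[ℝ] ℝ := fun i => EuclideanSpace.proj i
  have hb : ∀ i, b i = EuclideanSpace.single i 1 := fun i => by simp [b]
  have hc : ∀ i j, c i (b j) = if i = j then 1 else 0 := fun i j => by simp [c, hb]
  have hcoord : ∀ i v, c i v = b.coord i v := fun i v => by simp [c, b]
  have hL : ∀ {G : 𝔼 → Matrix (Fin n) (Fin n) ℝ} {U : Set 𝔼}, IsMetricOn G U →
      IsLeviCivita (fun z => formOf c (G z))
        (fun z => connOf c b fun k i j => christoffel G k i j z) U := by
    intro G U h
    refine isLeviCivita_of_components hc h.isOpen h.contDiffOn h.contDiffOn_christoffel h.posDef ?_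
    intro k i j z
    simp only [hb]
    rfl
  have hS : ∀ {G : 𝔼 → Matrix (Fin n) (Fin n) ℝ} {U : Set 𝔼}, IsMetricOn G U → ∀ {z : 𝔼}, z ∈ U →
      coordScalarCurvature G z = ∑ j, ∑ k, (Matrix.of fun i j => formOf c (G z) (b i) (b j))⁻¹ j k
        * ∑ i, b.coord i (curvature (fun z => connOf c b fun k i j => christoffel G k i j z) z
          (b i) (b j) (b k)) := by
    intro G U h z hz
    simp only [← hcoord]
    simp only [sum_coord_curvature_connOf hc h.isOpen h.contDiffOn_christoffel hz, formOf_basis hc]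
    simp only [hb]
    rfl
  rw [hS h hz, hS h' (hm hz)]
  refine (hL h).scalar_comp b (hL h') hτ hm ?_ hz
  intro z hz u v
  have hcb : ∀ v : 𝔼, v = ∑ i, c i v • b i := fun v => by simp only [hcoord]; exact (b.sum_repr v).symm
  have e : ∀ i j, formOf c (G z) (b i) (b j)
      = formOf c (G' (τ z)) (fderiv ℝ τ z (b i)) (fderiv ℝ τ z (b j)) := by
    intro i j
    rw [formOf_basis hc, hG z hz, formOf_apply]
    simp only [hb]
    rfl
  rw [hcb u, hcb v]
  simp only [map_sum, map_smul, _root_.sum_apply, _root_.smul_apply, e]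

end Curvature

end NodalYamabe

end

noncomputable section

namespace NodalYamabe

/-! ### The metric in charts -/

section Charts

variable {n : ℕ} {M : Type*} [TopologicalSpace M] [ChartedSpace (EuclideanSpace ℝ (Fin n)) M]
  [IsManifold (𝓡 n) ∞ M]

local notation "𝔼" => EuclideanSpace ℝ (Fin n)

/-- The coordinate vector field with constant components `v`. -/
def frame (c : M) (y : 𝔼) : 𝔼 →L[ℝ] TangentSpace (𝓡 n) ((extChartAt (𝓡 n) c).symm y) :=
  mfderiv (𝓡 n) (𝓡 n) (extChartAt (𝓡 n) c).symm y

theorem gram_form (g : RMetric n M) (c : M) (y u v : 𝔼) :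
    ∑ i, ∑ j, gram g c y i j * (u i * v j)
      = g.inner ((extChartAt (𝓡 n) c).symm y) (frame c y u) (frame c y v) := by
  have hu : ∀ u : 𝔼, u = ∑ i, u i • EuclideanSpace.single i (1 : ℝ) := fun u => by
    conv_lhs => rw [← (EuclideanSpace.basisFun (Fin n) ℝ).sum_repr u]
    simp
  conv_rhs => rw [hu u, hu v]
  simp only [map_sum, map_smul, _root_.sum_apply, _root_.smul_apply, smul_eq_mul, Finset.mul_sum]
  rw [Finset.sum_comm]
  refine Finset.sum_congr rfl fun i _ => Finset.sum_congr rfl fun j _ => ?_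
  rw [show gram g c y j i = g.inner ((extChartAt (𝓡 n) c).symm y)
    (frame c y (EuclideanSpace.single j 1)) (frame c y (EuclideanSpace.single i 1)) from rfl]
  ring

/-- All tangent spaces are definitionally the model space, so vectors can be carried along an
equality of base points without a cast. -/
theorem inner_congr (g : RMetric n M) {x x' : M} (h : x = x') (v w : 𝔼) :
    g.inner x v w = g.inner x' v w := by
  subst h
  rfl

theorem mdifferentiableAt_extChartAt_symm' {c : M} {y : 𝔼} (hy : y ∈ (extChartAt (𝓡 n) c).target) :
    MDifferentiableAt (𝓡 n) (𝓡 n) (extChartAt (𝓡 n) c).symm y :=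
  ((contMDiffOn_extChartAt_symm (n := ∞) c).mdifferentiableOn (by simp)).mdifferentiableAt
    ((isOpen_extChartAt_target c).mem_nhds hy)

theorem mdifferentiableAt_extChartAt' {c x : M} (hx : x ∈ (extChartAt (𝓡 n) c).source) :
    MDifferentiableAt (𝓡 n) (𝓡 n) (extChartAt (𝓡 n) c) x :=
  mdifferentiableAt_extChartAt (by rwa [extChartAt_source] at hx)

theorem mfderiv_frame {c : M} {y : 𝔼} (hy : y ∈ (extChartAt (𝓡 n) c).target) (v : 𝔼) :
    mfderiv (𝓡 n) (𝓡 n) (extChartAt (𝓡 n) c) ((extChartAt (𝓡 n) c).symm y) (frame c y v) = v := by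
  have h1 := mfderiv_comp y
    (mdifferentiableAt_extChartAt' ((extChartAt (𝓡 n) c).map_target hy))
    (mdifferentiableAt_extChartAt_symm' hy)
  have h2 : (extChartAt (𝓡 n) c ∘ (extChartAt (𝓡 n) c).symm) =ᶠ[𝓝 y] id := by
    filter_upwards [(isOpen_extChartAt_target c).mem_nhds hy] with z hz
    exact (extChartAt (𝓡 n) c).right_inv hz
  rw [h2.mfderiv_eq, mfderiv_id] at h1
  exact (DFunLike.congr_fun h1 v).symm

theorem frame_mfderiv {c x : M} (hx : x ∈ (extChartAt (𝓡 n) c).source) (v : TangentSpace (𝓡 n) x) :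
    (frame c (extChartAt (𝓡 n) c x) (mfderiv (𝓡 n) (𝓡 n) (extChartAt (𝓡 n) c) x v) : 𝔼) = v := by
  have h1 := mfderiv_comp x
    (mdifferentiableAt_extChartAt_symm' ((extChartAt (𝓡 n) c).map_source hx))
    (mdifferentiableAt_extChartAt' hx)
  have h2 : ((extChartAt (𝓡 n) c).symm ∘ extChartAt (𝓡 n) c) =ᶠ[𝓝 x] id := by
    filter_upwards [(isOpen_extChartAt_source (I := 𝓡 n) c).mem_nhds hx] with z hz
    exact (extChartAt (𝓡 n) c).left_inv hz
  rw [h2.mfderiv_eq, mfderiv_id] at h1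
  exact (DFunLike.congr_fun h1 v).symm

/-- The frame is the tangent map of the inverse chart applied to a constant vector field, and
tangent maps of smooth maps are smooth. -/
theorem contMDiffOn_frame (c : M) (v : 𝔼) :
    ContMDiffOn (𝓡 n) (𝓡 n).tangent ∞ (fun y => (TotalSpace.mk' 𝔼 ((extChartAt (𝓡 n) c).symm y)
      (frame c y v) : TangentBundle (𝓡 n) M)) (extChartAt (𝓡 n) c).target := by
  have ho := isOpen_extChartAt_target (I := 𝓡 n) c
  have h1 : ContMDiffOn (𝓡 n).tangent (𝓡 n).tangent ∞
      (tangentMapWithin (𝓡 n) (𝓡 n) (extChartAt (𝓡 n) c).symm (extChartAt (𝓡 n) c).target)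
      (TotalSpace.proj ⁻¹' (extChartAt (𝓡 n) c).target) :=
    (contMDiffOn_extChartAt_symm (n := ∞) c).contMDiffOn_tangentMapWithin (by simp)
      ho.uniqueMDiffOn
  have h2 : ContMDiff (𝓡 n) (𝓡 n).tangent ∞
      (fun y : 𝔼 => (TotalSpace.mk' 𝔼 y v : TangentBundle (𝓡 n) 𝔼)) :=
    contMDiff_vectorSpace_iff_contDiff.2 contDiff_const
  refine (h1.comp h2.contMDiffOn (s := (extChartAt (𝓡 n) c).target) fun y hy => hy).congr ?_
  intro y hy
  simp only [Function.comp, tangentMapWithin]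
  rw [mfderivWithin_of_isOpen ho hy]
  rfl

theorem contDiffOn_gram (g : RMetric n M) (c : M) (i j : Fin n) :
    ContDiffOn ℝ ∞ (fun y => gram g c y i j) (extChartAt (𝓡 n) c).target := by
  rw [← contMDiffOn_iff_contDiffOn]
  have h1 := g.contMDiff.comp_contMDiffOn (contMDiffOn_extChartAt_symm (n := ∞) c)
  have h2 := ContMDiffOn.clm_bundle_apply₂ (F₁ := 𝔼) (F₂ := 𝔼) (F₃ := ℝ)
    (E₁ := fun x : M => TangentSpace (𝓡 n) x) (E₂ := fun x : M => TangentSpace (𝓡 n) x)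
    (E₃ := Trivial M ℝ) (b := (extChartAt (𝓡 n) c).symm)
    (ψ := fun y => g.inner ((extChartAt (𝓡 n) c).symm y))
    h1 (contMDiffOn_frame c (EuclideanSpace.single i 1))
    (contMDiffOn_frame c (EuclideanSpace.single j 1))
  intro y hy
  exact ((contMDiffWithinAt_totalSpace.1 (h2 y hy))).2

theorem posDef_gram (g : RMetric n M) {c : M} {y : 𝔼} (hy : y ∈ (extChartAt (𝓡 n) c).target) :
    (gram g c y).PosDef := by
  refine Matrix.PosDef.of_dotProduct_mulVec_pos ?_ ?_
  · ext i j
    exact g.symm _ _ _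
  · intro x hx
    have h := gram_form g c y (WithLp.toLp 2 x) (WithLp.toLp 2 x)
    have h0 : frame c y (WithLp.toLp 2 x) ≠ 0 := by
      intro h0
      have := mfderiv_frame hy (WithLp.toLp 2 x)
      rw [h0, map_zero] at this
      exact hx (congrArg WithLp.ofLp this.symm)
    have hp := g.pos _ _ h0
    rw [← h] at hp
    refine hp.trans_eq ?_
    simp only [dotProduct, Matrix.mulVec, Finset.mul_sum, star_trivial]
    exact Finset.sum_congr rfl fun i _ => Finset.sum_congr rfl fun j _ => by ring

theorem isMetricOn_gram (g : RMetric n M) (c : M) :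
    IsMetricOn (gram g c) (extChartAt (𝓡 n) c).target :=
  ⟨isOpen_extChartAt_target c, contDiffOn_gram g c, fun _ => posDef_gram g⟩

/-- The change of coordinates from the chart at `c` to the chart at `d`. -/
def transition (c d : M) (y : 𝔼) : 𝔼 := extChartAt (𝓡 n) d ((extChartAt (𝓡 n) c).symm y)

/-- The domain of `transition c d`. -/
def overlap (c d : M) : Set 𝔼 :=
  (extChartAt (𝓡 n) c).target ∩ (extChartAt (𝓡 n) c).symm ⁻¹' (extChartAt (𝓡 n) d).source

theorem isOpen_overlap (c d : M) : IsOpen (overlap (n := n) c d) :=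
  (continuousOn_extChartAt_symm c).isOpen_inter_preimage (isOpen_extChartAt_target c)
    (isOpen_extChartAt_source d)

theorem contDiffOn_transition (c d : M) :
    ContDiffOn ℝ ∞ (transition (n := n) c d) (overlap c d) := by
  rw [← contMDiffOn_iff_contDiffOn]
  refine ContMDiffOn.comp (t := (extChartAt (𝓡 n) d).source) (I' := 𝓡 n) ?_
    ((contMDiffOn_extChartAt_symm c).mono Set.inter_subset_left) (fun y hy => hy.2)
  rw [extChartAt_source]
  exact contMDiffOn_extChartAt

theorem transition_mem {c d : M} {y : 𝔼} (hy : y ∈ overlap c d) :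
    transition c d y ∈ (extChartAt (𝓡 n) d).target :=
  (extChartAt (𝓡 n) d).map_source hy.2

theorem symm_transition {c d : M} {y : 𝔼} (hy : y ∈ overlap c d) :
    (extChartAt (𝓡 n) d).symm (transition c d y) = (extChartAt (𝓡 n) c).symm y :=
  (extChartAt (𝓡 n) d).left_inv hy.2

theorem frame_transition {c d : M} {y : 𝔼} (hy : y ∈ overlap c d) (v : 𝔼) :
    (frame d (transition c d y) (fderiv ℝ (transition c d) y v) : 𝔼) = frame c y v := by
  have ht : MDifferentiableAt (𝓡 n) (𝓡 n) (transition c d) y :=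
    ((contDiffOn_transition c d).differentiableAt_of_isOpen (isOpen_overlap c d)
      hy).mdifferentiableAt
  have h1 := mfderiv_comp y (mdifferentiableAt_extChartAt_symm' (transition_mem hy)) ht
  have h2 : ((extChartAt (𝓡 n) d).symm ∘ transition c d) =ᶠ[𝓝 y] (extChartAt (𝓡 n) c).symm := by
    filter_upwards [(isOpen_overlap c d).mem_nhds hy] with z hz using symm_transition hz
  rw [h2.mfderiv_eq, mfderiv_eq_fderiv] at h1
  exact (DFunLike.congr_fun h1 v).symm

theorem gram_transition (g : RMetric n M) {c d : M} {y : 𝔼} (hy : y ∈ overlap c d) (i j : Fin n) :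
    gram g c y i j = ∑ k, ∑ l, gram g d (transition c d y) k l *
      (fderiv ℝ (transition c d) y (EuclideanSpace.single i 1) k
        * fderiv ℝ (transition c d) y (EuclideanSpace.single j 1) l) := by
  rw [gram_form, show gram g c y i j = g.inner ((extChartAt (𝓡 n) c).symm y)
    (frame c y (EuclideanSpace.single i 1)) (frame c y (EuclideanSpace.single j 1)) from rfl]
  erw [← frame_transition hy, ← frame_transition hy]
  exact inner_congr g (symm_transition hy).symm _ _

theorem coordScalarCurvature_transition (g : RMetric n M) {c d : M} {y : 𝔼}
    (hy : y ∈ overlap c d) :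
    coordScalarCurvature (gram g c) y = coordScalarCurvature (gram g d) (transition c d y) := by
  have h := isMetricOn_gram g c
  exact IsMetricOn.coordScalarCurvature_comp (U := overlap c d)
    ⟨isOpen_overlap c d, fun i j => (h.contDiffOn i j).mono Set.inter_subset_left,
      fun z hz => h.posDef z hz.1⟩ (isMetricOn_gram g d) (contDiffOn_transition c d)
    (fun z hz => transition_mem hz) (fun z hz i j => gram_transition g hz i j) hy

/-- The definition changes chart with the point; this lets the curvature be read near a point in one
fixed chart, where it is continuous. -/
theorem scalarCurvature_eq (g : RMetric n M) {c x : M} (hx : x ∈ (extChartAt (𝓡 n) c).source) :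
    scalarCurvature g x = coordScalarCurvature (gram g c) (extChartAt (𝓡 n) c x) := by
  have hy : extChartAt (𝓡 n) x x ∈ overlap x c := by
    refine ⟨mem_extChartAt_target x, ?_⟩
    rw [Set.mem_preimage, extChartAt_to_inv]
    exact hx
  rw [scalarCurvature, coordScalarCurvature_transition g hy, transition, extChartAt_to_inv]

theorem continuous_scalarCurvature (g : RMetric n M) : Continuous (scalarCurvature g) := by
  rw [continuous_iff_continuousAt]
  intro x
  have hx := mem_extChartAt_source (I := 𝓡 n) x
  have h1 : ContinuousAt (fun z => coordScalarCurvature (gram g x) (extChartAt (𝓡 n) x z)) x :=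
    ContinuousAt.comp (g := coordScalarCurvature (gram g x))
      ((isMetricOn_gram g x).continuousOn_coordScalarCurvature.continuousAt
      ((isOpen_extChartAt_target x).mem_nhds (mem_extChartAt_target x))) (continuousAt_extChartAt x)
  refine h1.congr ?_
  filter_upwards [(isOpen_extChartAt_source (I := 𝓡 n) x).mem_nhds hx] with z hz
  exact (scalarCurvature_eq g hz).symm

end Charts

end NodalYamabe

end

noncomputable section

namespace NodalYamabe

/-! ### The volume measure in charts -/

theorem measurableSet_inter_preimage {α β : Type*} [TopologicalSpace α] [MeasurableSpace α]
    [OpensMeasurableSpace α] [TopologicalSpace β] [MeasurableSpace β] [BorelSpace β] {f : α → β}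
    {s : Set α} {t : Set β} (hf : ContinuousOn f s) (hs : IsOpen s) (ht : MeasurableSet t) :
    MeasurableSet (s ∩ f ⁻¹' t) := by
  have h1 : Measurable (s.domRestrict f) := (continuousOn_iff_continuous_domRestrict.1 hf).measurable
  have h2 := MeasurableSet.subtype_image hs.measurableSet (h1 ht)
  convert h2 using 1
  ext x
  simp [and_comm]

/-- A measurable choice of a member of a finite cover. -/
theorem exists_measurable_selection {α ι : Type*} [MeasurableSpace α] [Nonempty ι] (T : Finset ι)
    (U : ι → Set α) (hU : ∀ i, MeasurableSet (U i)) :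
    ∃ sel : α → ι, (∀ x ∈ ⋃ i ∈ T, U i, sel x ∈ T ∧ x ∈ U (sel x)) ∧
      ∀ i, MeasurableSet (sel ⁻¹' {i}) := by
  classical
  induction T using Finset.induction_on with
  | empty => exact ⟨fun _ => Classical.arbitrary ι, by simp, fun i => MeasurableSet.const _⟩
  | insert a T _ ih =>
    obtain ⟨sel, h1, h2⟩ := ih
    refine ⟨fun x => if x ∈ U a then a else sel x, fun x hx => ?_, fun i => ?_⟩
    · by_cases hxa : x ∈ U a
      · simp [hxa]
      · have hx' : x ∈ ⋃ i ∈ T, U i := by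
          simp only [Finset.mem_insert, Set.mem_iUnion, exists_prop] at hx ⊢
          obtain ⟨i, rfl | hi, hxi⟩ := hx
          · exact absurd hxi hxa
          · exact ⟨i, hi, hxi⟩
        simp only [hxa, if_false]
        exact ⟨Finset.mem_insert_of_mem (h1 x hx').1, (h1 x hx').2⟩
    · have : (fun x => if x ∈ U a then a else sel x) ⁻¹' {i}
          = (U a ∩ {_x | a = i}) ∪ ((U a)ᶜ ∩ sel ⁻¹' {i}) := by
        ext x
        by_cases hxa : x ∈ U a <;> simp [hxa]
      rw [this]
      exact ((hU a).inter (MeasurableSet.const _)).union ((hU a).compl.inter (h2 i))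

section Volume

variable {n : ℕ} {M : Type*} [TopologicalSpace M] [ChartedSpace (EuclideanSpace ℝ (Fin n)) M]
  [IsManifold (𝓡 n) ∞ M]

local notation "𝔼" => EuclideanSpace ℝ (Fin n)

/-- The density `√(det g_ij)`. -/
def density (g : RMetric n M) (c : M) (y : 𝔼) : ℝ := Real.sqrt (gram g c y).det

theorem continuousOn_density (g : RMetric n M) (c : M) :
    ContinuousOn (density g c) (extChartAt (𝓡 n) c).target :=
  (contDiffOn_det (contDiffOn_gram g c)).continuousOn.sqrt

theorem density_pos (g : RMetric n M) {c : M} {y : 𝔼} (hy : y ∈ (extChartAt (𝓡 n) c).target) :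
    0 < density g c y := Real.sqrt_pos.2 (posDef_gram g hy).det_pos

/-- The Gram matrix transforms by `Pᵀ G P`, so its determinant acquires the factor `(det P)²`, whose
square root is `|det P|`. -/
theorem density_transition (g : RMetric n M) {c d : M} {y : 𝔼} (hy : y ∈ overlap c d) :
    density g c y = |(fderiv ℝ (transition c d) y).det| * density g d (transition c d y) := by
  let b : Module.Basis (Fin n) ℝ 𝔼 := (EuclideanSpace.basisFun (Fin n) ℝ).toBasis
  set P := LinearMap.toMatrix b b (fderiv ℝ (transition c d) y).toLinearMap with hP
  have hPij : ∀ i j, P i j = fderiv ℝ (transition c d) y (EuclideanSpace.single j 1) i := fun i j => by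
    simp [hP, LinearMap.toMatrix_apply, b]
  have h1 : gram g c y = P.transpose * gram g d (transition c d y) * P := by
    ext i j
    rw [gram_transition g hy]
    simp only [Matrix.mul_apply, Matrix.transpose_apply, Finset.sum_mul, hPij]
    rw [Finset.sum_comm]
    exact Finset.sum_congr rfl fun k _ => Finset.sum_congr rfl fun l _ => by ring
  have h2 : (fderiv ℝ (transition c d) y).det = P.det := (LinearMap.det_toMatrix b _).symm
  rw [density, h1, Matrix.det_mul, Matrix.det_mul, Matrix.det_transpose, h2,
    show P.det * (gram g d (transition c d y)).det * P.det
      = P.det ^ 2 * (gram g d (transition c d y)).det by ring, Real.sqrt_mul (sq_nonneg _),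
    Real.sqrt_sq_eq_abs]
  rfl

variable [MeasurableSpace M] [BorelSpace M]

theorem aemeasurable_symm (c : M) : AEMeasurable (extChartAt (𝓡 n) c).symm
    (volume.restrict (extChartAt (𝓡 n) c).target) :=
  (continuousOn_extChartAt_symm c).aemeasurable (isOpen_extChartAt_target c).measurableSet

theorem aemeasurable_density (g : RMetric n M) (c : M) :
    AEMeasurable (fun y => ENNReal.ofReal (density g c y))
      (volume.restrict (extChartAt (𝓡 n) c).target) :=
  ((continuousOn_density g c).aemeasurable (isOpen_extChartAt_target c).measurableSet).ennreal_ofReal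

theorem chartVolume_apply (g : RMetric n M) (c : M) {s : Set M} (hs : MeasurableSet s) :
    chartVolume g c s = ∫⁻ y in (extChartAt (𝓡 n) c).target ∩ (extChartAt (𝓡 n) c).symm ⁻¹' s,
      ENNReal.ofReal (density g c y) := by
  have hm := measurableSet_inter_preimage (continuousOn_extChartAt_symm (I := 𝓡 n) c)
    (isOpen_extChartAt_target c) hs
  rw [chartVolume, Measure.map_apply_of_aemeasurable
    ((aemeasurable_symm c).mono_ac (withDensity_absolutelyContinuous _ _)) hs,
    withDensity_apply₀, Measure.restrict_restrict₀, Set.inter_comm]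
  · rfl
  · exact (aemeasurable_symm c).nullMeasurable hs
  · exact (aemeasurable_symm c).nullMeasurable hs

theorem chartVolume_compl_source (g : RMetric n M) (c : M) :
    chartVolume g c ((extChartAt (𝓡 n) c).source)ᶜ = 0 := by
  rw [chartVolume_apply g c (isOpen_extChartAt_source c).measurableSet.compl]
  have : (extChartAt (𝓡 n) c).target ∩ (extChartAt (𝓡 n) c).symm ⁻¹' ((extChartAt (𝓡 n) c).source)ᶜ
      = ∅ := by
    ext y
    simp only [Set.mem_inter_iff, Set.mem_preimage, Set.mem_compl_iff, Set.mem_empty_iff_false,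
      iff_false, not_and, not_not]
    exact fun hy => (extChartAt (𝓡 n) c).map_target hy
  rw [this]
  simp

/-- The change of variables formula for the transition map: its Jacobian is the factor by which the
two densities differ. -/
theorem chartVolume_eq_of_subset (g : RMetric n M) {c d : M} {s : Set M} (hs : MeasurableSet s)
    (hc : s ⊆ (extChartAt (𝓡 n) c).source) (hd : s ⊆ (extChartAt (𝓡 n) d).source) :
    chartVolume g c s = chartVolume g d s := by
  rw [chartVolume_apply g c hs, chartVolume_apply g d hs]
  set A := (extChartAt (𝓡 n) c).target ∩ (extChartAt (𝓡 n) c).symm ⁻¹' s with hA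
  have hm : MeasurableSet A := measurableSet_inter_preimage
    (continuousOn_extChartAt_symm (I := 𝓡 n) c) (isOpen_extChartAt_target c) hs
  have hAo : A ⊆ overlap c d := fun y hy => ⟨hy.1, hd hy.2⟩
  have himg : (extChartAt (𝓡 n) d).target ∩ (extChartAt (𝓡 n) d).symm ⁻¹' s
      = transition c d '' A := by
    ext z
    constructor
    · rintro ⟨hz, hzs⟩
      refine ⟨extChartAt (𝓡 n) c ((extChartAt (𝓡 n) d).symm z),
        ⟨(extChartAt (𝓡 n) c).map_source (hc hzs), ?_⟩, ?_⟩
      · rw [Set.mem_preimage, (extChartAt (𝓡 n) c).left_inv (hc hzs)]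
        exact hzs
      · rw [transition, (extChartAt (𝓡 n) c).left_inv (hc hzs), (extChartAt (𝓡 n) d).right_inv hz]
    · rintro ⟨y, hy, rfl⟩
      refine ⟨transition_mem (hAo hy), ?_⟩
      rw [Set.mem_preimage, symm_transition (hAo hy)]
      exact hy.2
  have hinj : Set.InjOn (transition c d) A := by
    intro y hy z hz h
    have := congrArg (extChartAt (𝓡 n) d).symm h
    rw [symm_transition (hAo hy), symm_transition (hAo hz)] at this
    exact (extChartAt (𝓡 n) c).symm.injOn hy.1 hz.1 this
  rw [himg, lintegral_image_eq_lintegral_abs_det_fderiv_mul volume hm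
    (fun y hy => ((contDiffOn_transition c d).differentiableAt_of_isOpen (isOpen_overlap c d)
      (hAo hy)).hasFDerivAt.hasFDerivWithinAt) hinj]
  refine setLIntegral_congr_fun hm fun y hy => ?_
  rw [density_transition g (hAo hy), ENNReal.ofReal_mul (abs_nonneg _)]

variable [CompactSpace M]

/-- The chart measures agree on overlaps, so they can be glued into a single measure along a
measurable partition subordinate to finitely many charts; the glued measure is their supremum. -/
theorem vol_restrict_source (g : RMetric n M) (c : M) :
    (vol g).restrict (extChartAt (𝓡 n) c).source = chartVolume g c := by
  classical
  haveI : Nonempty M := ⟨c⟩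
  have hso : ∀ c : M, MeasurableSet (extChartAt (𝓡 n) c).source := fun c =>
    (isOpen_extChartAt_source c).measurableSet
  obtain ⟨T, hT⟩ := isCompact_univ.elim_finite_subcover (fun c : M => (extChartAt (𝓡 n) c).source)
    (fun c => isOpen_extChartAt_source c)
    (fun x _ => Set.mem_iUnion.2 ⟨x, mem_extChartAt_source x⟩)
  obtain ⟨sel, h1, h2⟩ := exists_measurable_selection T
    (fun c : M => (extChartAt (𝓡 n) c).source) hso
  have h1' : ∀ x, sel x ∈ T ∧ x ∈ (extChartAt (𝓡 n) (sel x)).source := fun x =>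
    h1 x (hT (Set.mem_univ x))
  -- The glued measure: each chart measure on the set where its chart is selected.
  let μ : Measure M := ∑ t ∈ T, (chartVolume g t).restrict (sel ⁻¹' {t})
  have hμ : ∀ s, MeasurableSet s → μ s = ∑ t ∈ T, chartVolume g t (s ∩ sel ⁻¹' {t}) := by
    intro s hs
    simp only [μ, Measure.coe_finsetSum, Finset.sum_apply, Measure.restrict_apply hs]
  have hsum : ∀ (ν : Measure M) (s : Set M), MeasurableSet s →
      ν s = ∑ t ∈ T, ν (s ∩ sel ⁻¹' {t}) := by
    intro ν s hs
    rw [← measure_biUnion_finset]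
    · congr 1
      ext x
      simp only [Set.mem_iUnion, Set.mem_inter_iff, Set.mem_preimage, Set.mem_singleton_iff,
        exists_prop]
      exact ⟨fun hx => ⟨sel x, (h1' x).1, hx, rfl⟩, fun ⟨_, _, hx, _⟩ => hx⟩
    · intro t _ t' _ htt
      rw [Function.onFun, Set.disjoint_left]
      rintro x ⟨_, hx⟩ ⟨_, hx'⟩
      exact htt (hx.symm.trans hx')
    · exact fun t _ => hs.inter (h2 t)
  have hsel : ∀ t, sel ⁻¹' {t} ⊆ (extChartAt (𝓡 n) t).source := by
    rintro t x rfl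
    exact (h1' x).2
  have hsrc : ∀ d s, chartVolume g d (s ∩ (extChartAt (𝓡 n) d).source) = chartVolume g d s :=
    fun d s => measure_inter_conull (chartVolume_compl_source g d)
  have hres : ∀ d s, MeasurableSet s → μ (s ∩ (extChartAt (𝓡 n) d).source) = chartVolume g d s := by
    intro d s hs
    rw [hμ _ (hs.inter (hso d)), ← hsrc d s, hsum (chartVolume g d) _ (hs.inter (hso d))]
    refine Finset.sum_congr rfl fun t _ => ?_
    exact chartVolume_eq_of_subset g ((hs.inter (hso d)).inter (h2 t))
      (Set.inter_subset_right.trans (hsel t)) (Set.inter_subset_left.trans Set.inter_subset_right)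
  -- On each source `μ` agrees with the chart measure, so it is an upper bound of the family; each
  -- of its pieces is at most the supremum, so it is the least one.
  have hvol : vol g = μ := by
    apply le_antisymm
    · refine iSup_le fun d => Measure.le_iff.2 fun s hs => ?_
      rw [← hres d s hs]
      exact measure_mono Set.inter_subset_left
    · refine Measure.le_iff.2 fun s hs => ?_
      rw [hμ s hs, hsum (vol g) s hs]
      exact Finset.sum_le_sum fun t _ => le_iSup (chartVolume g) t _
  ext s hs
  rw [Measure.restrict_apply hs, hvol, hres c s hs]

/-- Lebesgue measure on a subset of the chart at `c`, transported to `M`. -/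
def flatMeasure (c : M) (K : Set M) : Measure M :=
  Measure.map (extChartAt (𝓡 n) c).symm
    (volume.restrict ((extChartAt (𝓡 n) c).target ∩ (extChartAt (𝓡 n) c).symm ⁻¹' K))

theorem image_eq_inter_preimage {c : M} {K : Set M} (hK : K ⊆ (extChartAt (𝓡 n) c).source) :
    (extChartAt (𝓡 n) c).target ∩ (extChartAt (𝓡 n) c).symm ⁻¹' K = extChartAt (𝓡 n) c '' K :=
  ((extChartAt (𝓡 n) c).image_eq_target_inter_inv_preimage hK).symm

theorem isCompact_image_chart {c : M} {K : Set M} (hK : IsCompact K)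
    (hKc : K ⊆ (extChartAt (𝓡 n) c).source) :
    IsCompact ((extChartAt (𝓡 n) c).target ∩ (extChartAt (𝓡 n) c).symm ⁻¹' K) := by
  rw [image_eq_inter_preimage hKc]
  exact hK.image_of_continuousOn ((continuousOn_extChartAt c).mono hKc)

/-- On a compact subset of a chart the volume is comparable with Lebesgue measure. -/
theorem exists_vol_comparison (g : RMetric n M) (c : M) {K : Set M} (hK : IsCompact K)
    (hKm : MeasurableSet K) (hKc : K ⊆ (extChartAt (𝓡 n) c).source) :
    ∃ C : ℝ≥0∞, C ≠ 0 ∧ C ≠ ⊤ ∧ (vol g).restrict K ≤ C • flatMeasure (n := n) c K ∧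
      flatMeasure (n := n) c K ≤ C • (vol g).restrict K := by
  have hcomp := isCompact_image_chart hK hKc
  have hmK := measurableSet_inter_preimage (continuousOn_extChartAt_symm (I := 𝓡 n) c)
    (isOpen_extChartAt_target c) hKm
  set Z := (extChartAt (𝓡 n) c).target ∩ (extChartAt (𝓡 n) c).symm ⁻¹' K with hZ
  have hZt : Z ⊆ (extChartAt (𝓡 n) c).target := Set.inter_subset_left
  obtain ⟨C₁, hC₁⟩ := hcomp.bddAbove_image ((continuousOn_density g c).mono hZt)
  obtain ⟨C₂, hC₂⟩ := hcomp.bddAbove_image (((continuousOn_density g c).mono hZt).inv₀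
    fun y hy => (density_pos g (hZt hy)).ne')
  have hb1 : ∀ y ∈ Z, density g c y ≤ C₁ := fun y hy => hC₁ ⟨y, hy, rfl⟩
  have hb2 : ∀ y ∈ Z, (density g c y)⁻¹ ≤ C₂ := fun y hy => hC₂ ⟨y, hy, rfl⟩
  -- One constant bounds the density and its reciprocal; the entry `1` makes it positive.
  set C := max 1 (max C₁ C₂) with hC
  have hC0 : 0 < C := lt_max_of_lt_left one_pos
  have hvs : ∀ s, MeasurableSet s → (vol g).restrict K s
      = ∫⁻ y in Z ∩ (extChartAt (𝓡 n) c).symm ⁻¹' s, ENNReal.ofReal (density g c y) := by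
    intro s hs
    rw [Measure.restrict_apply hs, ← Set.inter_eq_left.2
      (Set.inter_subset_right.trans hKc : s ∩ K ⊆ _), ← Measure.restrict_apply (hs.inter hKm),
      vol_restrict_source, chartVolume_apply g c (hs.inter hKm), hZ, Set.preimage_inter,
      Set.inter_comm (_ ⁻¹' s), ← Set.inter_assoc]
  have hms : ∀ s, MeasurableSet s → MeasurableSet (Z ∩ (extChartAt (𝓡 n) c).symm ⁻¹' s) := by
    intro s hs
    have := measurableSet_inter_preimage (continuousOn_extChartAt_symm (I := 𝓡 n) c)
      (isOpen_extChartAt_target c) (hKm.inter hs)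
    rwa [Set.preimage_inter, ← Set.inter_assoc] at this
  have hfs : ∀ s, MeasurableSet s → flatMeasure (n := n) c K s
      = ∫⁻ y in Z ∩ (extChartAt (𝓡 n) c).symm ⁻¹' s, 1 := by
    intro s hs
    rw [flatMeasure, Measure.map_apply_of_aemeasurable
      ((aemeasurable_symm c).mono_measure (Measure.restrict_mono hZt le_rfl)) hs,
      lintegral_one, Measure.restrict_apply_univ, Measure.restrict_apply₀' hmK.nullMeasurableSet,
      Set.inter_comm]
  refine ⟨ENNReal.ofReal C, by simpa using hC0, ENNReal.ofReal_ne_top,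
    Measure.le_iff.2 fun s hs => ?_, Measure.le_iff.2 fun s hs => ?_⟩
  · rw [Measure.smul_apply, smul_eq_mul, hvs s hs, hfs s hs, ← lintegral_const_mul _ measurable_const]
    refine setLIntegral_mono' (hms s hs) fun y hy => ?_
    rw [mul_one]
    exact ENNReal.ofReal_le_ofReal ((hb1 y hy.1).trans ((le_max_left _ _).trans (le_max_right _ _)))
  · rw [Measure.smul_apply, smul_eq_mul, hvs s hs, hfs s hs,
      ← lintegral_const_mul' _ _ ENNReal.ofReal_ne_top]
    refine setLIntegral_mono' (hms s hs) fun y hy => ?_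
    rw [← ENNReal.ofReal_mul hC0.le, ← ENNReal.ofReal_one]
    refine ENNReal.ofReal_le_ofReal ?_
    have hp := density_pos g (hZt hy.1)
    have : (density g c y)⁻¹ ≤ C := (hb2 y hy.1).trans ((le_max_right _ _).trans (le_max_right _ _))
    calc 1 = (density g c y)⁻¹ * density g c y := (inv_mul_cancel₀ hp.ne').symm
      _ ≤ C * density g c y := by gcongr

theorem flatMeasure_lt_top {c : M} {K : Set M} (hK : IsCompact K)
    (hKc : K ⊆ (extChartAt (𝓡 n) c).source) : flatMeasure (n := n) c K Set.univ < ⊤ := by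
  rw [flatMeasure, Measure.map_apply_of_aemeasurable ((aemeasurable_symm c).mono_measure
    (Measure.restrict_mono Set.inter_subset_left le_rfl)) MeasurableSet.univ]
  simp only [Set.preimage_univ, Measure.restrict_apply_univ]
  exact (isCompact_image_chart hK hKc).measure_lt_top

instance isFiniteMeasure_vol [T2Space M] (g : RMetric n M) : IsFiniteMeasure (vol g) := by
  haveI : LocallyCompactSpace M := ChartedSpace.locallyCompactSpace 𝔼 M
  refine ⟨isCompact_univ.measure_lt_top_of_nhdsWithin fun x _ => ?_⟩
  obtain ⟨K, hKn, hKs, hK⟩ := LocallyCompactSpace.local_compact_nhds x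
    (extChartAt (𝓡 n) x).source (extChartAt_source_mem_nhds x)
  refine ⟨K, mem_nhdsWithin_of_mem_nhds hKn, ?_⟩
  obtain ⟨C, _, hC, h1, _⟩ := exists_vol_comparison g x hK hK.isClosed.measurableSet hKs
  rw [← Measure.restrict_apply_univ]
  refine (h1 _).trans_lt ?_
  rw [Measure.smul_apply, smul_eq_mul]
  exact ENNReal.mul_lt_top hC.lt_top (flatMeasure_lt_top hK hKs)

theorem vol_pos_of_isOpen (g : RMetric n M) {U : Set M} (hU : IsOpen U) (hne : U.Nonempty) :
    0 < vol g U := by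
  obtain ⟨x, hx⟩ := hne
  have h1 : chartVolume g x U ≤ vol g U := le_iSup (chartVolume g) x U
  refine lt_of_lt_of_le ?_ h1
  rw [chartVolume_apply g x hU.measurableSet]
  have ho := (continuousOn_extChartAt_symm (I := 𝓡 n) x).isOpen_inter_preimage
    (isOpen_extChartAt_target x) hU
  have hpos : 0 < volume ((extChartAt (𝓡 n) x).target ∩ (extChartAt (𝓡 n) x).symm ⁻¹' U) :=
    ho.measure_pos volume ⟨extChartAt (𝓡 n) x x, mem_extChartAt_target x, by
      rw [Set.mem_preimage, extChartAt_to_inv]; exact hx⟩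
  rw [pos_iff_ne_zero]
  intro h0
  rw [lintegral_eq_zero_iff' ((aemeasurable_density g x).mono_measure
    (Measure.restrict_mono Set.inter_subset_left le_rfl)), Filter.EventuallyEq,
    ae_restrict_iff' ho.measurableSet] at h0
  have : volume ((extChartAt (𝓡 n) x).target ∩ (extChartAt (𝓡 n) x).symm ⁻¹' U) = 0 := by
    refine measure_mono_null (fun y hy => ?_) h0
    simp only [Set.mem_compl_iff, Set.mem_ofPred_eq]
    intro h
    have h2 := h hy
    simp only [Pi.zero_apply, ENNReal.ofReal_eq_zero, not_le] at h2
    exact absurd h2 (not_le.2 (density_pos g hy.1))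
  exact hpos.ne' this

end Volume

end NodalYamabe

end

noncomputable section

namespace NodalYamabe

/-! ### Gradients in charts -/

section Gradients

variable {n : ℕ} {M : Type*} [TopologicalSpace M] [ChartedSpace (EuclideanSpace ℝ (Fin n)) M]
  [IsManifold (𝓡 n) ∞ M]

local notation "𝔼" => EuclideanSpace ℝ (Fin n)

theorem inner_grad (g : RMetric n M) (φ : M → ℝ) (x : M) (w : TangentSpace (𝓡 n) x) :
    g.inner x (grad g φ x) w = (mfderiv (𝓡 n) 𝓘(ℝ, ℝ) φ x w : ℝ) :=
  Classical.choose_spec (exists_sharp g x (mfderiv (𝓡 n) 𝓘(ℝ, ℝ) φ x)) w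

theorem eq_of_inner_eq (g : RMetric n M) {x : M} {v v' : TangentSpace (𝓡 n) x}
    (h : ∀ w, g.inner x v w = g.inner x v' w) : v = v' := by
  by_contra hne
  have := g.pos x (v - v') (sub_ne_zero.2 hne)
  rw [(g.inner x).map_sub, _root_.sub_apply, h, sub_self] at this
  exact lt_irrefl _ this

theorem inner_self_nonneg (g : RMetric n M) (x : M) (v : TangentSpace (𝓡 n) x) :
    0 ≤ g.inner x v v := by
  by_cases h : v = 0
  · simp [h]
  · exact (g.pos x v h).le

/-- Cauchy–Schwarz, from nonnegativity of the metric at `g(w, w) v - g(v, w) w`. -/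
theorem inner_sq_le (g : RMetric n M) (x : M) (v w : TangentSpace (𝓡 n) x) :
    g.inner x v w ^ 2 ≤ g.inner x v v * g.inner x w w := by
  by_cases h : w = 0
  · simp [h]
  · have hw := g.pos x w h
    have h1 := inner_self_nonneg g x (g.inner x w w • v - g.inner x v w • w)
    simp only [map_sub, map_smul, _root_.sub_apply, _root_.smul_apply, smul_eq_mul] at h1
    rw [g.symm x w v] at h1
    have h2 : 0 ≤ g.inner x w w * (g.inner x v v * g.inner x w w - g.inner x v w ^ 2) := by
      nlinarith
    have := nonneg_of_mul_nonneg_right h2 hw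
    linarith

/-- The components of a tangent vector in the chart at `c`. -/
def coord (c x : M) : TangentSpace (𝓡 n) x →L[ℝ] 𝔼 :=
  mfderiv (𝓡 n) (𝓡 n) (extChartAt (𝓡 n) c) x

/-- The tangent vector at `x` with given components in the chart at `c`. -/
def vec (c x : M) : 𝔼 →L[ℝ] TangentSpace (𝓡 n) x :=
  (frame c (extChartAt (𝓡 n) c x) : 𝔼 →L[ℝ] 𝔼)

theorem vec_coord {c x : M} (hx : x ∈ (extChartAt (𝓡 n) c).source) (X : TangentSpace (𝓡 n) x) :
    vec c x (coord c x X) = X := frame_mfderiv hx X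

theorem coord_vec {c x : M} (hx : x ∈ (extChartAt (𝓡 n) c).source) (v : 𝔼) :
    coord c x (vec c x v) = v := by
  have h := mfderiv_frame ((extChartAt (𝓡 n) c).map_source hx) v
  rw [(extChartAt (𝓡 n) c).left_inv hx] at h
  exact h

theorem inner_vec (g : RMetric n M) {c x : M} (hx : x ∈ (extChartAt (𝓡 n) c).source) (v w : 𝔼) :
    g.inner x (vec c x v) (vec c x w)
      = ∑ i, ∑ j, gram g c (extChartAt (𝓡 n) c x) i j * (v i * w j) := by
  rw [gram_form]
  exact inner_congr g ((extChartAt (𝓡 n) c).left_inv hx).symm _ _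

theorem mdifferentiableAt_of_contMDiff {φ : M → ℝ} (hφ : ContMDiff (𝓡 n) 𝓘(ℝ, ℝ) ∞ φ) (x : M) :
    MDifferentiableAt (𝓡 n) 𝓘(ℝ, ℝ) φ x := (hφ x).mdifferentiableAt (by simp)

theorem contDiffOn_comp_symm {φ : M → ℝ} (hφ : ContMDiff (𝓡 n) 𝓘(ℝ, ℝ) ∞ φ) (c : M) :
    ContDiffOn ℝ ∞ (fun y => φ ((extChartAt (𝓡 n) c).symm y)) (extChartAt (𝓡 n) c).target := by
  rw [← contMDiffOn_iff_contDiffOn]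
  exact hφ.comp_contMDiffOn (contMDiffOn_extChartAt_symm c)

theorem fderiv_comp_symm {φ : M → ℝ} (hφ : ContMDiff (𝓡 n) 𝓘(ℝ, ℝ) ∞ φ) {c x : M}
    (hx : x ∈ (extChartAt (𝓡 n) c).source) (v : 𝔼) :
    fderiv ℝ (fun y => φ ((extChartAt (𝓡 n) c).symm y)) (extChartAt (𝓡 n) c x) v
      = (mfderiv (𝓡 n) 𝓘(ℝ, ℝ) φ x (vec c x v) : ℝ) := by
  have hy := (extChartAt (𝓡 n) c).map_source hx
  have h1 := mfderiv_comp (extChartAt (𝓡 n) c x)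
    (mdifferentiableAt_of_contMDiff hφ ((extChartAt (𝓡 n) c).symm (extChartAt (𝓡 n) c x)))
    (mdifferentiableAt_extChartAt_symm' hy)
  rw [mfderiv_eq_fderiv] at h1
  have h2 := DFunLike.congr_fun h1 v
  refine h2.trans ?_
  have h3 : ∀ x' : M, x' = x → ∀ w : 𝔼, (mfderiv (𝓡 n) 𝓘(ℝ, ℝ) φ x' w : ℝ)
      = (mfderiv (𝓡 n) 𝓘(ℝ, ℝ) φ x w : ℝ) := by
    rintro x' rfl w
    rfl
  exact h3 _ ((extChartAt (𝓡 n) c).left_inv hx) _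

theorem fderiv_comp_symm_eq_inner (g : RMetric n M) {φ : M → ℝ}
    (hφ : ContMDiff (𝓡 n) 𝓘(ℝ, ℝ) ∞ φ) {c x : M}
    (hx : x ∈ (extChartAt (𝓡 n) c).source) (v : 𝔼) :
    fderiv ℝ (fun y => φ ((extChartAt (𝓡 n) c).symm y)) (extChartAt (𝓡 n) c x) v
      = g.inner x (grad g φ x) (vec c x v) := by
  rw [inner_grad, fderiv_comp_symm hφ hx]

/-- The gradient is obtained by choice, so its regularity has to be read off the formula `g^{ij} ∂_j
φ`, which follows by inverting `G w = dφ`. -/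
theorem coord_grad (g : RMetric n M) {φ : M → ℝ} (hφ : ContMDiff (𝓡 n) 𝓘(ℝ, ℝ) ∞ φ) {c x : M}
    (hx : x ∈ (extChartAt (𝓡 n) c).source) (i : Fin n) :
    coord c x (grad g φ x) i = ∑ j, (gram g c (extChartAt (𝓡 n) c x))⁻¹ i j *
      fderiv ℝ (fun y => φ ((extChartAt (𝓡 n) c).symm y)) (extChartAt (𝓡 n) c x)
        (EuclideanSpace.single j 1) := by
  set G := gram g c (extChartAt (𝓡 n) c x) with hG
  have hpd : G.PosDef := posDef_gram g ((extChartAt (𝓡 n) c).map_source hx)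
  set w := coord c x (grad g φ x) with hw
  have h1 : ∀ j, fderiv ℝ (fun y => φ ((extChartAt (𝓡 n) c).symm y)) (extChartAt (𝓡 n) c x)
        (EuclideanSpace.single j 1) = G.mulVec w.ofLp j := by
    intro j
    rw [fderiv_comp_symm_eq_inner g hφ hx]
    conv_lhs => rw [← vec_coord hx (grad g φ x)]
    rw [g.symm, inner_vec g hx]
    simp [Matrix.mulVec, dotProduct, hG, hw]
  simp only [h1]
  have h2 : w.ofLp = G⁻¹.mulVec (G.mulVec w.ofLp) := by
    rw [Matrix.mulVec_mulVec, Matrix.nonsing_inv_mul _ hpd.det_pos.ne'.isUnit, Matrix.one_mulVec]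
  exact congrFun h2 i

theorem continuousOn_coord_grad (g : RMetric n M) {φ : M → ℝ} (hφ : ContMDiff (𝓡 n) 𝓘(ℝ, ℝ) ∞ φ)
    (c : M) : ContinuousOn (fun x => coord c x (grad g φ x)) (extChartAt (𝓡 n) c).source := by
  have h1 : ContinuousOn (fun x => (WithLp.toLp 2 fun i =>
      ∑ j, (gram g c (extChartAt (𝓡 n) c x))⁻¹ i j *
      fderiv ℝ (fun y => φ ((extChartAt (𝓡 n) c).symm y)) (extChartAt (𝓡 n) c x)
        (EuclideanSpace.single j 1) : 𝔼)) (extChartAt (𝓡 n) c).source := by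
    refine (PiLp.continuous_toLp 2 _).comp_continuousOn (continuousOn_pi.2 fun i =>
      continuousOn_finsetSum _ fun j _ => ContinuousOn.mul ?_ ?_)
    · exact ContinuousOn.comp ((isMetricOn_gram g c).contDiffOn_inv i j).continuousOn
        (continuousOn_extChartAt c) (extChartAt (𝓡 n) c).mapsTo
    · exact ContinuousOn.comp (contDiffOn_partialD (isOpen_extChartAt_target c)
        (contDiffOn_comp_symm hφ c) j).continuousOn
        (continuousOn_extChartAt c) (extChartAt (𝓡 n) c).mapsTo
  refine h1.congr fun x hx => ?_
  ext i
  exact coord_grad g hφ hx i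

/-- The metric in coordinates is continuous and positive on the compact product of `K` with the unit
sphere; homogeneity extends the bounds to all vectors. -/
theorem exists_gram_bounds (g : RMetric n M) (c : M) {K : Set M} (hK : IsCompact K)
    (hKc : K ⊆ (extChartAt (𝓡 n) c).source) :
    ∃ C : ℝ, 0 < C ∧ ∀ x ∈ K, ∀ v : 𝔼, ‖v‖ ^ 2 ≤ C * g.inner x (vec c x v) (vec c x v) ∧
      g.inner x (vec c x v) (vec c x v) ≤ C * ‖v‖ ^ 2 := by
  let f : M × 𝔼 → ℝ := fun z => ∑ i, ∑ j, gram g c (extChartAt (𝓡 n) c z.1) i j * (z.2 i * z.2 j)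
  have hc : ContinuousOn f (K ×ˢ Metric.sphere (0 : 𝔼) 1) := by
    refine continuousOn_finsetSum _ fun i _ => continuousOn_finsetSum _ fun j _ =>
      ContinuousOn.mul ?_ (Continuous.continuousOn (by fun_prop))
    exact (ContinuousOn.comp (contDiffOn_gram g c i j).continuousOn
        (continuousOn_extChartAt c) (extChartAt (𝓡 n) c).mapsTo).comp continuousOn_fst
        fun z hz => hKc hz.1
  have hf : ∀ x ∈ K, ∀ v, f (x, v) = g.inner x (vec c x v) (vec c x v) := fun x hx v =>
    (inner_vec g (hKc hx) v v).symm
  have hpos : ∀ z ∈ K ×ˢ Metric.sphere (0 : 𝔼) 1, 0 < f z := by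
    rintro ⟨x, v⟩ ⟨hx, hv⟩
    rw [hf x hx]
    refine g.pos x _ fun h0 => ?_
    have := coord_vec (hKc hx) v
    rw [h0, map_zero] at this
    rw [← this] at hv
    simp at hv
  have hcomp := hK.prod (isCompact_sphere (0 : 𝔼) 1)
  obtain ⟨C₁, hC₁⟩ := hcomp.bddAbove_image hc
  obtain ⟨C₂, hC₂⟩ := hcomp.bddAbove_image (hc.inv₀ fun z hz => (hpos z hz).ne')
  refine ⟨max 1 (max C₁ C₂), lt_max_of_lt_left one_pos, fun x hx v => ?_⟩
  by_cases hv : v = 0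
  · simp [hv]
  have hv' : 0 < ‖v‖ := norm_pos_iff.2 hv
  have hmem : (x, ‖v‖⁻¹ • v) ∈ K ×ˢ Metric.sphere (0 : 𝔼) 1 := by
    refine ⟨hx, ?_⟩
    simp [norm_smul, hv'.ne']
  have hsc : f (x, ‖v‖⁻¹ • v) = (‖v‖ ^ 2)⁻¹ * g.inner x (vec c x v) (vec c x v) := by
    rw [hf x hx]
    simp only [map_smul, _root_.smul_apply, smul_eq_mul]
    ring
  have h1 : (‖v‖ ^ 2)⁻¹ * g.inner x (vec c x v) (vec c x v) ≤ max 1 (max C₁ C₂) := by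
    rw [← hsc]
    exact (hC₁ ⟨_, hmem, rfl⟩).trans ((le_max_left _ _).trans (le_max_right _ _))
  have hp := hpos _ hmem
  have h2 : ((‖v‖ ^ 2)⁻¹ * g.inner x (vec c x v) (vec c x v))⁻¹ ≤ max 1 (max C₁ C₂) := by
    rw [← hsc]
    exact (hC₂ ⟨_, hmem, rfl⟩).trans ((le_max_right _ _).trans (le_max_right _ _))
  rw [hsc] at hp
  have hg : 0 < g.inner x (vec c x v) (vec c x v) := pos_of_mul_pos_right hp (by positivity)
  rw [mul_inv, inv_inv, ← div_eq_mul_inv, div_le_iff₀ hg] at h2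
  rw [inv_mul_le_iff₀ (by positivity), mul_comm] at h1
  exact ⟨h2, h1⟩

/-- A function on `M` supported in the chart at `c`, read in that chart. -/
def localize (c : M) (h : M → ℝ) : 𝔼 → ℝ :=
  (extChartAt (𝓡 n) c).target.indicator fun y => h ((extChartAt (𝓡 n) c).symm y)

theorem localize_apply {c : M} (h : M → ℝ) {y : 𝔼} (hy : y ∈ (extChartAt (𝓡 n) c).target) :
    localize c h y = h ((extChartAt (𝓡 n) c).symm y) := Set.indicator_of_mem hy _

theorem localize_eventuallyEq {c : M} (h : M → ℝ) {y : 𝔼} (hy : y ∈ (extChartAt (𝓡 n) c).target) :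
    localize c h =ᶠ[𝓝 y] fun y => h ((extChartAt (𝓡 n) c).symm y) := by
  filter_upwards [(isOpen_extChartAt_target c).mem_nhds hy] with z hz using localize_apply h hz

theorem support_localize {c : M} {h : M → ℝ} {K : Set M} (hs : Function.support h ⊆ K) :
    Function.support (localize (n := n) c h)
      ⊆ (extChartAt (𝓡 n) c).target ∩ (extChartAt (𝓡 n) c).symm ⁻¹' K := by
  intro y hy
  have h1 : y ∈ (extChartAt (𝓡 n) c).target := by
    by_contra h
    exact hy (Set.indicator_of_notMem h _)
  refine ⟨h1, hs ?_⟩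
  rw [Function.mem_support, localize_apply h h1] at hy
  exact hy

/-- The support is compact inside the chart, so its image is closed and the extension by zero is
locally zero outside the target. -/
theorem contDiff_localize [CompactSpace M] [T2Space M] {c : M} {h : M → ℝ}
    (hh : ContMDiff (𝓡 n) 𝓘(ℝ, ℝ) ∞ h) (hs : tsupport h ⊆ (extChartAt (𝓡 n) c).source) :
    ContDiff ℝ ∞ (localize (n := n) c h) := by
  rw [contDiff_iff_contDiffAt]
  intro y
  by_cases hy : y ∈ (extChartAt (𝓡 n) c).target
  · exact ((contDiffOn_comp_symm hh c).contDiffAt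
      ((isOpen_extChartAt_target c).mem_nhds hy)).congr_of_eventuallyEq (localize_eventuallyEq h hy)
  · have hcl : IsClosed ((extChartAt (𝓡 n) c).target ∩ (extChartAt (𝓡 n) c).symm ⁻¹' tsupport h) := by
      rw [((extChartAt (𝓡 n) c).image_eq_target_inter_inv_preimage hs).symm]
      exact ((isClosed_tsupport h).isCompact.image_of_continuousOn
        ((continuousOn_extChartAt c).mono hs)).isClosed
    refine contDiffAt_const (c := 0) |>.congr_of_eventuallyEq ?_
    filter_upwards [hcl.isOpen_compl.mem_nhds fun hy' => hy hy'.1] with z hz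
    by_contra hne
    exact hz (support_localize (subset_tsupport h) hne)

end Gradients

end NodalYamabe

end

noncomputable section

namespace NodalYamabe

/-! ### Comparison of norms on `M` and in charts -/

/-- Closability of directional derivatives. -/
theorem ae_eq_zero_of_tendsto_fderiv {n : ℕ} {f : ℕ → EuclideanSpace ℝ (Fin n) → ℝ}
    {α : EuclideanSpace ℝ (Fin n) → ℝ} {O : Set (EuclideanSpace ℝ (Fin n))} (hO : IsOpen O)
    (v : EuclideanSpace ℝ (Fin n)) (hf : ∀ k, ContDiff ℝ ∞ (f k))
    (hα : MemLp α 2 (volume.restrict O))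
    (h0 : Tendsto (fun k => eLpNorm (f k) 2 volume) atTop (𝓝 0))
    (h1 : Tendsto (fun k => eLpNorm (fun y => fderiv ℝ (f k) y v - α y) 2 (volume.restrict O))
      atTop (𝓝 0)) : ∀ᵐ y, y ∈ O → α y = 0 := by
  have hloc : LocallyIntegrableOn α O := by
    rw [locallyIntegrableOn_iff hO.isLocallyClosed]
    intro K hKO hK
    haveI : IsFiniteMeasure (volume.restrict K) := ⟨by simpa using hK.measure_lt_top⟩
    exact ((hα.mono_measure (Measure.restrict_mono hKO le_rfl)).integrable (by norm_num))
  refine hO.ae_eq_zero_of_integral_contDiff_smul_eq_zero hloc fun η hη hηc hηO => ?_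
  have hηL : MemLp η 2 (volume : Measure (EuclideanSpace ℝ (Fin n))) :=
    hη.continuous.memLp_of_hasCompactSupport hηc
  have hηd : Continuous fun y => fderiv ℝ η y v :=
    (hη.continuous_fderiv (by simp)).clm_apply continuous_const
  have hηdc : HasCompactSupport fun y => fderiv ℝ η y v := hηc.fderiv_apply ℝ v
  have hηdL : MemLp (fun y => fderiv ℝ η y v) 2 (volume : Measure (EuclideanSpace ℝ (Fin n))) :=
    hηd.memLp_of_hasCompactSupport hηdc
  have hfd : ∀ k, Continuous fun y => fderiv ℝ (f k) y v := fun k =>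
    ((hf k).continuous_fderiv (by simp)).clm_apply continuous_const
  have hsupp : ∀ y, y ∉ O → η y = 0 := fun y hy => by
    by_contra hne
    exact hy (hηO (subset_tsupport η hne))
  -- The derivative is moved onto the test function, where the convergence of `f k` to zero applies;
  -- compact support of `η` leaves no boundary term.
  have hparts : ∀ k, ∫ y, η y * fderiv ℝ (f k) y v = - ∫ y, fderiv ℝ η y v * f k y := by
    intro k
    refine integral_mul_fderiv_eq_neg_fderiv_mul_of_integrable ?_ ?_ ?_
      (fun y _ => hη.differentiable (by simp) y) (fun y _ => (hf k).differentiable (by simp) y)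
    · exact (hηd.mul (hf k).continuous).integrable_of_hasCompactSupport hηdc.mul_right
    · exact (hη.continuous.mul (hfd k)).integrable_of_hasCompactSupport hηc.mul_right
    · exact (hη.continuous.mul (hf k).continuous).integrable_of_hasCompactSupport hηc.mul_right
  have holder : ∀ {ν : Measure (EuclideanSpace ℝ (Fin n))} {u w : EuclideanSpace ℝ (Fin n) → ℝ},
      AEStronglyMeasurable u ν → AEStronglyMeasurable w ν →
      ‖∫ y, u y * w y ∂ν‖ₑ ≤ eLpNorm u 2 ν * eLpNorm w 2 ν := by
    intro ν u w hu hw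
    refine (enorm_integral_le_lintegral_enorm _).trans ?_
    have h := eLpNorm_smul_le_mul_eLpNorm (p := 2) (q := 2) (r := 1) hw hu
    rw [eLpNorm_one_eq_lintegral_enorm] at h
    exact h
  have hlim1 : Tendsto (fun k => ‖∫ y, η y * fderiv ℝ (f k) y v‖ₑ) atTop (𝓝 0) := by
    have hb : Tendsto (fun k => eLpNorm (fun y => fderiv ℝ η y v) 2 volume * eLpNorm (f k) 2 volume)
        atTop (𝓝 0) := by
      simpa using ENNReal.Tendsto.const_mul h0 (Or.inr hηdL.2.ne)
    refine tendsto_of_tendsto_of_tendsto_of_le_of_le tendsto_const_nhds hb (fun k => zero_le)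
      fun k => ?_
    beta_reduce
    rw [hparts k, enorm_neg]
    exact holder hηdL.1 (hf k).continuous.aestronglyMeasurable
  have hsetint : ∀ w : EuclideanSpace ℝ (Fin n) → ℝ, ∫ y, η y * w y = ∫ y in O, η y * w y := fun w =>
    (setIntegral_eq_integral_of_forall_compl_eq_zero fun y hy => by rw [hsupp y hy, zero_mul]).symm
  have hηO2 : MemLp η 2 (volume.restrict O) := hηL.restrict O
  have hlim2 : Tendsto (fun k => ‖∫ y in O, η y * (fderiv ℝ (f k) y v - α y)‖ₑ) atTop (𝓝 0) := by
    have hb : Tendsto (fun k => eLpNorm η 2 (volume.restrict O) *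
        eLpNorm (fun y => fderiv ℝ (f k) y v - α y) 2 (volume.restrict O)) atTop (𝓝 0) := by
      simpa using ENNReal.Tendsto.const_mul h1 (Or.inr hηO2.2.ne)
    refine tendsto_of_tendsto_of_tendsto_of_le_of_le tendsto_const_nhds hb (fun k => zero_le)
      fun k => ?_
    exact holder hηO2.1 ((hfd k).aestronglyMeasurable.sub hα.1)
  -- The left side is independent of `k`, and both terms on the right tend to zero.
  have hdiff : ∀ k, ∫ y, η y * α y = (∫ y, η y * fderiv ℝ (f k) y v)
      - ∫ y in O, η y * (fderiv ℝ (f k) y v - α y) := by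
    intro k
    have hi1 : Integrable (fun y => η y * fderiv ℝ (f k) y v) (volume.restrict O) :=
      ((hη.continuous.mul (hfd k)).integrable_of_hasCompactSupport hηc.mul_right).restrict
    have hi2 : Integrable (fun y => η y * α y) (volume.restrict O) := hηO2.integrable_mul hα
    simp only [mul_sub]
    rw [integral_sub hi1 hi2, hsetint, hsetint]
    ring
  have hle : ∀ k, ‖∫ y, η y * α y‖ₑ ≤ ‖∫ y, η y * fderiv ℝ (f k) y v‖ₑ
      + ‖∫ y in O, η y * (fderiv ℝ (f k) y v - α y)‖ₑ := by
    intro k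
    conv_lhs => rw [hdiff k]
    exact enorm_sub_le
  have hz : ‖∫ y, η y * α y‖ₑ ≤ 0 :=
    ge_of_tendsto' (by simpa using hlim1.add hlim2) hle
  simpa using hz

section Transfer

variable {n : ℕ} {M : Type*} [TopologicalSpace M] [ChartedSpace (EuclideanSpace ℝ (Fin n)) M]
  [IsManifold (𝓡 n) ∞ M] [MeasurableSpace M] [BorelSpace M] [CompactSpace M]

local notation "𝔼" => EuclideanSpace ℝ (Fin n)

/-- Together with `volume_preimage_null`, this moves almost everywhere statements between the
manifold and a chart. -/
theorem vol_preimage_null (g : RMetric n M) (c : M) {N : Set 𝔼} (hN : volume N = 0) :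
    vol g ((extChartAt (𝓡 n) c).source ∩ extChartAt (𝓡 n) c ⁻¹' N) = 0 := by
  have hm := measurableSet_inter_preimage (continuousOn_extChartAt (I := 𝓡 n) c)
    (isOpen_extChartAt_source c) (measurableSet_toMeasurable volume N)
  refine measure_mono_null (Set.inter_subset_inter_right _
    (Set.preimage_mono (subset_toMeasurable volume N))) ?_
  rw [← Set.inter_eq_left.2 (Set.inter_subset_left : (extChartAt (𝓡 n) c).source ∩
      extChartAt (𝓡 n) c ⁻¹' toMeasurable volume N ⊆ (extChartAt (𝓡 n) c).source),
    ← Measure.restrict_apply hm, vol_restrict_source, chartVolume_apply g c hm]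
  refine setLIntegral_measure_zero _ _ (measure_mono_null (fun y hy => ?_)
    ((measure_toMeasurable (μ := volume) N).trans hN))
  have := hy.2.2
  rwa [Set.mem_preimage, (extChartAt (𝓡 n) c).right_inv hy.1] at this

theorem volume_preimage_null (g : RMetric n M) (c : M) {S : Set M} (hS : vol g S = 0) :
    volume ((extChartAt (𝓡 n) c).target ∩ (extChartAt (𝓡 n) c).symm ⁻¹' S) = 0 := by
  have hm := measurableSet_toMeasurable (vol g) S
  have h0 : chartVolume g c (toMeasurable (vol g) S) = 0 := by
    rw [← vol_restrict_source]
    exact le_antisymm ((Measure.restrict_apply_le _ _).trans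
      ((measure_toMeasurable S).trans hS).le) zero_le
  rw [chartVolume_apply g c hm] at h0
  have hms := measurableSet_inter_preimage (continuousOn_extChartAt_symm (I := 𝓡 n) c)
    (isOpen_extChartAt_target c) hm
  rw [lintegral_eq_zero_iff' ((aemeasurable_density g c).mono_measure
    (Measure.restrict_mono Set.inter_subset_left le_rfl)), Filter.EventuallyEq,
    ae_restrict_iff' hms] at h0
  refine measure_mono_null (fun y hy => ?_) h0
  simp only [Set.mem_compl_iff, Set.mem_ofPred_eq]
  intro h
  have h2 := h ⟨hy.1, subset_toMeasurable _ _ hy.2⟩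
  simp only [Pi.zero_apply, ENNReal.ofReal_eq_zero] at h2
  exact absurd h2 (not_le.2 (density_pos g hy.1))

/-- On a compact subset of a chart the `Lᵖ` norms on `M` and in the chart are equivalent. -/
theorem exists_eLpNorm_comparison (g : RMetric n M) (c : M) {K : Set M} (hK : IsCompact K)
    (hKm : MeasurableSet K) (hKc : K ⊆ (extChartAt (𝓡 n) c).source) (p : ℝ≥0∞) :
    ∃ C : ℝ≥0∞, C ≠ ⊤ ∧ ∀ {F : Type} [NormedAddCommGroup F] (w : M → F),
      AEStronglyMeasurable w (vol g) →
      eLpNorm w p ((vol g).restrict K) ≤ C * eLpNorm (fun y => w ((extChartAt (𝓡 n) c).symm y)) p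
        (volume.restrict ((extChartAt (𝓡 n) c).target ∩ (extChartAt (𝓡 n) c).symm ⁻¹' K)) ∧
      eLpNorm (fun y => w ((extChartAt (𝓡 n) c).symm y)) p
        (volume.restrict ((extChartAt (𝓡 n) c).target ∩ (extChartAt (𝓡 n) c).symm ⁻¹' K))
        ≤ C * eLpNorm w p (vol g) := by
  obtain ⟨C, hC0, hC, h1, h2⟩ := exists_vol_comparison g c hK hKm hKc
  refine ⟨C ^ (1 / p).toReal, ENNReal.rpow_ne_top_of_nonneg (by positivity) hC,
    fun {F} _ w hw => ?_⟩
  have hac : flatMeasure (n := n) c K ≪ vol g :=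
    ((Measure.absolutelyContinuous_of_le h2).trans
      (Measure.smul_absolutelyContinuous)).trans Measure.restrict_le_self.absolutelyContinuous
  have hmap : eLpNorm w p (flatMeasure (n := n) c K) = eLpNorm (fun y => w ((extChartAt (𝓡 n) c).symm y)) p
        (volume.restrict ((extChartAt (𝓡 n) c).target ∩ (extChartAt (𝓡 n) c).symm ⁻¹' K)) :=
    eLpNorm_map_measure (hw.mono_ac hac) ((aemeasurable_symm c).mono_measure
      (Measure.restrict_mono Set.inter_subset_left le_rfl))
  rw [← hmap]
  constructor
  · refine (eLpNorm_mono_measure w h1).trans_eq ?_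
    rw [eLpNorm_smul_measure_of_ne_zero hC0, smul_eq_mul]
  · refine (eLpNorm_mono_measure w h2).trans ?_
    rw [eLpNorm_smul_measure_of_ne_zero hC0, smul_eq_mul]
    gcongr
    exact Measure.restrict_le_self

end Transfer

end NodalYamabe

end

noncomputable section

namespace NodalYamabe

/-! ### The gradient on smooth functions in a finite system of charts -/

/-- Finitely many charts with bump functions, and a measurable choice at each point `x` of a chart
whose bump function is `1` near `x`. -/
structure ChartCover (n : ℕ) (M : Type*) [TopologicalSpace M]
    [ChartedSpace (EuclideanSpace ℝ (Fin n)) M] [MeasurableSpace M] where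
  index : Finset M
  bump : (c : M) → SmoothBumpFunction (𝓡 n) c
  sel : M → M
  sel_mem : ∀ x, sel x ∈ index
  bump_eq_one : ∀ x, bump (sel x) =ᶠ[𝓝 x] 1
  measurableSet_sel : ∀ c, MeasurableSet (sel ⁻¹' {c})

section Cover

variable {n : ℕ} {M : Type*} [TopologicalSpace M] [ChartedSpace (EuclideanSpace ℝ (Fin n)) M]
  [MeasurableSpace M]

local notation "𝔼" => EuclideanSpace ℝ (Fin n)

/-- By compactness finitely many of the open sets on whose points a bump function is locally `1`
cover `M`; `exists_measurable_selection` picks one of them at each point. -/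
theorem exists_chartCover [BorelSpace M] [CompactSpace M] [Nonempty M] :
    Nonempty (ChartCover n M) := by
  let χ : (c : M) → SmoothBumpFunction (𝓡 n) c := fun c => Classical.arbitrary _
  have ho : ∀ c, IsOpen (interior {x | χ c x = 1}) := fun c => isOpen_interior
  obtain ⟨T, hT⟩ := isCompact_univ.elim_finite_subcover (fun c : M => interior {x | χ c x = 1})
    ho (fun x _ => Set.mem_iUnion.2 ⟨x, mem_interior_iff_mem_nhds.2 (χ x).eventuallyEq_one⟩)
  obtain ⟨sel, h1, h2⟩ := exists_measurable_selection T
    (fun c : M => interior {x | χ c x = 1}) fun c => (ho c).measurableSet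
  exact ⟨⟨T, χ, sel, fun x => (h1 x (hT trivial)).1,
    fun x => mem_interior_iff_mem_nhds.1 (h1 x (hT trivial)).2, h2⟩⟩

namespace ChartCover

variable (A : ChartCover n M)

/-- The support of the bump function. -/
def supp (c : M) : Set M := tsupport (A.bump c)

/-- The open set near which the bump function is `1`. -/
def core (c : M) : Set M := interior {x | A.bump c x = 1}

theorem isOpen_core (c : M) : IsOpen (A.core c) := isOpen_interior

theorem bump_core {c x : M} (hx : x ∈ A.core c) : A.bump c x = 1 := by
  have h : A.core c ⊆ {x | A.bump c x = 1} := interior_subset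
  exact h hx

theorem mem_core (x : M) : x ∈ A.core (A.sel x) := mem_interior_iff_mem_nhds.2 (A.bump_eq_one x)

theorem core_subset_supp (c : M) : A.core c ⊆ A.supp c := fun x hx =>
  subset_tsupport _ (by rw [Function.mem_support, A.bump_core hx]; exact one_ne_zero)

theorem supp_subset [T2Space M] (c : M) : A.supp c ⊆ (extChartAt (𝓡 n) c).source :=
  (A.bump c).tsupport_subset_extChartAt_source

theorem isCompact_supp [CompactSpace M] (c : M) : IsCompact (A.supp c) :=
  (isClosed_tsupport _).isCompact

theorem measurableSet_supp [BorelSpace M] (c : M) : MeasurableSet (A.supp c) :=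
  (isClosed_tsupport _).measurableSet

theorem mem_supp (x : M) : x ∈ A.supp (A.sel x) := A.core_subset_supp _ (A.mem_core x)

theorem mem_source [T2Space M] (x : M) : x ∈ (extChartAt (𝓡 n) (A.sel x)).source :=
  A.supp_subset _ (A.mem_supp x)

theorem aestronglyMeasurable_of_sel {F : Type*} [NormedAddCommGroup F] {μ : Measure M} {f : M → F}
    (h : ∀ c ∈ A.index, AEStronglyMeasurable f (μ.restrict (A.sel ⁻¹' {c}))) :
    AEStronglyMeasurable f μ := by
  have hU : (⋃ c : A.index, A.sel ⁻¹' {(c : M)}) = Set.univ := by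
    ext x
    simp only [Set.mem_iUnion, Set.mem_univ, iff_true]
    exact ⟨⟨A.sel x, A.sel_mem x⟩, rfl⟩
  have h1 : AEStronglyMeasurable f (μ.restrict (⋃ c : A.index, A.sel ⁻¹' {(c : M)})) :=
    aestronglyMeasurable_iUnion_iff.2 fun c => h c c.2
  rwa [hU, Measure.restrict_univ] at h1

/-- The selected chart is constant on each of finitely many measurable pieces, so measurability may
be checked with an expression in one fixed chart at a time. -/
theorem aestronglyMeasurable_of_sel_congr {F : Type*} [NormedAddCommGroup F] {μ : Measure M}
    {f : M → F} (h : ∀ c ∈ A.index, ∃ f' : M → F, AEStronglyMeasurable f'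
      (μ.restrict (A.sel ⁻¹' {c})) ∧ ∀ x, A.sel x = c → f' x = f x) :
    AEStronglyMeasurable f μ := by
  refine A.aestronglyMeasurable_of_sel fun c hc => ?_
  obtain ⟨f', h1, h2⟩ := h c hc
  exact h1.congr ((ae_restrict_iff' (A.measurableSet_sel c)).2 (ae_of_all _ fun x hx => h2 x hx))

theorem sel_preimage_subset [T2Space M] (c : M) :
    A.sel ⁻¹' {c} ⊆ (extChartAt (𝓡 n) c).source := by
  rintro x rfl
  exact A.mem_source x

theorem aestronglyMeasurable_continuousOn [T2Space M] [BorelSpace M] {F : Type*}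
    [NormedAddCommGroup F] [SecondCountableTopology F] {μ : Measure M} {f : M → F} {c : M}
    (hf : ContinuousOn f (extChartAt (𝓡 n) c).source) :
    AEStronglyMeasurable f (μ.restrict (A.sel ⁻¹' {c})) :=
  (hf.aestronglyMeasurable (isOpen_extChartAt_source c).measurableSet).mono_measure
    (Measure.restrict_mono (A.sel_preimage_subset c) le_rfl)

variable [IsManifold (𝓡 n) ∞ M]

/-- The components of a tangent vector in the selected chart. -/
def coord (x : M) : TangentSpace (𝓡 n) x →L[ℝ] 𝔼 := NodalYamabe.coord (A.sel x) x

/-- The tangent vector with given components in the selected chart. -/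
def vec (x : M) : 𝔼 →L[ℝ] TangentSpace (𝓡 n) x := NodalYamabe.vec (A.sel x) x

theorem vec_coord [T2Space M] (x : M) (X : TangentSpace (𝓡 n) x) : A.vec x (A.coord x X) = X :=
  NodalYamabe.vec_coord (A.mem_source x) X

theorem coord_vec [T2Space M] (x : M) (v : 𝔼) : A.coord x (A.vec x v) = v :=
  NodalYamabe.coord_vec (A.mem_source x) v

/-- One constant for all the charts. The last clause concerns a chart `c` that need not be the
selected one at `x`: derivatives are taken in chart `c`, while the gradient is recorded in the
selected chart. -/
theorem exists_bounds [T2Space M] [CompactSpace M] (g : RMetric n M) :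
    ∃ C : ℝ, 0 < C ∧ (∀ x, ∀ v : 𝔼, ‖v‖ ^ 2 ≤ C * g.inner x (A.vec x v) (A.vec x v) ∧
      g.inner x (A.vec x v) (A.vec x v) ≤ C * ‖v‖ ^ 2) ∧
      ∀ c ∈ A.index, ∀ x ∈ A.supp c, ∀ v : 𝔼,
        g.inner x (NodalYamabe.vec c x v) (NodalYamabe.vec c x v) ≤ C * ‖v‖ ^ 2 := by
  choose C hC h using fun c => exists_gram_bounds g c (A.isCompact_supp c) (A.supp_subset c)
  have hle : ∀ c ∈ A.index, C c ≤ 1 + ∑ c ∈ A.index, C c := fun c hc =>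
    (Finset.single_le_sum (f := C) (fun c _ => (hC c).le) hc).trans (by linarith)
  have hs : 0 ≤ ∑ c ∈ A.index, C c := Finset.sum_nonneg fun c _ => (hC c).le
  refine ⟨1 + ∑ c ∈ A.index, C c, by linarith, fun x v => ?_, fun c hc x hx v => ?_⟩
  · have h1 := h (A.sel x) x (A.mem_supp x) v
    have h2 := hle _ (A.sel_mem x)
    refine ⟨h1.1.trans ?_, h1.2.trans ?_⟩
    · exact mul_le_mul_of_nonneg_right h2 (inner_self_nonneg g x _)
    · gcongr
  · refine ((h c x hx v).2).trans ?_
    have := hle c hc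
    gcongr

/-- The components of the gradient of a smooth function. -/
def gradient (g : RMetric n M) (φ : M → ℝ) (x : M) : 𝔼 := A.coord x (grad g φ x)

theorem inner_coord_le [T2Space M] {g : RMetric n M} {C : ℝ} (h : ∀ x, ∀ v : 𝔼,
    ‖v‖ ^ 2 ≤ C * g.inner x (A.vec x v) (A.vec x v) ∧
      g.inner x (A.vec x v) (A.vec x v) ≤ C * ‖v‖ ^ 2) (x : M) (X : TangentSpace (𝓡 n) x) :
    g.inner x X X ≤ C * ‖A.coord x X‖ ^ 2 := by
  have := (h x (A.coord x X)).2
  rwa [A.vec_coord] at this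

variable [T2Space M] [CompactSpace M] [BorelSpace M]

theorem aestronglyMeasurable_gradient {g : RMetric n M} {φ : M → ℝ}
    (hφ : ContMDiff (𝓡 n) 𝓘(ℝ, ℝ) ∞ φ) {μ : Measure M} :
    AEStronglyMeasurable (A.gradient g φ) μ := by
  refine A.aestronglyMeasurable_of_sel_congr fun c _ =>
    ⟨_, A.aestronglyMeasurable_continuousOn (continuousOn_coord_grad g hφ c), ?_⟩
  rintro x rfl
  rfl

theorem memLp_gradient {g : RMetric n M} {φ : M → ℝ}
    (hφ : ContMDiff (𝓡 n) 𝓘(ℝ, ℝ) ∞ φ) : MemLp (A.gradient g φ) 2 (vol g) := by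
  have hb : ∀ c, ∃ C : ℝ, ∀ x ∈ A.supp c, ‖NodalYamabe.coord c x (grad g φ x)‖ ≤ C := fun c =>
    (A.isCompact_supp c).exists_bound_of_continuousOn
      ((continuousOn_coord_grad g hφ c).mono (A.supp_subset c))
  choose C hC using hb
  refine MemLp.of_bound (A.aestronglyMeasurable_gradient hφ) (∑ c ∈ A.index, |C c|)
    (ae_of_all _ fun x => ?_)
  exact ((hC _ x (A.mem_supp x)).trans (le_abs_self _)).trans
    (Finset.single_le_sum (f := fun c => |C c|) (fun c _ => abs_nonneg _) (A.sel_mem x))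

theorem memLp_smooth {g : RMetric n M} {φ : M → ℝ} (hφ : ContMDiff (𝓡 n) 𝓘(ℝ, ℝ) ∞ φ)
    (p : ℝ≥0∞) : MemLp φ p (vol g) := by
  obtain ⟨C, hC⟩ := isCompact_univ.exists_bound_of_continuousOn hφ.continuous.continuousOn
  exact MemLp.of_bound hφ.continuous.aestronglyMeasurable C (ae_of_all _ fun x => hC x trivial)

/-- The product of `φ` with the bump function, in coordinates. -/
def piece (c : M) (φ : M → ℝ) : 𝔼 → ℝ := localize c fun x => A.bump c x * φ x

/-- The support of `piece`. -/
def chartSupp (c : M) : Set 𝔼 :=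
  (extChartAt (𝓡 n) c).target ∩ (extChartAt (𝓡 n) c).symm ⁻¹' A.supp c

theorem isCompact_chartSupp (c : M) : IsCompact (A.chartSupp c) := by
  rw [chartSupp, ((extChartAt (𝓡 n) c).image_eq_target_inter_inv_preimage (A.supp_subset c)).symm]
  exact (A.isCompact_supp c).image_of_continuousOn ((continuousOn_extChartAt c).mono
    (A.supp_subset c))

end ChartCover

end Cover

end NodalYamabe

end

/-! ### Sobolev inequality and Rellich's theorem on the manifold -/

noncomputable section

namespace NodalYamabe

theorem eLpNorm_restrict_of_eq_zero {α F : Type*} [MeasurableSpace α] [NormedAddCommGroup F]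
    {μ : Measure α} {f : α → F} {s : Set α} (h : ∀ x, x ∉ s → ‖f x‖ = 0) (p : ℝ≥0∞) :
    eLpNorm f p μ = eLpNorm f p (μ.restrict s) :=
  (eLpNorm_restrict_eq_of_support_subset fun x hx => by
    by_contra hs
    exact hx (norm_eq_zero.1 (h x hs))).symm

namespace ChartCover

variable {n : ℕ} {M : Type*} [TopologicalSpace M] [ChartedSpace (EuclideanSpace ℝ (Fin n)) M]
  [MeasurableSpace M] [IsManifold (𝓡 n) ∞ M] [T2Space M] [CompactSpace M] [BorelSpace M]
  (A : ChartCover n M)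

local notation "𝔼" => EuclideanSpace ℝ (Fin n)

theorem contDiff_piece (c : M) {φ : M → ℝ} (hφ : ContMDiff (𝓡 n) 𝓘(ℝ, ℝ) ∞ φ) :
    ContDiff ℝ ∞ (A.piece c φ) :=
  contDiff_localize ((A.bump c).contMDiff.mul hφ)
    ((tsupport_mul_subset_left).trans (A.supp_subset c))

theorem support_piece (c : M) (φ : M → ℝ) : Function.support (A.piece c φ) ⊆ A.chartSupp c :=
  support_localize fun x hx => subset_tsupport _ (left_ne_zero_of_mul hx)

theorem hasCompactSupport_piece (c : M) (φ : M → ℝ) : HasCompactSupport (A.piece c φ) :=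
  HasCompactSupport.of_support_subset_isCompact (A.isCompact_chartSupp c) (A.support_piece c φ)

theorem piece_sub (c : M) (φ ψ : M → ℝ) : A.piece c (φ - ψ) = A.piece c φ - A.piece c ψ := by
  ext y
  by_cases hy : y ∈ (extChartAt (𝓡 n) c).target
  · simp only [piece, localize, Set.indicator_of_mem hy, Pi.sub_apply, mul_sub]
  · simp only [piece, localize, Set.indicator_of_notMem hy, Pi.sub_apply, sub_zero]

theorem piece_apply {c : M} {φ : M → ℝ} {y : 𝔼} (hy : y ∈ (extChartAt (𝓡 n) c).target) :
    A.piece c φ y = A.bump c ((extChartAt (𝓡 n) c).symm y) * φ ((extChartAt (𝓡 n) c).symm y) :=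
  localize_apply _ hy

/-- The Cauchy–Schwarz inequality for the metric compares components in two different charts without
mentioning the transition map. -/
theorem norm_fderiv_comp_symm_le {g : RMetric n M} {C : ℝ} (hC : 0 < C)
    (h : ∀ x, ∀ v : 𝔼, ‖v‖ ^ 2 ≤ C * g.inner x (A.vec x v) (A.vec x v) ∧
      g.inner x (A.vec x v) (A.vec x v) ≤ C * ‖v‖ ^ 2)
    {c : M} (h' : ∀ x ∈ A.supp c, ∀ v : 𝔼,
      g.inner x (NodalYamabe.vec c x v) (NodalYamabe.vec c x v) ≤ C * ‖v‖ ^ 2)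
    {x : M} (hx : x ∈ A.supp c) (X : TangentSpace (𝓡 n) x) (v : 𝔼) :
    |g.inner x X (NodalYamabe.vec c x v)| ≤ C * ‖A.coord x X‖ * ‖v‖ := by
  refine abs_le_of_sq_le_sq ?_ (by positivity)
  refine (inner_sq_le g x _ _).trans ?_
  calc g.inner x X X * g.inner x (NodalYamabe.vec c x v) (NodalYamabe.vec c x v)
      ≤ (C * ‖A.coord x X‖ ^ 2) * (C * ‖v‖ ^ 2) :=
        mul_le_mul (A.inner_coord_le h x X) (h' x hx v) (inner_self_nonneg g x _) (by positivity)
    _ = (C * ‖A.coord x X‖ * ‖v‖) ^ 2 := by ring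

/-- Product rule: the bump function is at most `1` with bounded derivative, and the derivative of
`φ` in the chart is the pairing with its gradient. -/
theorem exists_norm_fderiv_piece_le (g : RMetric n M) {c : M} (hc : c ∈ A.index) :
    ∃ L : ℝ, 0 < L ∧ ∀ φ : M → ℝ, ContMDiff (𝓡 n) 𝓘(ℝ, ℝ) ∞ φ → ∀ y ∈ A.chartSupp c,
      ‖fderiv ℝ (A.piece c φ) y‖ ≤ L * (‖φ ((extChartAt (𝓡 n) c).symm y)‖
        + ‖A.gradient g φ ((extChartAt (𝓡 n) c).symm y)‖) := by
  obtain ⟨C, hC, h1, h2⟩ := A.exists_bounds g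
  have hbump : ContDiff ℝ ∞ (localize (n := n) c (A.bump c)) :=
    contDiff_localize (A.bump c).contMDiff (A.supp_subset c)
  obtain ⟨D, hD⟩ := (A.isCompact_chartSupp c).exists_bound_of_continuousOn
    (hbump.continuous_fderiv (by simp)).continuousOn
  refine ⟨max C D, lt_max_of_lt_left hC, fun φ hφ y hy => ?_⟩
  have hyt := hy.1
  have hxs := A.supp_subset c hy.2
  have hb : localize (n := n) c (A.bump c) y = A.bump c ((extChartAt (𝓡 n) c).symm y) :=
    localize_apply _ hyt
  set x := (extChartAt (𝓡 n) c).symm y with hx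
  have hyx : extChartAt (𝓡 n) c x = y := (extChartAt (𝓡 n) c).right_inv hyt
  have hd1 := (hbump.differentiable (by simp) y).hasFDerivAt
  have hd2 := ((contDiffOn_comp_symm hφ c).differentiableAt_of_isOpen
    (isOpen_extChartAt_target c) hyt).hasFDerivAt
  have heq : A.piece c φ =ᶠ[𝓝 y] fun z => localize (n := n) c (A.bump c) z
      * φ ((extChartAt (𝓡 n) c).symm z) := by
    filter_upwards [(isOpen_extChartAt_target c).mem_nhds hyt] with z hz
    rw [A.piece_apply hz, localize_apply _ hz]
  have hd3 := (hd1.mul hd2).congr_of_eventuallyEq heq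
  rw [hd3.fderiv]
  have hn1 : ‖fderiv ℝ (fun y => φ ((extChartAt (𝓡 n) c).symm y)) y‖ ≤ C * ‖A.gradient g φ x‖ := by
    refine ContinuousLinearMap.opNorm_le_bound _ (by positivity) fun v => ?_
    conv_lhs => rw [← hyx]
    rw [fderiv_comp_symm_eq_inner g hφ hxs]
    exact A.norm_fderiv_comp_symm_le hC h1 (h2 c hc) hy.2 _ v
  have hn2 : |A.bump c x| ≤ 1 := abs_le.2 ⟨by linarith [(A.bump c).nonneg (x := x)], (A.bump c).le_one⟩
  refine (norm_add_le _ _).trans ?_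
  rw [norm_smul, norm_smul, hb, Real.norm_eq_abs]
  calc |A.bump c x| * ‖fderiv ℝ (fun y => φ ((extChartAt (𝓡 n) c).symm y)) y‖
        + ‖φ x‖ * ‖fderiv ℝ (localize (n := n) c (A.bump c)) y‖
      ≤ 1 * (C * ‖A.gradient g φ x‖) + ‖φ x‖ * D := by
        gcongr
        exact hD y hy
    _ ≤ max C D * ‖A.gradient g φ x‖ + max C D * ‖φ x‖ := by
        rw [one_mul, mul_comm ‖φ x‖]
        gcongr
        · exact le_max_left _ _
        · exact le_max_right _ _
    _ = max C D * (‖φ x‖ + ‖A.gradient g φ x‖) := by ring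

theorem exists_eLpNorm_piece_le (g : RMetric n M) {c : M} (hc : c ∈ A.index) :
    ∃ C : ℝ≥0∞, C ≠ ⊤ ∧ ∀ φ : M → ℝ, ContMDiff (𝓡 n) 𝓘(ℝ, ℝ) ∞ φ →
      eLpNorm (A.piece c φ) 2 volume ≤ C * eLpNorm φ 2 (vol g) ∧
      eLpNorm (fderiv ℝ (A.piece c φ)) 2 volume
        ≤ C * (eLpNorm φ 2 (vol g) + eLpNorm (A.gradient g φ) 2 (vol g)) := by
  obtain ⟨C, hC, h⟩ := exists_eLpNorm_comparison g c (A.isCompact_supp c) (A.measurableSet_supp c)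
    (A.supp_subset c) 2
  obtain ⟨L, hL, h'⟩ := A.exists_norm_fderiv_piece_le g hc
  have hZm : MeasurableSet (A.chartSupp c) := (A.isCompact_chartSupp c).isClosed.measurableSet
  refine ⟨max C (ENNReal.ofReal L * C), (max_lt hC.lt_top
    (ENNReal.mul_lt_top ENNReal.ofReal_lt_top hC.lt_top)).ne, fun φ hφ => ⟨?_, ?_⟩⟩
  · rw [← eLpNorm_restrict_eq_of_support_subset (A.support_piece c φ)]
    have h1 : eLpNorm (A.piece c φ) 2 (volume.restrict (A.chartSupp c))
        ≤ eLpNorm (fun y => φ ((extChartAt (𝓡 n) c).symm y)) 2 (volume.restrict (A.chartSupp c)) := by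
      refine eLpNorm_mono_ae ((ae_restrict_iff' hZm).2 (ae_of_all _ fun y hy => ?_))
      rw [A.piece_apply hy.1, norm_mul, Real.norm_eq_abs (A.bump c _)]
      refine mul_le_of_le_one_left (norm_nonneg _) (abs_le.2 ⟨?_, (A.bump c).le_one⟩)
      linarith [(A.bump c).nonneg (x := (extChartAt (𝓡 n) c).symm y)]
    refine h1.trans ((h φ hφ.continuous.aestronglyMeasurable).2.trans ?_)
    gcongr
    exact le_max_left _ _
  · have hs : Function.support (fderiv ℝ (A.piece c φ)) ⊆ A.chartSupp c :=
      (support_fderiv_subset ℝ).trans (closure_minimal (A.support_piece c φ)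
        (A.isCompact_chartSupp c).isClosed)
    rw [eLpNorm_restrict_of_eq_zero (s := A.chartSupp c) fun y hy => by
      rw [Function.notMem_support.1 fun h => hy (hs h), norm_zero]]
    have hmg : AEStronglyMeasurable (fun x => ‖φ x‖ + ‖A.gradient g φ x‖) (vol g) :=
      hφ.continuous.aestronglyMeasurable.norm.add (A.aestronglyMeasurable_gradient hφ).norm
    have h1 : eLpNorm (fderiv ℝ (A.piece c φ)) 2 (volume.restrict (A.chartSupp c))
        ≤ ENNReal.ofReal L * eLpNorm (fun y => (fun x => ‖φ x‖ + ‖A.gradient g φ x‖)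
          ((extChartAt (𝓡 n) c).symm y)) 2 (volume.restrict (A.chartSupp c)) := by
      refine eLpNorm_le_mul_eLpNorm_of_ae_le_mul
        ((ae_restrict_iff' hZm).2 (ae_of_all _ fun y hy => ?_)) 2
      refine (h' φ hφ y hy).trans_eq ?_
      beta_reduce
      rw [Real.norm_of_nonneg (add_nonneg (norm_nonneg (φ _)) (norm_nonneg (A.gradient g φ _)))]
    refine h1.trans ?_
    have h2 := (h _ hmg).2
    have h3 : eLpNorm (fun x => ‖φ x‖ + ‖A.gradient g φ x‖) 2 (vol g)
        ≤ eLpNorm φ 2 (vol g) + eLpNorm (A.gradient g φ) 2 (vol g) := by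
      refine (eLpNorm_add_le hφ.continuous.aestronglyMeasurable.norm
        (A.aestronglyMeasurable_gradient hφ).norm (by norm_num)).trans_eq ?_
      rw [eLpNorm_norm, eLpNorm_norm]
    calc _ ≤ ENNReal.ofReal L * (C * (eLpNorm φ 2 (vol g) + eLpNorm (A.gradient g φ) 2 (vol g))) := by
          gcongr
          exact h2.trans (by gcongr)
      _ ≤ _ := by
          rw [← mul_assoc]
          gcongr
          exact le_max_right _ _

/-- At each point the selected bump function equals `1`, so `|φ|` is at most the sum of the
localised absolute values. -/
theorem exists_eLpNorm_le_sum_piece (g : RMetric n M) (p : ℝ≥0∞) (hp : 1 ≤ p) :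
    ∃ C : ℝ≥0∞, C ≠ ⊤ ∧ ∀ φ : M → ℝ, Continuous φ →
      eLpNorm φ p (vol g) ≤ C * ∑ c ∈ A.index, eLpNorm (A.piece c φ) p volume := by
  choose C hC h using fun c => exists_eLpNorm_comparison g c (A.isCompact_supp c)
    (A.measurableSet_supp c) (A.supp_subset c) p
  refine ⟨∑ c ∈ A.index, C c, (ENNReal.sum_lt_top.2 fun c _ => (hC c).lt_top).ne, fun φ hφ => ?_⟩
  have hm : ∀ c, AEStronglyMeasurable (fun x => A.bump c x * φ x) (vol g) := fun c =>
    ((A.bump c).continuous.mul hφ).aestronglyMeasurable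
  have h1 : eLpNorm φ p (vol g) ≤ eLpNorm (∑ c ∈ A.index, fun x => ‖A.bump c x * φ x‖) p (vol g) := by
    refine eLpNorm_mono fun x => ?_
    rw [Finset.sum_apply, Real.norm_of_nonneg (Finset.sum_nonneg fun c _ => norm_nonneg _)]
    have h2 : ‖φ x‖ = ‖A.bump (A.sel x) x * φ x‖ := by
      rw [A.bump_core (A.mem_core x), one_mul]
    rw [h2]
    exact Finset.single_le_sum (f := fun c => ‖A.bump c x * φ x‖) (fun c _ => norm_nonneg _)
      (A.sel_mem x)
  refine h1.trans ((eLpNorm_sum_le (fun c _ => (hm c).norm) hp).trans ?_)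
  rw [Finset.mul_sum]
  refine Finset.sum_le_sum fun c hc => ?_
  rw [eLpNorm_norm]
  have hs : Function.support (fun x => A.bump c x * φ x) ⊆ A.supp c := fun x hx =>
    subset_tsupport _ (left_ne_zero_of_mul hx)
  rw [← eLpNorm_restrict_eq_of_support_subset hs]
  refine ((h c _ (hm c)).1).trans ?_
  have h3 : eLpNorm (fun y => A.bump c ((extChartAt (𝓡 n) c).symm y)
      * φ ((extChartAt (𝓡 n) c).symm y)) p (volume.restrict (A.chartSupp c))
      ≤ eLpNorm (A.piece c φ) p volume := by
    refine le_trans (eLpNorm_mono_ae (g := A.piece c φ) ?_)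
      (eLpNorm_mono_measure _ Measure.restrict_le_self)
    refine (ae_restrict_iff' (A.isCompact_chartSupp c).isClosed.measurableSet).2
      (ae_of_all _ fun y hy => ?_)
    rw [A.piece_apply hy.1]
  refine mul_le_mul' ?_ h3
  exact Finset.single_le_sum (f := C) (fun c _ => zero_le) hc

/-- The Gagliardo–Nirenberg–Sobolev inequality for each compactly supported piece, with `1/q = 1/2 -
1/n`, summed over the finitely many charts. -/
theorem exists_sobolev (hn : 3 ≤ n) (g : RMetric n M) :
    ∃ C : ℝ≥0∞, C ≠ ⊤ ∧ ∀ φ : M → ℝ, ContMDiff (𝓡 n) 𝓘(ℝ, ℝ) ∞ φ →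
      eLpNorm φ (ENNReal.ofReal (2 * n / (n - 2))) (vol g)
        ≤ C * (eLpNorm φ 2 (vol g) + eLpNorm (A.gradient g φ) 2 (vol g)) := by
  have hn' : (3 : ℝ) ≤ n := by exact_mod_cast hn
  have hq : (1 : ℝ) ≤ 2 * n / (n - 2) := by
    rw [le_div_iff₀ (by linarith)]
    linarith
  obtain ⟨C, hC, h⟩ := A.exists_eLpNorm_le_sum_piece g (ENNReal.ofReal (2 * n / (n - 2)))
    (by rw [← ENNReal.ofReal_one]; exact ENNReal.ofReal_le_ofReal hq)
  have hex : ∀ c : A.index, ∃ C : ℝ≥0∞, C ≠ ⊤ ∧ ∀ φ : M → ℝ, ContMDiff (𝓡 n) 𝓘(ℝ, ℝ) ∞ φ →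
      eLpNorm (A.piece c φ) (ENNReal.ofReal (2 * n / (n - 2))) volume
        ≤ C * (eLpNorm φ 2 (vol g) + eLpNorm (A.gradient g φ) 2 (vol g)) := by
    intro c
    obtain ⟨D, hD, h'⟩ := A.exists_eLpNorm_piece_le g c.2
    refine ⟨SNormLESNormFDerivOfEqConst ℝ (volume : Measure 𝔼) (2 : NNReal) * D,
      ENNReal.mul_ne_top ENNReal.coe_ne_top hD, fun φ hφ => ?_⟩
    have hs := eLpNorm_le_eLpNorm_fderiv_of_eq (volume : Measure 𝔼) (p := 2)
      (p' := Real.toNNReal (2 * n / (n - 2))) ((A.contDiff_piece c hφ).of_le (by simp))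
      (A.hasCompactSupport_piece c φ) (by norm_num) (by rw [finrank_euclideanSpace_fin]; omega) (by
        rw [Real.coe_toNNReal _ (by linarith), finrank_euclideanSpace_fin]
        push_cast
        have h2 : (n : ℝ) - 2 ≠ 0 := by linarith
        have h3 : (n : ℝ) ≠ 0 := by linarith
        field_simp)
    refine hs.trans ?_
    rw [mul_assoc]
    gcongr
    exact (h' φ hφ).2
  choose D hD h' using hex
  refine ⟨C * ∑ c : A.index, D c, ENNReal.mul_ne_top hC
    (ENNReal.sum_lt_top.2 fun c _ => (hD c).lt_top).ne, fun φ hφ => (h φ hφ.continuous).trans ?_⟩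
  rw [mul_assoc, ← Finset.sum_coe_sort, Finset.sum_mul]
  gcongr with c
  exact h' c φ hφ

/-- Euclidean Rellich is applied to the pieces in one chart after the other, passing to a further
subsequence each time. Along the final one all pieces are Cauchy in `L²`, hence so are the
functions. -/
theorem exists_rellich (g : RMetric n M) (φ : ℕ → M → ℝ)
    (hφ : ∀ k, ContMDiff (𝓡 n) 𝓘(ℝ, ℝ) ∞ (φ k)) {C : ℝ≥0∞} (hC : C ≠ ⊤)
    (h1 : ∀ k, eLpNorm (φ k) 2 (vol g) ≤ C) (h2 : ∀ k, eLpNorm (A.gradient g (φ k)) 2 (vol g) ≤ C) :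
    ∃ (σ : ℕ → ℕ) (u : M → ℝ), StrictMono σ ∧ MemLp u 2 (vol g) ∧
      Tendsto (fun k => eLpNorm (φ (σ k) - u) 2 (vol g)) atTop (𝓝 0) := by
  classical
  have key : ∀ T : Finset M, T ⊆ A.index → ∃ σ : ℕ → ℕ, StrictMono σ ∧ ∀ c ∈ T, ∀ ε : ℝ≥0∞, 0 < ε →
      ∃ N, ∀ k ≥ N, ∀ l ≥ N, eLpNorm (A.piece c (φ (σ k)) - A.piece c (φ (σ l))) 2 volume < ε := by
    intro T
    induction T using Finset.induction_on with
    | empty => exact fun _ => ⟨id, strictMono_id, by simp⟩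
    | insert a T _ ih =>
      intro hT
      obtain ⟨σ, hσ, h⟩ := ih ((Finset.subset_insert a T).trans hT)
      obtain ⟨D, hD, hb⟩ := A.exists_eLpNorm_piece_le g (hT (Finset.mem_insert_self a T))
      obtain ⟨τ, hτ, h'⟩ := rellich_euclidean (f := fun k => A.piece a (φ (σ k)))
        (A.isCompact_chartSupp a)
        (fun k => (A.contDiff_piece a (hφ _)).of_le (by simp)) (fun k => A.support_piece a _)
        (C := D * (C + C)) (ENNReal.mul_ne_top hD (ENNReal.add_ne_top.2 ⟨hC, hC⟩))
        (fun k => ((hb _ (hφ _)).1).trans (by gcongr; exact (h1 _).trans le_self_add))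
        (fun k => ((hb _ (hφ _)).2).trans (by gcongr; exacts [h1 _, h2 _]))
      refine ⟨σ ∘ τ, hσ.comp hτ, fun c hc ε hε => ?_⟩
      rcases Finset.mem_insert.1 hc with rfl | hc
      · exact h' ε hε
      · obtain ⟨N, hN⟩ := h c hc ε hε
        exact ⟨N, fun k hk l hl => hN _ (hk.trans (hτ.id_le k)) _ (hl.trans (hτ.id_le l))⟩
  obtain ⟨σ, hσ, h⟩ := key A.index subset_rfl
  obtain ⟨D, hD, hsum⟩ := A.exists_eLpNorm_le_sum_piece g 2 (by norm_num)
  have hmem : ∀ k, MemLp (φ (σ k)) 2 (vol g) := fun k => memLp_smooth (hφ _) 2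
  have hcau : CauchySeq fun k => (hmem k).toLp (φ (σ k)) := by
    rw [Lp.cauchySeq_Lp_iff_cauchySeq_eLpNorm]
    have hlim : Tendsto (fun z : ℕ × ℕ => D * ∑ c ∈ A.index,
        eLpNorm (A.piece c (φ (σ z.1)) - A.piece c (φ (σ z.2))) 2 volume) atTop (𝓝 0) := by
      have : Tendsto (fun z : ℕ × ℕ => ∑ c ∈ A.index,
          eLpNorm (A.piece c (φ (σ z.1)) - A.piece c (φ (σ z.2))) 2 volume) atTop (𝓝 0) := by
        rw [show (0 : ℝ≥0∞) = ∑ c ∈ A.index, 0 by simp]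
        refine tendsto_finsetSum _ fun c hc => ENNReal.tendsto_nhds_zero.2 fun ε hε => ?_
        obtain ⟨N, hN⟩ := h c hc ε hε
        filter_upwards [Filter.eventually_ge_atTop (N, N)] with z hz
        exact (hN _ hz.1 _ hz.2).le
      simpa using ENNReal.Tendsto.const_mul this (Or.inr hD)
    refine tendsto_of_tendsto_of_tendsto_of_le_of_le tendsto_const_nhds hlim (fun z => zero_le)
      fun z => ?_
    beta_reduce
    rw [eLpNorm_congr_ae ((hmem z.1).coeFn_toLp.sub (hmem z.2).coeFn_toLp)]
    refine (hsum _ ((hφ _).continuous.sub (hφ _).continuous)).trans_eq ?_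
    simp only [A.piece_sub]
  obtain ⟨u, hu⟩ := cauchySeq_tendsto_of_complete hcau
  refine ⟨σ, u, hσ, Lp.memLp u, ?_⟩
  have := (Lp.tendsto_Lp_iff_tendsto_eLpNorm'' _ hmem u (Lp.memLp u)).1
    (by simpa only [Lp.toLp_coeFn] using hu)
  exact this

end ChartCover

end NodalYamabe

end

/-! ### Closability of the gradient on the manifold -/

noncomputable section

namespace NodalYamabe

section Algebra

variable {n : ℕ} {M : Type*} [TopologicalSpace M] [ChartedSpace (EuclideanSpace ℝ (Fin n)) M]
  [IsManifold (𝓡 n) ∞ M]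

theorem grad_add (g : RMetric n M) {φ ψ : M → ℝ} (hφ : ContMDiff (𝓡 n) 𝓘(ℝ, ℝ) ∞ φ)
    (hψ : ContMDiff (𝓡 n) 𝓘(ℝ, ℝ) ∞ ψ) (x : M) : grad g (φ + ψ) x = grad g φ x + grad g ψ x := by
  refine eq_of_inner_eq g fun w => ?_
  rw [(g.inner x).map_add, _root_.add_apply, inner_grad, inner_grad, inner_grad,
    mfderiv_add (mdifferentiableAt_of_contMDiff hφ x) (mdifferentiableAt_of_contMDiff hψ x)]
  rfl

theorem grad_smul (g : RMetric n M) {φ : M → ℝ} (hφ : ContMDiff (𝓡 n) 𝓘(ℝ, ℝ) ∞ φ) (a : ℝ) (x : M) :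
    grad g (a • φ) x = a • grad g φ x := by
  refine eq_of_inner_eq g fun w => ?_
  rw [(g.inner x).map_smul, _root_.smul_apply, inner_grad, inner_grad,
    const_smul_mfderiv (mdifferentiableAt_of_contMDiff hφ x)]
  rfl

theorem grad_comp (g : RMetric n M) {φ : M → ℝ} (hφ : ContMDiff (𝓡 n) 𝓘(ℝ, ℝ) ∞ φ) {f : ℝ → ℝ}
    (hf : ContDiff ℝ ∞ f) (x : M) :
    grad g (fun x => f (φ x)) x = deriv f (φ x) • grad g φ x := by
  refine eq_of_inner_eq g fun w => ?_
  have hfd : HasDerivAt f (deriv f (φ x)) (φ x) := (hf.differentiable (by simp) (φ x)).hasDerivAt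
  have h1 : HasMFDerivAt 𝓘(ℝ, ℝ) 𝓘(ℝ, ℝ) f (φ x) _ := hfd.hasFDerivAt.hasMFDerivAt
  have h2 := h1.comp x (mdifferentiableAt_of_contMDiff hφ x).hasMFDerivAt
  rw [(g.inner x).map_smul, _root_.smul_apply, inner_grad, inner_grad,
    show (fun x => f (φ x)) = f ∘ φ from rfl, h2.mfderiv]
  have h3 : ∀ r : ℝ, ContinuousLinearMap.toSpanSingleton ℝ (deriv f (φ x)) r = deriv f (φ x) * r :=
    fun r => by rw [ContinuousLinearMap.toSpanSingleton_apply, smul_eq_mul, mul_comm]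
  exact h3 _

end Algebra

namespace ChartCover

variable {n : ℕ} {M : Type*} [TopologicalSpace M] [ChartedSpace (EuclideanSpace ℝ (Fin n)) M]
  [MeasurableSpace M] [IsManifold (𝓡 n) ∞ M] [T2Space M] [CompactSpace M] [BorelSpace M]
  (A : ChartCover n M)

local notation "𝔼" => EuclideanSpace ℝ (Fin n)

/-- Where a bump function is `1`, the derivative of the piece of `φ k` along `v` is the pairing of
its gradient with the coordinate vector of `v`, and converges in `L²` to the pairing `α v` of `F`.
The pieces tend to zero, so Euclidean closability kills every `α v`, and nondegeneracy of the metric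
kills `F`. -/
theorem gradient_closable (g : RMetric n M) (φ : ℕ → M → ℝ)
    (hφ : ∀ k, ContMDiff (𝓡 n) 𝓘(ℝ, ℝ) ∞ (φ k)) {F : M → 𝔼} (hF : MemLp F 2 (vol g))
    (h0 : Tendsto (fun k => eLpNorm (φ k) 2 (vol g)) atTop (𝓝 0))
    (h1 : Tendsto (fun k => eLpNorm (A.gradient g (φ k) - F) 2 (vol g)) atTop (𝓝 0)) :
    F =ᵐ[vol g] 0 := by
  obtain ⟨C, hC, hb1, hb2⟩ := A.exists_bounds g
  obtain ⟨σ, hσ, hae⟩ := (tendstoInMeasure_of_tendsto_eLpNorm (by norm_num)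
    (fun k => A.aestronglyMeasurable_gradient (hφ k)) hF.1 h1).exists_seq_tendsto_ae
  have key : ∀ c ∈ A.index, vol g (A.core c ∩ {x | F x ≠ 0}) = 0 := by
    intro c hc
    set O : Set 𝔼 := (extChartAt (𝓡 n) c).target ∩ (extChartAt (𝓡 n) c).symm ⁻¹' A.core c with hO
    have hOo : IsOpen O := (continuousOn_extChartAt_symm (I := 𝓡 n) c).isOpen_inter_preimage
      (isOpen_extChartAt_target c) (A.isOpen_core c)
    have hOZ : O ⊆ A.chartSupp c := Set.inter_subset_inter_right _
      (Set.preimage_mono (A.core_subset_supp c))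
    have hOs : ∀ y ∈ O, (extChartAt (𝓡 n) c).symm y ∈ A.supp c := fun y hy => (hOZ hy).2
    let α : 𝔼 → 𝔼 → ℝ := fun v y => g.inner ((extChartAt (𝓡 n) c).symm y)
      (A.vec _ (F ((extChartAt (𝓡 n) c).symm y))) (NodalYamabe.vec c _ v)
    have hfd : ∀ k, ∀ y ∈ O, ∀ v, fderiv ℝ (A.piece c (φ k)) y v
        = g.inner ((extChartAt (𝓡 n) c).symm y) (grad g (φ k) ((extChartAt (𝓡 n) c).symm y))
          (NodalYamabe.vec c _ v) := by
      intro k y hy v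
      have heq : A.piece c (φ k) =ᶠ[𝓝 y] fun z => φ k ((extChartAt (𝓡 n) c).symm z) := by
        filter_upwards [hOo.mem_nhds hy] with z hz
        rw [A.piece_apply hz.1, A.bump_core hz.2, one_mul]
      rw [heq.fderiv_eq, ← fderiv_comp_symm_eq_inner g (hφ k) (A.supp_subset c (hOs y hy)),
        (extChartAt (𝓡 n) c).right_inv hy.1]
    have hdiff : ∀ k, ∀ y ∈ O, ∀ v, ‖fderiv ℝ (A.piece c (φ k)) y v - α v y‖ ≤ (C * ‖v‖) *
        ‖(A.gradient g (φ k) - F) ((extChartAt (𝓡 n) c).symm y)‖ := by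
      intro k y hy v
      rw [hfd k y hy v, Real.norm_eq_abs]
      have h2 := A.norm_fderiv_comp_symm_le hC hb1 (hb2 c hc) (hOs y hy)
        (grad g (φ k) ((extChartAt (𝓡 n) c).symm y)
          - A.vec _ (F ((extChartAt (𝓡 n) c).symm y))) v
      rw [(g.inner _).map_sub, _root_.sub_apply, map_sub, A.coord_vec] at h2
      refine h2.trans_eq ?_
      rw [mul_right_comm]
      rfl
    obtain ⟨D, hD, hcmp⟩ := exists_eLpNorm_comparison g c (A.isCompact_supp c)
      (A.measurableSet_supp c) (A.supp_subset c) 2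
    have hOm := hOo.measurableSet
    -- Measurability comes from writing `α v` as an almost everywhere limit of continuous functions,
    -- along the subsequence on which the gradients converge.
    have hαm : ∀ v, AEStronglyMeasurable (α v) (volume.restrict O) := by
      intro v
      refine aestronglyMeasurable_of_tendsto_ae atTop
        (f := fun k y => fderiv ℝ (A.piece c (φ (σ k))) y v) (fun k =>
          (((A.contDiff_piece c (hφ _)).continuous_fderiv (by simp)).clm_apply
            continuous_const).aestronglyMeasurable) ?_
      have hnull := volume_preimage_null g c (ae_iff.1 hae)
      rw [ae_restrict_iff' hOm, ae_iff]
      refine measure_mono_null (fun y hy => ?_) hnull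
      simp only [Set.mem_ofPred_eq, Classical.not_imp] at hy
      refine ⟨hy.1.1, fun hlim => hy.2 ?_⟩
      rw [tendsto_iff_norm_sub_tendsto_zero] at hlim ⊢
      refine squeeze_zero (fun k => norm_nonneg _) (fun k => hdiff (σ k) y hy.1 v) ?_
      simpa using hlim.const_mul (C * ‖v‖)
    have hle : ∀ k v, eLpNorm (fun y => fderiv ℝ (A.piece c (φ k)) y v - α v y) 2 (volume.restrict O)
        ≤ ENNReal.ofReal (C * ‖v‖) * (D * eLpNorm (A.gradient g (φ k) - F) 2 (vol g)) := by
      intro k v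
      refine (eLpNorm_le_mul_eLpNorm_of_ae_le_mul (g := fun y => (A.gradient g (φ k) - F)
        ((extChartAt (𝓡 n) c).symm y)) ((ae_restrict_iff' hOm).2 (ae_of_all _ fun y hy =>
        hdiff k y hy v)) 2).trans ?_
      gcongr
      refine (eLpNorm_mono_measure _ (Measure.restrict_mono hOZ le_rfl)).trans
        (hcmp _ ((A.aestronglyMeasurable_gradient (hφ k)).sub hF.1)).2
    have hlim : ∀ v, Tendsto (fun k => eLpNorm (fun y => fderiv ℝ (A.piece c (φ k)) y v - α v y) 2
        (volume.restrict O)) atTop (𝓝 0) := by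
      intro v
      refine tendsto_of_tendsto_of_tendsto_of_le_of_le tendsto_const_nhds ?_ (fun k => zero_le)
        (fun k => hle k v)
      have := ENNReal.Tendsto.const_mul (ENNReal.Tendsto.const_mul h1 (Or.inr hD))
        (Or.inr (ENNReal.ofReal_ne_top (r := C * ‖v‖)))
      simpa using this
    -- `α v` is the derivative of the piece of `φ 0` minus their difference, and both are in `L²`.
    have hαL : ∀ v, MemLp (α v) 2 (volume.restrict O) := by
      intro v
      have hf : MemLp (fun y => fderiv ℝ (A.piece c (φ 0)) y v) 2 (volume.restrict O) :=
        ((((A.contDiff_piece c (hφ 0)).continuous_fderiv (by simp)).clm_apply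
          continuous_const).memLp_of_hasCompactSupport
          ((A.hasCompactSupport_piece c (φ 0)).fderiv_apply ℝ v)).restrict O
      have hd : MemLp (fun y => fderiv ℝ (A.piece c (φ 0)) y v - α v y) 2 (volume.restrict O) := by
        refine ⟨hf.1.sub (hαm v), (hle 0 v).trans_lt ?_⟩
        exact ENNReal.mul_lt_top ENNReal.ofReal_lt_top (ENNReal.mul_lt_top hD.lt_top
          ((A.memLp_gradient (hφ 0)).sub hF).2)
      have := hf.sub hd
      refine this.ae_eq (ae_of_all _ fun y => ?_)
      simp
    obtain ⟨D', hD', hpc⟩ := A.exists_eLpNorm_piece_le g hc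
    have h0' : Tendsto (fun k => eLpNorm (A.piece c (φ k)) 2 volume) atTop (𝓝 0) := by
      refine tendsto_of_tendsto_of_tendsto_of_le_of_le tendsto_const_nhds ?_ (fun k => zero_le)
        (fun k => (hpc (φ k) (hφ k)).1)
      simpa using ENNReal.Tendsto.const_mul h0 (Or.inr hD')
    -- Testing only the finitely many basis directions keeps the exceptional set null; linearity
    -- recovers the other directions.
    have hzero : ∀ i : Fin n, ∀ᵐ y, y ∈ O → α (EuclideanSpace.single i 1) y = 0 := fun i =>
      ae_eq_zero_of_tendsto_fderiv hOo _ (fun k => A.contDiff_piece c (hφ k)) (hαL _) h0' (hlim _)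
    have hzero' := ae_iff.1 (ae_all_iff.2 hzero)
    refine measure_mono_null (fun x hx => ?_) (vol_preimage_null g c hzero')
    have hxs := A.supp_subset c (A.core_subset_supp c hx.1)
    refine ⟨hxs, fun hall => hx.2 ?_⟩
    have hyO : extChartAt (𝓡 n) c x ∈ O := by
      refine ⟨(extChartAt (𝓡 n) c).map_source hxs, ?_⟩
      rw [Set.mem_preimage, (extChartAt (𝓡 n) c).left_inv hxs]
      exact hx.1
    have hi : ∀ i, g.inner x (A.vec x (F x)) (NodalYamabe.vec c x (EuclideanSpace.single i 1)) = 0 := by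
      intro i
      have := hall i hyO
      simp only [α] at this
      rwa [(extChartAt (𝓡 n) c).left_inv hxs] at this
    have hv : ∀ v : 𝔼, g.inner x (A.vec x (F x)) (NodalYamabe.vec c x v) = 0 := by
      intro v
      rw [← (EuclideanSpace.basisFun (Fin n) ℝ).sum_repr v]
      simp only [map_sum, map_smul, EuclideanSpace.basisFun_apply, hi, smul_zero,
        Finset.sum_const_zero]
    have h3 : A.vec x (F x) = 0 := by
      by_contra hne
      have := g.pos x _ hne
      have h4 := hv (NodalYamabe.coord c x (A.vec x (F x)))
      rw [NodalYamabe.vec_coord hxs] at h4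
      exact this.ne' h4
    rw [← A.coord_vec x (F x), h3, map_zero]
  rw [Filter.EventuallyEq, ae_iff]
  refine measure_mono_null (t := ⋃ c ∈ A.index, A.core c ∩ {x | F x ≠ 0}) (fun x hx => ?_)
    ((measure_biUnion_null_iff A.index.countable_toSet).2 key)
  simp only [Set.mem_iUnion]
  exact ⟨A.sel x, A.sel_mem x, A.mem_core x, hx⟩

/-- The smooth functions. -/
def smoothFunctions (n : ℕ) (M : Type*) [TopologicalSpace M]
    [ChartedSpace (EuclideanSpace ℝ (Fin n)) M] : Submodule ℝ (M → ℝ) where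
  carrier := {φ | ContMDiff (𝓡 n) 𝓘(ℝ, ℝ) ∞ φ}
  add_mem' hφ hψ := ContMDiff.add hφ hψ
  zero_mem' := contMDiff_const
  smul_mem' a φ hφ := by
    have h : ContMDiff (𝓡 n) 𝓘(ℝ, ℝ) ∞ φ := hφ
    exact (contMDiff_const (c := a)).mul h

theorem contMDiff_coe (φ : smoothFunctions n M) : ContMDiff (𝓡 n) 𝓘(ℝ, ℝ) ∞ (φ : M → ℝ) := φ.2

/-- The gradient on the smooth functions of a compact manifold. -/
def gradientData (hn : 3 ≤ n) (g : RMetric n M) :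
    GradientData (vol g) (EuclideanSpace ℝ (Fin n)) (2 * n / (n - 2)) where
  smooth := smoothFunctions n M
  grad :=
    { toFun := fun φ => A.gradient g φ
      map_add' := fun φ ψ => funext fun x => by
        change A.coord x (grad g ((φ : M → ℝ) + ψ) x) = A.coord x _ + A.coord x _
        rw [grad_add g (contMDiff_coe φ) (contMDiff_coe ψ), map_add]
      map_smul' := fun a φ => funext fun x => by
        change A.coord x (grad g (a • (φ : M → ℝ)) x) = a • A.coord x _
        rw [grad_smul g (contMDiff_coe φ), map_smul] }
  memLp := fun φ => memLp_smooth (contMDiff_coe φ) 2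
  memLp_grad := fun φ => A.memLp_gradient (contMDiff_coe φ)
  comp := fun φ f hf => ⟨⟨fun x => f ((φ : M → ℝ) x), hf.contMDiff.comp (contMDiff_coe φ)⟩, rfl, funext fun x => by
    change A.coord x (grad g (fun x => f ((φ : M → ℝ) x)) x) = _ • A.coord x _
    rw [grad_comp g (contMDiff_coe φ) hf, map_smul]⟩
  closable := fun φ _ hF h0 h1 => A.gradient_closable g (fun k => φ k) (fun k => contMDiff_coe (φ k)) hF h0 h1
  const := Classical.choose (A.exists_sobolev hn g)
  const_ne_top := (Classical.choose_spec (A.exists_sobolev hn g)).1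
  sobolev := fun φ => (Classical.choose_spec (A.exists_sobolev hn g)).2 φ (contMDiff_coe φ)
  rellich := fun φ _ hC h1 h2 => A.exists_rellich g (fun k => φ k) (fun k => contMDiff_coe (φ k)) hC h1 h2

end ChartCover

end NodalYamabe

end

noncomputable section

namespace NodalYamabe

/-! ### The Sobolev space and the quadratic form -/

theorem tendsto_zero_of_sq_le {a b : ℕ → ℝ≥0∞} {C : ℝ≥0∞} (hC : C ≠ ⊤)
    (hb : Tendsto b atTop (𝓝 0)) (h : ∀ k, a k ^ 2 ≤ C * b k) : Tendsto a atTop (𝓝 0) := by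
  have h1 : Tendsto (fun k => a k ^ 2) atTop (𝓝 0) :=
    tendsto_of_tendsto_of_tendsto_of_le_of_le tendsto_const_nhds
      (by simpa using ENNReal.Tendsto.const_mul hb (Or.inr hC)) (fun _ => zero_le) h
  have h2 := h1.ennrpow_const (1 / 2)
  rw [ENNReal.zero_rpow_of_pos (by norm_num)] at h2
  refine h2.congr fun k => ?_
  rw [← ENNReal.rpow_natCast, ← ENNReal.rpow_mul]
  norm_num

namespace ChartCover

variable {n : ℕ} {M : Type*} [TopologicalSpace M] [ChartedSpace (EuclideanSpace ℝ (Fin n)) M]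
  [MeasurableSpace M] [IsManifold (𝓡 n) ∞ M] [T2Space M] [CompactSpace M] [BorelSpace M]
  (A : ChartCover n M)

local notation "𝔼" => EuclideanSpace ℝ (Fin n)

/-- A chart coordinate times the bump function is a globally smooth function, equal to the
coordinate near the points where the chart is selected. Testing the vector field on these functions
recovers its components. -/
theorem aestronglyMeasurable_coord {μ : Measure M} {X : (x : M) → TangentSpace (𝓡 n) x}
    (h : ∀ φ : M → ℝ, ContMDiff (𝓡 n) 𝓘(ℝ, ℝ) ∞ φ →
      AEMeasurable (fun x => (mfderiv (𝓡 n) 𝓘(ℝ, ℝ) φ x (X x) : ℝ)) μ) :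
    AEStronglyMeasurable (fun x => A.coord x (X x)) μ := by
  refine A.aestronglyMeasurable_of_sel fun c _ => ?_
  let φ : Fin n → M → ℝ := fun i x => A.bump c x • (extChartAt (𝓡 n) c x) i
  have hφ : ∀ i, ContMDiff (𝓡 n) 𝓘(ℝ, ℝ) ∞ (φ i) := by
    intro i
    refine (A.bump c).contMDiff_smul ?_
    have h1 : ContMDiff (𝓡 n) 𝓘(ℝ, ℝ) ∞ (EuclideanSpace.proj i : 𝔼 →L[ℝ] ℝ) :=
      (EuclideanSpace.proj i : 𝔼 →L[ℝ] ℝ).contDiff.contMDiff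
    exact h1.comp_contMDiffOn contMDiffOn_extChartAt
  have heq : ∀ i x, A.sel x = c →
      (mfderiv (𝓡 n) 𝓘(ℝ, ℝ) (φ i) x (X x) : ℝ) = A.coord x (X x) i := by
    rintro i x rfl
    have h1 : φ i =ᶠ[𝓝 x] (EuclideanSpace.proj i : 𝔼 →L[ℝ] ℝ) ∘ extChartAt (𝓡 n) (A.sel x) := by
      filter_upwards [A.bump_eq_one x] with z hz
      simp only [φ, Function.comp, hz]
      simp
    have h2 := ((EuclideanSpace.proj i : 𝔼 →L[ℝ] ℝ).hasFDerivAt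
      (x := extChartAt (𝓡 n) (A.sel x) x)).hasMFDerivAt.comp x
      (mdifferentiableAt_extChartAt' (A.mem_source x)).hasMFDerivAt
    rw [h1.mfderiv_eq, h2.mfderiv]
    rfl
  have h1 : AEMeasurable (fun x => (WithLp.toLp 2 fun i => A.coord x (X x) i : 𝔼))
      (μ.restrict (A.sel ⁻¹' {c})) := by
    refine (WithLp.measurable_toLp 2 _).comp_aemeasurable (aemeasurable_pi_iff.2 fun i => ?_)
    exact ((h (φ i) (hφ i)).mono_measure Measure.restrict_le_self).congr
      ((ae_restrict_iff' (A.measurableSet_sel c)).2 (ae_of_all _ fun x hx => heq i x hx))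
  exact h1.aestronglyMeasurable

theorem aemeasurable_mfderiv {μ : Measure M} {X : (x : M) → TangentSpace (𝓡 n) x}
    (h : AEStronglyMeasurable (fun x => A.coord x (X x)) μ) {φ : M → ℝ}
    (hφ : ContMDiff (𝓡 n) 𝓘(ℝ, ℝ) ∞ φ) :
    AEMeasurable (fun x => (mfderiv (𝓡 n) 𝓘(ℝ, ℝ) φ x (X x) : ℝ)) μ := by
  refine (A.aestronglyMeasurable_of_sel_congr fun c _ => ⟨fun x =>
    ∑ i, fderiv ℝ (fun y => φ ((extChartAt (𝓡 n) c).symm y)) (extChartAt (𝓡 n) c x)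
      (EuclideanSpace.single i 1) * A.coord x (X x) i, ?_, ?_⟩).aemeasurable
  · refine Finset.aestronglyMeasurable_fun_sum _ fun i _ => AEStronglyMeasurable.mul ?_ ?_
    · exact A.aestronglyMeasurable_continuousOn (ContinuousOn.comp (contDiffOn_partialD
        (isOpen_extChartAt_target c) (contDiffOn_comp_symm hφ c) i).continuousOn
        (continuousOn_extChartAt c) (extChartAt (𝓡 n) c).mapsTo)
    · exact (EuclideanSpace.proj i : 𝔼 →L[ℝ] ℝ).continuous.comp_aestronglyMeasurable h.restrict
  · rintro x rfl
    conv_rhs => rw [← A.vec_coord x (X x)]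
    refine Eq.trans ?_ (fderiv_comp_symm hφ (A.mem_source x) (A.coord x (X x)))
    conv_rhs => rw [← (EuclideanSpace.basisFun (Fin n) ℝ).sum_repr (A.coord x (X x))]
    simp only [map_sum, map_smul, EuclideanSpace.basisFun_apply, EuclideanSpace.basisFun_repr,
      smul_eq_mul]
    exact Finset.sum_congr rfl fun i _ => mul_comm _ _

theorem exists_lintegral_comparison (g : RMetric n M) :
    ∃ C : ℝ≥0∞, C ≠ ⊤ ∧ ∀ X : (x : M) → TangentSpace (𝓡 n) x,
      eLpNorm (fun x => A.coord x (X x)) 2 (vol g) ^ 2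
        ≤ C * ∫⁻ x, ENNReal.ofReal (g.inner x (X x) (X x)) ∂(vol g) ∧
      ∫⁻ x, ENNReal.ofReal (g.inner x (X x) (X x)) ∂(vol g)
        ≤ C * eLpNorm (fun x => A.coord x (X x)) 2 (vol g) ^ 2 := by
  obtain ⟨C, hC, h, -⟩ := A.exists_bounds g
  refine ⟨ENNReal.ofReal C, ENNReal.ofReal_ne_top, fun X => ?_⟩
  have hsq : ∀ x, ‖A.coord x (X x)‖ₑ ^ 2 = ENNReal.ofReal (‖A.coord x (X x)‖ ^ 2) := fun x => by
    rw [ENNReal.ofReal_pow (norm_nonneg _), ofReal_norm]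
  rw [eLpNorm_two_eq, ← lintegral_const_mul' _ _ ENNReal.ofReal_ne_top,
    ← lintegral_const_mul' _ _ ENNReal.ofReal_ne_top]
  constructor
  · refine lintegral_mono fun x => ?_
    rw [hsq, ← ENNReal.ofReal_mul hC.le]
    have := (h x (A.coord x (X x))).1
    rw [A.vec_coord] at this
    exact ENNReal.ofReal_le_ofReal this
  · refine lintegral_mono fun x => ?_
    rw [hsq, ← ENNReal.ofReal_mul hC.le]
    exact ENNReal.ofReal_le_ofReal (A.inner_coord_le h x (X x))

/-- Taking components in the selected chart changes the `L²` norm of vector fields only by bounded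
factors and preserves measurability in both directions, so the two closures of the smooth functions
coincide. -/
theorem isSobolevGradient_iff (hn : 3 ≤ n) (g : RMetric n M) (u : M → ℝ)
    (X : (x : M) → TangentSpace (𝓡 n) x) :
    IsSobolevGradient g u X ↔ (A.gradientData hn g).IsGrad u fun x => A.coord x (X x) := by
  obtain ⟨C, hC, h⟩ := A.exists_lintegral_comparison g
  have hdiff : ∀ φ : M → ℝ, (fun x => A.coord x (X x - grad g φ x))
      = (fun x => A.coord x (X x)) - A.gradient g φ := fun φ => by
    funext x
    rw [map_sub]
    rfl
  constructor
  · rintro ⟨hu, hm, φ, hφ, h1, h2⟩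
    have hm' := A.aestronglyMeasurable_coord hm
    have h3 : Tendsto (fun k => eLpNorm ((fun x => A.coord x (X x)) - A.gradient g (φ k)) 2 (vol g))
        atTop (𝓝 0) := by
      refine tendsto_zero_of_sq_le hC h2 fun k => ?_
      rw [← hdiff]
      exact (h fun x => X x - grad g (φ k) x).1
    have hX : MemLp (fun x => A.coord x (X x)) 2 (vol g) := by
      obtain ⟨k, hk⟩ := (h3.eventually (gt_mem_nhds ENNReal.zero_lt_top)).exists
      have h4 : MemLp ((fun x => A.coord x (X x)) - A.gradient g (φ k)) 2 (vol g) :=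
        ⟨hm'.sub (A.aestronglyMeasurable_gradient (hφ k)), hk⟩
      have h5 := h4.add (A.memLp_gradient (g := g) (hφ k))
      rwa [sub_add_cancel] at h5
    let Φ : ℕ → (A.gradientData hn g).smooth := fun k => ⟨φ k, hφ k⟩
    refine GradientData.IsGrad.of_tendsto (fun k => GradientData.isGrad_smooth (Φ k)) hu hX ?_ ?_
    · refine h1.congr fun k => eLpNorm_sub_comm _ _ _ _
    · refine h3.congr fun k => eLpNorm_sub_comm _ _ _ _
  · intro hG
    obtain ⟨φ, h1, h2⟩ := hG.exists_approx
    refine ⟨hG.memLp, fun ψ hψ => A.aemeasurable_mfderiv hG.memLp_grad.1 hψ, fun k => φ k,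
      fun k => contMDiff_coe (φ k), h1.congr fun k => eLpNorm_sub_comm _ _ _ _, ?_⟩
    have h3 : Tendsto (fun k => C * eLpNorm ((fun x => A.coord x (X x))
        - A.gradient g (φ k : M → ℝ)) 2 (vol g) ^ 2) atTop (𝓝 0) := by
      have h4 : Tendsto (fun k => eLpNorm ((fun x => A.coord x (X x))
        - A.gradient g (φ k : M → ℝ)) 2 (vol g)) atTop (𝓝 0) :=
        h2.congr fun k => eLpNorm_sub_comm _ _ _ _
      have h5 := ENNReal.Tendsto.const_mul (ENNReal.Tendsto.pow (n := 2) h4) (Or.inr hC)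
      simpa using h5
    refine tendsto_of_tendsto_of_tendsto_of_le_of_le tendsto_const_nhds h3 (fun _ => zero_le)
      fun k => ?_
    beta_reduce
    rw [← hdiff]
    exact (h fun x => X x - grad g (φ k) x).2

theorem mem_H1_iff (hn : 3 ≤ n) (g : RMetric n M) (u : M → ℝ) :
    u ∈ H1 g ↔ u ∈ (A.gradientData hn g).space := by
  constructor
  · rintro ⟨X, hX⟩
    exact ⟨_, (A.isSobolevGradient_iff hn g u X).1 hX⟩
  · rintro ⟨F, hF⟩
    refine ⟨fun x => A.vec x (F x), (A.isSobolevGradient_iff hn g u _).2 ?_⟩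
    simpa only [A.coord_vec] using hF

theorem isGrad_sobolevGrad (hn : 3 ≤ n) (g : RMetric n M) {u : M → ℝ}
    (hu : u ∈ (A.gradientData hn g).space) :
    (A.gradientData hn g).IsGrad u fun x => A.coord x (sobolevGrad g u x) := by
  have h : ∃ X, IsSobolevGradient g u X := (A.mem_H1_iff hn g u).2 hu
  rw [← A.isSobolevGradient_iff hn, sobolevGrad, dif_pos h]
  exact Classical.choose_spec h

/-- In selected components the metric lies between multiples of the Euclidean one. The potential is
bounded above since the scalar curvature is continuous on a compact space, and below by the
coercivity assumption. -/
theorem exists_ellipticForm [Nonempty M] (g : RMetric n M) (m : ℕ) {ε : ℝ} (hε : 0 < ε)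
    (hcoer : ∃ c : ℝ, 0 < c ∧ ∀ x : M, c < 1 + scalarCurvature g x / aConst (m + n) * ε ^ 2) :
    ∃ B : EllipticForm (vol g) 𝔼, (∀ x (X Y : TangentSpace (𝓡 n) x),
      B.b x (A.coord x X) (A.coord x Y) = ε ^ 2 * g.inner x X Y) ∧
      ∀ x, B.V x = potential g m ε x := by
  obtain ⟨C, hC, h, -⟩ := A.exists_bounds g
  obtain ⟨c, hc, hcV⟩ := hcoer
  have hVc : Continuous (potential g m ε) :=
    (((continuous_scalarCurvature g).div_const _).mul continuous_const).add continuous_const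
  obtain ⟨D, hD⟩ := isCompact_univ.exists_bound_of_continuousOn hVc.continuousOn
  let b : M → 𝔼 →ₗ[ℝ] 𝔼 →ₗ[ℝ] ℝ := fun x => LinearMap.mk₂ ℝ
    (fun v w => ε ^ 2 * g.inner x (A.vec x v) (A.vec x w))
    (fun v v' w => by simp only [map_add, _root_.add_apply, mul_add])
    (fun a v w => by simp only [map_smul, _root_.smul_apply, smul_eq_mul]; ring)
    (fun v w w' => by simp only [map_add, mul_add])
    (fun a v w => by simp only [map_smul, smul_eq_mul]; ring)
  refine ⟨⟨b, potential g m ε, min (ε ^ 2 / C) c, max (ε ^ 2 * C) D, lt_min (by positivity) hc,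
    ?_, ?_, ?_, ?_, ?_, ?_, hVc.aestronglyMeasurable⟩, ?_, ?_⟩
  · intro x v w
    simp only [b, LinearMap.mk₂_apply]
    rw [g.symm]
  · intro x v
    simp only [b, LinearMap.mk₂_apply]
    calc min (ε ^ 2 / C) c * ‖v‖ ^ 2 ≤ ε ^ 2 / C * (C * g.inner x (A.vec x v) (A.vec x v)) :=
          mul_le_mul (min_le_left _ _) (h x v).1 (by positivity) (by positivity)
      _ = ε ^ 2 * g.inner x (A.vec x v) (A.vec x v) := by field_simp
  · intro x v w
    simp only [b, LinearMap.mk₂_apply]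
    rw [abs_mul, abs_of_pos (by positivity : 0 < ε ^ 2)]
    have h1 : |g.inner x (A.vec x v) (A.vec x w)| ≤ C * (‖v‖ * ‖w‖) := by
      refine abs_le_of_sq_le_sq ?_ (by positivity)
      refine (inner_sq_le g x _ _).trans ?_
      calc _ ≤ (C * ‖v‖ ^ 2) * (C * ‖w‖ ^ 2) :=
            mul_le_mul (h x v).2 (h x w).2 (inner_self_nonneg g x _) (by positivity)
        _ = _ := by ring
    calc _ ≤ ε ^ 2 * (C * (‖v‖ * ‖w‖)) := by gcongr
      _ = ε ^ 2 * C * (‖v‖ * ‖w‖) := by ring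
      _ ≤ _ := by gcongr; exact le_max_left _ _
  · intro x
    refine (min_le_right _ _).trans ((hcV x).le.trans_eq ?_)
    rw [potential, add_comm]
  · intro x
    exact ((le_abs_self _).trans (hD x trivial)).trans (le_max_right _ _)
  · intro F F' hF hF'
    refine A.aestronglyMeasurable_of_sel_congr fun c _ => ⟨fun x => ε ^ 2 * ∑ i, ∑ j,
      gram g c (extChartAt (𝓡 n) c x) i j * (F x i * F' x j), ?_, ?_⟩
    · refine aestronglyMeasurable_const.mul (Finset.aestronglyMeasurable_fun_sum _ fun i _ =>
        Finset.aestronglyMeasurable_fun_sum _ fun j _ => AEStronglyMeasurable.mul ?_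
          (AEStronglyMeasurable.mul ?_ ?_))
      · exact A.aestronglyMeasurable_continuousOn (ContinuousOn.comp
          (contDiffOn_gram g c i j).continuousOn
          (continuousOn_extChartAt c) (extChartAt (𝓡 n) c).mapsTo)
      · exact (EuclideanSpace.proj i : 𝔼 →L[ℝ] ℝ).continuous.comp_aestronglyMeasurable hF.restrict
      · exact (EuclideanSpace.proj j : 𝔼 →L[ℝ] ℝ).continuous.comp_aestronglyMeasurable hF'.restrict
    · rintro x rfl
      simp only [b, LinearMap.mk₂_apply]
      rw [← inner_vec g (A.mem_source x)]
      rfl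
  · intro x X Y
    simp only [b, LinearMap.mk₂_apply, A.vec_coord]
  · exact fun x => rfl

/-- A chart coordinate minus its value at the centre, cut off by a bump function, takes every value
near `0`; so both sign sets are nonempty and open, hence of positive volume. -/
theorem exists_sign_changing_smooth [Nonempty M] (hn : 3 ≤ n) (g : RMetric n M) :
    ∃ φ : M → ℝ, ContMDiff (𝓡 n) 𝓘(ℝ, ℝ) ∞ φ ∧ 0 < vol g {x | 0 < φ x} ∧ 0 < vol g {x | φ x < 0} := by
  obtain ⟨c⟩ := ‹Nonempty M›
  let χ : SmoothBumpFunction (𝓡 n) c := Classical.arbitrary _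
  let i : Fin n := ⟨0, by omega⟩
  let a : ℝ := (extChartAt (𝓡 n) c c) i
  let φ : M → ℝ := fun x => χ x • ((extChartAt (𝓡 n) c x) i - a)
  have hφ : ContMDiff (𝓡 n) 𝓘(ℝ, ℝ) ∞ φ := by
    refine χ.contMDiff_smul ?_
    have h1 : ContMDiff (𝓡 n) 𝓘(ℝ, ℝ) ∞ fun y : 𝔼 => y i - a :=
      ((EuclideanSpace.proj i : 𝔼 →L[ℝ] ℝ).contDiff.sub contDiff_const).contMDiff
    exact h1.comp_contMDiffOn contMDiffOn_extChartAt
  have hnear : ∀ᶠ t : ℝ in 𝓝 0, ∃ x, φ x = t := by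
    have h1 : ∀ᶠ y in 𝓝 (extChartAt (𝓡 n) c c), y ∈ (extChartAt (𝓡 n) c).target ∧
        χ ((extChartAt (𝓡 n) c).symm y) = 1 := by
      refine Filter.Eventually.and
        ((isOpen_extChartAt_target c).mem_nhds (mem_extChartAt_target c)) ?_
      have h2 := continuousAt_extChartAt_symm (I := 𝓡 n) c
      rw [ContinuousAt, extChartAt_to_inv] at h2
      exact h2.eventually χ.eventuallyEq_one
    have h3 : Tendsto (fun t : ℝ => extChartAt (𝓡 n) c c + t • EuclideanSpace.single i (1 : ℝ))
        (𝓝 0) (𝓝 (extChartAt (𝓡 n) c c)) := by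
      have : Continuous fun t : ℝ => extChartAt (𝓡 n) c c + t • EuclideanSpace.single i (1 : ℝ) := by
        fun_prop
      have h4 := this.tendsto 0
      rwa [zero_smul, add_zero] at h4
    filter_upwards [h3.eventually h1] with t ht
    refine ⟨(extChartAt (𝓡 n) c).symm (extChartAt (𝓡 n) c c
      + t • EuclideanSpace.single i (1 : ℝ)), ?_⟩
    simp only [φ]
    rw [ht.2, (extChartAt (𝓡 n) c).right_inv ht.1]
    simp only [PiLp.add_apply, PiLp.smul_apply, PiLp.single_apply, if_true, smul_eq_mul, a]
    ring
  obtain ⟨δ, hδ, hball⟩ := Metric.eventually_nhds_iff.1 hnear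
  refine ⟨φ, hφ, ?_, ?_⟩
  · refine vol_pos_of_isOpen g (isOpen_lt continuous_const hφ.continuous) ?_
    obtain ⟨x, hx⟩ := hball (y := δ / 2) (by rw [Real.dist_eq, sub_zero, abs_of_pos] <;> linarith)
    exact ⟨x, by rw [Set.mem_ofPred_eq, hx]; linarith⟩
  · refine vol_pos_of_isOpen g (isOpen_lt hφ.continuous continuous_const) ?_
    obtain ⟨x, hx⟩ := hball (y := -(δ / 2))
      (by rw [Real.dist_eq, sub_zero, abs_neg, abs_of_pos] <;> linarith)
    exact ⟨x, by rw [Set.mem_ofPred_eq, hx]; linarith⟩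

end ChartCover

end NodalYamabe

end

/-! ### Subcriticality of the exponent and proof of the theorem -/

noncomputable section

namespace NodalYamabe

theorem two_lt_pConst {k : ℕ} (hk : 3 ≤ k) : 2 < pConst k := by
  have : (3 : ℝ) ≤ k := by exact_mod_cast hk
  rw [pConst, lt_div_iff₀ (by linarith)]
  linarith

/-- `2k/(k - 2)` decreases in `k`, so `m ≥ 1` puts the exponent strictly below the critical one of
dimension `n`; compactness rests on this. -/
theorem pConst_lt {m n : ℕ} (hn : 3 ≤ n) (hm : 1 ≤ m) : pConst (m + n) < 2 * n / (n - 2) := by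
  have h1 : (3 : ℝ) ≤ n := by exact_mod_cast hn
  have h2 : (1 : ℝ) ≤ m := by exact_mod_cast hm
  rw [pConst]
  push_cast
  rw [div_lt_div_iff₀ (by linarith) (by linarith)]
  nlinarith

namespace ChartCover

variable {n : ℕ} {M : Type*} [TopologicalSpace M] [ChartedSpace (EuclideanSpace ℝ (Fin n)) M]
  [MeasurableSpace M] [IsManifold (𝓡 n) ∞ M] [T2Space M] [CompactSpace M] [BorelSpace M]
  [Nonempty M] (A : ChartCover n M) {hn : 3 ≤ n} {g : RMetric n M} {m : ℕ} {ε : ℝ}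
  {B : EllipticForm (vol g) (EuclideanSpace ℝ (Fin n))}

theorem bilin_eq (hB : ∀ x (X Y : TangentSpace (𝓡 n) x),
      B.b x (A.coord x X) (A.coord x Y) = ε ^ 2 * g.inner x X Y)
    (hV : ∀ x, B.V x = potential g m ε x) (u v : (A.gradientData hn g).space) :
    bilin g m ε u v = 1 / ε ^ n * GradientData.form B u v := by
  rw [bilin, GradientData.form_eq B (A.isGrad_sobolevGrad hn g u.2)
    (A.isGrad_sobolevGrad hn g v.2)]
  congr 1
  refine integral_congr_ae (ae_of_all _ fun x => ?_)
  simp only [EllipticForm.density, hB, hV]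

theorem energy_eq (hB : ∀ x (X Y : TangentSpace (𝓡 n) x),
      B.b x (A.coord x X) (A.coord x Y) = ε ^ 2 * g.inner x X Y)
    (hV : ∀ x, B.V x = potential g m ε x) (u : (A.gradientData hn g).space)
    (hpow : Integrable (fun x => |(u : M → ℝ) x| ^ pConst (m + n)) (vol g)) :
    energy g m ε u = 1 / ε ^ n * (1 / 2 * GradientData.form B u u
      - 1 / pConst (m + n) * ∫ x, |(u : M → ℝ) x| ^ pConst (m + n) ∂(vol g)) := by
  have hu := A.isGrad_sobolevGrad hn g u.2
  have hd := B.integrable_density hu.memLp hu.memLp_grad hu.memLp hu.memLp_grad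
  have h1 := integral_sub (hd.const_mul (1 / 2)) (hpow.const_mul (1 / pConst (m + n)))
  rw [integral_const_mul, integral_const_mul] at h1
  rw [energy, GradientData.form_eq B hu hu, ← h1]
  congr 1
  refine integral_congr_ae (ae_of_all _ fun x => ?_)
  simp only [EllipticForm.density, hB, hV]
  ring

/-- The variational problem on `H¹_g(M)`, up to the factor `ε⁻ⁿ`, as a compact form. -/
theorem exists_compactForm (A : ChartCover n M) (hn : 3 ≤ n) (hm : 1 ≤ m) (g : RMetric n M) (hε : 0 < ε)
    (hcoer : ∃ c : ℝ, 0 < c ∧ ∀ x : M, c < 1 + scalarCurvature g x / aConst (m + n) * ε ^ 2) :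
    ∃ S : CompactForm (vol g) (pConst (m + n)), (∀ u, u ∈ H1 g ↔ u ∈ S.space) ∧
      (∀ u v : S.space, bilin g m ε u v = 1 / ε ^ n * S.form u v) ∧
      ∀ u : S.space, energy g m ε u = 1 / ε ^ n * S.functional u := by
  obtain ⟨B, hB, hV⟩ := A.exists_ellipticForm g m hε hcoer
  have hp : 2 < pConst (m + n) := two_lt_pConst (by omega)
  exact ⟨(A.gradientData hn g).compactForm B hp (pConst_lt hn hm), A.mem_H1_iff hn g,
    A.bilin_eq hB hV, fun u => A.energy_eq hB hV u (CompactForm.integrable_power _ hp u)⟩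

end ChartCover

section

variable {n : ℕ} {M : Type*} [TopologicalSpace M] [ChartedSpace (EuclideanSpace ℝ (Fin n)) M]
  [MeasurableSpace M] [IsManifold (𝓡 n) ∞ M] {g : RMetric n M} {m : ℕ} {ε : ℝ}

theorem lqNorm_rpow {p : ℝ} (hp : 0 < p) (hε : 0 < ε) (u : M → ℝ) :
    lqNorm g p ε u ^ p = 1 / ε ^ n * ∫ x, |u x| ^ p ∂(vol g) := by
  rw [lqNorm, ← Real.rpow_mul, one_div_mul_cancel hp.ne', Real.rpow_one]
  exact mul_nonneg (by positivity) (integral_nonneg fun x => by positivity)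

variable {S : CompactForm (vol g) (pConst (m + n))}

/-- Both sides of the Nehari identity carry the same factor `ε⁻ⁿ`, which cancels. -/
theorem mem_nehari_iff (hε : 0 < ε) (hp : 0 < pConst (m + n)) (hS : ∀ u, u ∈ H1 g ↔ u ∈ S.space)
    (hform : ∀ u v : S.space, bilin g m ε u v = 1 / ε ^ n * S.form u v) (u : S.space) :
    (u : M → ℝ) ∈ nehari g m ε ↔ u ∈ S.nehariSet := by
  have h2 : lqNorm g (pConst (m + n)) ε u ^ pConst (m + n) = 1 / ε ^ n * S.power u := by
    rw [lqNorm_rpow hp hε, CompactForm.power]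
  have h3 : (1 / ε ^ n : ℝ) ≠ 0 := by positivity
  constructor
  · rintro ⟨-, h, he⟩
    rw [hform, h2] at he
    exact ⟨h, mul_left_cancel₀ h3 he⟩
  · rintro ⟨h, he⟩
    refine ⟨(hS u).2 u.2, h, ?_⟩
    rw [hform, h2, he]

theorem mem_nodalNehari_iff (hS : ∀ u, u ∈ H1 g ↔ u ∈ S.space)
    (hN : ∀ u : S.space, (u : M → ℝ) ∈ nehari g m ε ↔ u ∈ S.nehariSet) (u : S.space) :
    (u : M → ℝ) ∈ nodalNehari g m ε ↔ u ∈ S.nodalSet := by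
  have h1 := hN (S.pos u)
  have h2 := hN (S.neg u)
  rw [S.coe_neg] at h2
  rw [S.coe_pos] at h1
  constructor
  · rintro ⟨-, a, b⟩
    exact ⟨h1.1 a, h2.1 b⟩
  · rintro ⟨a, b⟩
    exact ⟨(hS u).2 u.2, h1.2 a, h2.2 b⟩

end

theorem measure_pos_of_posPart_ne {X : Type*} [MeasurableSpace X] {μ : Measure X} {u : X → ℝ}
    (h : ¬ (fun x => max (u x) 0) =ᵐ[μ] 0) : 0 < μ {x | 0 < u x} := by
  rw [pos_iff_ne_zero]
  intro h0
  refine h (ae_iff.2 (measure_mono_null (fun x hx => ?_) h0))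
  by_contra hle
  exact hx (max_eq_right (not_lt.1 hle))

theorem measure_pos_of_negPart_ne {X : Type*} [MeasurableSpace X] {μ : Measure X} {u : X → ℝ}
    (h : ¬ (fun x => min (u x) 0) =ᵐ[μ] 0) : 0 < μ {x | u x < 0} := by
  rw [pos_iff_ne_zero]
  intro h0
  refine h (ae_iff.2 (measure_mono_null (fun x hx => ?_) h0))
  by_contra hle
  exact hx (min_eq_right (not_lt.1 hle))

theorem posPart_ne_of_measure_pos {X : Type*} [MeasurableSpace X] {μ : Measure X} {u : X → ℝ}
    (h : 0 < μ {x | 0 < u x}) : ¬ (fun x => max (u x) 0) =ᵐ[μ] 0 := by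
  intro h0
  refine h.ne' (measure_mono_null (fun x hx => ?_) (ae_iff.1 h0))
  intro he
  exact absurd (max_eq_right_iff.1 he) (not_le.2 hx)

theorem negPart_ne_of_measure_pos {X : Type*} [MeasurableSpace X] {μ : Measure X} {u : X → ℝ}
    (h : 0 < μ {x | u x < 0}) : ¬ (fun x => min (u x) 0) =ᵐ[μ] 0 := by
  intro h0
  refine h.ne' (measure_mono_null (fun x hx => ?_) (ae_iff.1 h0))
  intro he
  exact absurd (min_eq_right_iff.1 he) (not_le.2 hx)

end NodalYamabe

end

open NodalYamabe in
theorem theorem1p1 {n : ℕ} (hn : 3 ≤ n) {m : ℕ} (hm : 1 ≤ m)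
    {M : Type*} [TopologicalSpace M] [T2Space M] [CompactSpace M] [Nonempty M]
    [ChartedSpace (EuclideanSpace ℝ (Fin n)) M] [IsManifold (𝓡 n) ∞ M]
    [MeasurableSpace M] [BorelSpace M]
    (g : RMetric n M) (ε : ℝ) (hε : 0 < ε)
    (hcoer : ∃ c : ℝ, 0 < c ∧ ∀ x : M, c < 1 + scalarCurvature g x / aConst (m + n) * ε ^ 2) :
    (∃ u ∈ nodalNehari g m ε,
      energy g m ε u = nodalLevel g m ε ∧
      (∀ v ∈ nodalNehari g m ε, energy g m ε u ≤ energy g m ε v) ∧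
      SignChanging g u ∧ IsSolution g m ε u) ∧
    IsGLB (energy g m ε '' nehari g m ε) (groundLevel g m ε) ∧
    2 * groundLevel g m ε ≤ nodalLevel g m ε := by
  obtain ⟨A⟩ : Nonempty (ChartCover n M) := exists_chartCover
  obtain ⟨S, hS, hform, hE⟩ := A.exists_compactForm hn hm g hε hcoer
  have hp : 2 < pConst (m + n) := two_lt_pConst (by omega)
  have hε' : 0 < 1 / ε ^ n := by positivity
  have hN := mem_nehari_iff hε (by linarith) hS hform
  have hNN := mem_nodalNehari_iff hS hN
  have hmem : ∀ u : M → ℝ, u ∈ H1 g → u ∈ S.space := fun u => (hS u).1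
  -- A smooth function of both signs makes the nodal set nonempty after rescaling its two parts.
  obtain ⟨φ, hφ, hφ1, hφ2⟩ := ChartCover.exists_sign_changing_smooth hn g
  have hφS : φ ∈ S.space := hmem φ ((A.mem_H1_iff hn g φ).2
    ⟨_, GradientData.isGrad_smooth (D := A.gradientData hn g) ⟨φ, hφ⟩⟩)
  obtain ⟨u, hu, hmin⟩ := S.exists_nodal_minimizer hp ⟨⟨φ, hφS⟩, posPart_ne_of_measure_pos hφ1, by
    rw [S.coe_neg]
    exact negPart_ne_of_measure_pos hφ2⟩
  have hmin' : ∀ v ∈ nodalNehari g m ε, energy g m ε u ≤ energy g m ε v := by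
    intro v hv
    have h1 := hmin ⟨v, hmem v hv.1⟩ ((hNN ⟨v, hmem v hv.1⟩).1 hv)
    rw [hE u]
    refine (mul_le_mul_of_nonneg_left h1 hε'.le).trans_eq ?_
    exact (hE ⟨v, hmem v hv.1⟩).symm
  have hlevel : energy g m ε u = nodalLevel g m ε :=
    (IsLeast.csInf_eq (s := energy g m ε '' nodalNehari g m ε) ⟨⟨u, (hNN u).2 hu, rfl⟩, by
      rintro _ ⟨v, hv, rfl⟩
      exact hmin' v hv⟩).symm
  have hbdd : BddBelow (energy g m ε '' nehari g m ε) := by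
    refine ⟨0, ?_⟩
    rintro _ ⟨v, hv, rfl⟩
    have h1 := S.functional_nonneg hp ((hN ⟨v, hmem v hv.1⟩).1 hv)
    refine (mul_nonneg hε'.le h1).trans_eq ?_
    exact (hE ⟨v, hmem v hv.1⟩).symm
  have hne : (energy g m ε '' nehari g m ε).Nonempty := ⟨_, _, (hN _).2 hu.1, rfl⟩
  have hground : ∀ v ∈ S.nehariSet, groundLevel g m ε ≤ 1 / ε ^ n * S.functional v := by
    intro v hv
    rw [← hE v]
    exact csInf_le hbdd ⟨v, (hN v).2 hv, rfl⟩
  refine ⟨⟨u, (hNN u).2 hu, hlevel, hmin', ⟨?_, ?_⟩, (hS u).2 u.2, fun v hv => ?_⟩,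
    isGLB_csInf hne hbdd, ?_⟩
  · exact measure_pos_of_posPart_ne hu.1.1
  · have h1 := hu.2.1
    rw [S.coe_neg] at h1
    exact measure_pos_of_negPart_ne h1
  · refine ⟨S.integrable_mul hp u ⟨v, hmem v hv⟩, ?_⟩
    have h1 : bilin g m ε u v = 1 / ε ^ n * S.form u ⟨v, hmem v hv⟩ := hform u ⟨v, hmem v hv⟩
    have h2 := S.slope_eq_zero_of_minimizer hp hu hmin ⟨v, hmem v hv⟩
    rw [h1, sub_eq_zero.1 h2]
  -- The energy of the minimiser is the sum of the energies of its two parts, each on the Nehari set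
  -- and so at least the ground level.
  · rw [← hlevel, hE u, S.functional_eq_parts hp, mul_add, two_mul]
    exact add_le_add (hground _ hu.1) (hground _ hu.2)
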